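/- **Setting.** Let $p\in\mathbb N\cup\{\infty\}$ and let $x\in\mathbb R^p$ be a random feature vector with law $\mu$ and $\mathbb E[xx^\top]=\Sigma=\mathrm{diag}(\lambda_1,\lambda_2,\dots)$, $\lambda_1\ge\lambda_2\ge\dots>0$; put $z=\Sigma^{-1/2}x$. Let $X\in\mathbb R^{n\times p}$ have $n\geq 2$ i.i.d. rows $x_i\sim\mu$, let $\theta^*\in\mathbb R^p$, let $\lambda\ge 0$, and let $\hat\theta(y)=X^\top(XX^\top+n\lambda I_n)^{-1}y$. The bias is $$\mathcal B=\mathbb E_x\big(x^\top\hat\theta(X\theta^*)-x^\top\theta^*\big)^2,$$ a random variable depending on $X$ (for $p=\infty$, $x^\top\theta^*=\sum_k x_k\theta^*_k$ is understood as a limit in $L^2(\mu)$). Subscripts $\le k$ and $>k$ denote restriction to the first $k$ coordinates and to the remaining ones, and $\|v\|_M=\sqrt{v^\top Mv}$. **Assumptions.** Let $a,r>0$ and $b\in[1+a,\infty]$. For all $1\le k\le p$, $$\underline c_E\,k^{-1-a}\le\lambda_k\le \overline c_E\,k^{-1-a},\qquad |\theta^*_k|\le c_T\,k^{-r},$$ and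 $\underline c_R\, n^{-b}\le\lambda\le \overline c_R\, n^{-b}$ if $b<\infty$, $\lambda=0$ if $b=\infty$, with fixed positive constants. Write $(u)_+=\max\{u,0\}$. **(GF) Generic features.** Let $\alpha,\beta,\kappa>0$. There are $M>0$ and $q\in\mathbb N$, depending only on $a,r,b$, the constants above and $\alpha,\beta,\kappa$, such that for every $\delta\in(0,1)$ there is $K>0$, depending in addition only on $\delta$, with the following property. Suppose that $p=\infty$, or that $p$ is finite with $p\ge\kappa n^2\log n$, and that for all integers $0\le k<p$ $$\operatorname*{ess\,inf}_z\frac{\|z_{>k}\|^2_{\Sigma_{>k}}}{\mathrm{tr}\,\Sigma_{>k}}\ge\alpha,\qquad \operatorname*{ess\,sup}_z\max\Big\{\frac{\|z_{\le k}\|_2^2}{k},\frac{\|z_{>k}\|^2_{\Sigma_{>k}}}{\mathrm{tr}\,\Sigma_{>k}},\frac{\|z_{>k}\|^2_{\Sigma_{>k}^2}}{\mathrm{tr}\,\Sigma_{>k}^2}\Big\}\le\beta$$ (the first fraction being omitted for $k=0$). Then, with probability at least $1-\delta-\frac{M}{\log n}$, $$\mathcal B\le K(\log n)^q\,n^{-\left(\min\{2(r-a),\,2-a\}\right)_+}.$$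 **(IF) Independent features.** Let $G>0$ and $\eta>1$. There are $c_1>0$ and $q\in\mathbb N$, depending only on $a,r,b$, the constants above and $G,\eta$, with $q=0$ if $2r\ne a+2$, such that for every $\delta\in(0,1)$ there is $K>0$, depending in addition only on $\delta$, with the following property. Suppose that $\eta n<p<\infty$ and that the coordinates of $z$ are independent with sub-Gaussian norm $\|z_k\|_{\psi_2}=\inf\{t>0:\mathbb E\,e^{z_k^2/t^2}\le 2\}\le G$. Then, with probability at least $1-\delta-3e^{-c_1n}$, $$\mathcal B\le K(\log n)^q\,n^{-\min\{2r+a,\,2(1+a)\}}.$$ That is, $\mathcal B=\tilde O(n^{-\min\{2r+a,2(1+a)\}})$, and $\mathcal B=O(n^{-\min\{2r+a,2(1+a)\}})$ if $2r\neq a+2$. -/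

import Mathlib

open MeasureTheory ProbabilityTheory Filter Topology
open scoped ENNReal Matrix

noncomputable section

/-! Conventions. Coordinates are numbered from `0`, so `eig k` is the `(k+1)`-st eigenvalue.
The feature dimension is `p : ℕ∞`. For finite `p`, the space `ℝ^p` is regarded as the space of
real sequences all of whose entries of index `≥ p` vanish (the corresponding `eig k` are zero, so
these entries are almost surely zero). A feature distribution is a probability measure on `ℕ → ℝ`;
the input matrix `X : Fin n → ℕ → ℝ` has the `n` samples as its rows. -/

namespace RidgeRegression

/-- The feature vector `x ∼ μ` in `ℝ^p` has second moment matrix `𝔼[x xᵀ] = diag(eig)`, where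
`eig` is nonincreasing and positive on the first `p` coordinates. -/
structure IsFeatureLaw (p : ℕ∞) (eig : ℕ → ℝ) (μ : Measure (ℕ → ℝ)) : Prop where
  antitone : Antitone eig
  pos : ∀ k : ℕ, (k : ℕ∞) < p → 0 < eig k
  zero : ∀ k : ℕ, p ≤ (k : ℕ∞) → eig k = 0
  integrable : ∀ i j : ℕ, Integrable (fun x : ℕ → ℝ => x i * x j) μ
  secondMoment : ∀ i j : ℕ, ∫ x, x i * x j ∂μ = if i = j then eig i else 0

/-- The whitened (isotropic) feature vector `z = Σ^{-1/2} x`. Entries of index `≥ p` are `0`. -/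
def whiten (eig : ℕ → ℝ) (x : ℕ → ℝ) (k : ℕ) : ℝ := x k / √(eig k)

/-- `‖z_{≤k}‖²`, the sum over the first `k` coordinates. -/
def headNormSq (eig : ℕ → ℝ) (k : ℕ) (x : ℕ → ℝ) : ℝ≥0∞ :=
  ∑ l ∈ Finset.range k, ENNReal.ofReal (whiten eig x l ^ 2)

/-- `‖z_{>k}‖²` in the norm given by `Σ_{>k}^m`, the sum over all but the first `k` coordinates. -/
def tailNormSq (eig : ℕ → ℝ) (m k : ℕ) (x : ℕ → ℝ) : ℝ≥0∞ :=
  ∑' l : ℕ, ENNReal.ofReal (eig (k + l) ^ m * whiten eig x (k + l) ^ 2)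

/-- `tr (Σ_{>k}^m)`. -/
def tailTrace (eig : ℕ → ℝ) (m k : ℕ) : ℝ≥0∞ := ∑' l : ℕ, ENNReal.ofReal (eig (k + l) ^ m)

/-- `α_k = ess inf ‖z_{>k}‖²_{Σ_{>k}} / tr Σ_{>k}`. -/
def alphaCoeff (eig : ℕ → ℝ) (μ : Measure (ℕ → ℝ)) (k : ℕ) : ℝ≥0∞ :=
  essInf (fun x => tailNormSq eig 1 k x / tailTrace eig 1 k) μ

/-- `β_k = ess sup max {‖z_{≤k}‖² / k, ‖z_{>k}‖²_{Σ_{>k}} / tr Σ_{>k},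
‖z_{>k}‖²_{Σ_{>k}²} / tr Σ_{>k}²}`. For `k = 0` the first fraction is `0 / 0 = 0`, that is,
it is left out. -/
def betaCoeff (eig : ℕ → ℝ) (μ : Measure (ℕ → ℝ)) (k : ℕ) : ℝ≥0∞ :=
  essSup (fun x => max (headNormSq eig k x / (k : ℝ≥0∞))
    (max (tailNormSq eig 1 k x / tailTrace eig 1 k)
      (tailNormSq eig 2 k x / tailTrace eig 2 k))) μ

/-- Generic features: `α_k` and `β_k` are bounded away from `0` and `∞`, uniformly in `k`.
(The bounds `α_k ≤ 1 ≤ β_k` are automatic, since the fractions have mean `1`.) -/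
def GenericFeatures (p : ℕ∞) (eig : ℕ → ℝ) (μ : Measure (ℕ → ℝ)) (α β : ℝ) : Prop :=
  ∀ k : ℕ, (k : ℕ∞) < p →
    ENNReal.ofReal α ≤ alphaCoeff eig μ k ∧ betaCoeff eig μ k ≤ ENNReal.ofReal β

/-- The sub-Gaussian norm `‖Y‖_{ψ₂} = inf {t > 0 : 𝔼 exp(Y²/t²) ≤ 2}`. -/
def psiTwoNorm {Ω : Type*} [MeasurableSpace Ω] (Y : Ω → ℝ) (μ : Measure Ω) : ℝ≥0∞ :=
  sInf {s : ℝ≥0∞ | ∃ t : ℝ, 0 < t ∧ s = ENNReal.ofReal t ∧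
    ∫⁻ ω, ENNReal.ofReal (Real.exp (Y ω ^ 2 / t ^ 2)) ∂μ ≤ 2}

/-- Independent sub-Gaussian features: the coordinates of `z` are independent with sub-Gaussian
norm at most `G`. -/
def IndependentFeatures (p : ℕ) (eig : ℕ → ℝ) (μ : Measure (ℕ → ℝ)) (G : ℝ) : Prop :=
  iIndepFun (fun (k : ℕ) (x : ℕ → ℝ) => whiten eig x k) μ ∧
    ∀ k : ℕ, k < p → psiTwoNorm (fun x : ℕ → ℝ => whiten eig x k) μ ≤ ENNReal.ofReal G

/-- `eig_k = Θ(k^{-1-a})` for the indices `1, …, p`, with constants `c` and `C`. -/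
def EigenDecay (p : ℕ∞) (a c C : ℝ) (eig : ℕ → ℝ) : Prop :=
  ∀ k : ℕ, (k : ℕ∞) < p →
    c * ((k : ℝ) + 1) ^ (-1 - a) ≤ eig k ∧ eig k ≤ C * ((k : ℝ) + 1) ^ (-1 - a)

/-- `|θ_k| = O(k^{-r})` for the indices `1, …, p`, with constant `C`. -/
def TargetDecay (p : ℕ∞) (r C : ℝ) (θ : ℕ → ℝ) : Prop :=
  ∀ k : ℕ, (k : ℕ∞) < p → |θ k| ≤ C * ((k : ℝ) + 1) ^ (-r)

/-- `lam = Θ(n^{-b})` with constants `c` and `C`, where `b = ∞` means `lam = 0`. -/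
def RidgeDecay (b : EReal) (c C : ℝ) (n : ℕ) (lam : ℝ) : Prop :=
  if b = ⊤ then lam = 0
  else c * (n : ℝ) ^ (-b.toReal) ≤ lam ∧ lam ≤ C * (n : ℝ) ^ (-b.toReal)

/-- `f` is (a version of) the target function `x ↦ xᵀθ = ∑ₖ xₖ θₖ`. The series is taken in `L²(μ)`,
as `θ` need not be square summable when `p = ∞`; for finite `p` this just says that
`f x = ∑_{k<p} xₖ θₖ` for almost every `x`. -/
def IsTargetFunction (μ : Measure (ℕ → ℝ)) (θ : ℕ → ℝ) (f : (ℕ → ℝ) → ℝ) : Prop :=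
  MemLp f 2 μ ∧
    Tendsto (fun N : ℕ => eLpNorm (fun x => f x - ∑ k ∈ Finset.range N, x k * θ k) 2 μ)
      atTop (𝓝 0)

/-- `X Xᵀ + n λ Iₙ`. -/
def kernelMatrix {n : ℕ} (lam : ℝ) (X : Fin n → ℕ → ℝ) : Matrix (Fin n) (Fin n) ℝ :=
  Matrix.of (fun i j => ∑' k : ℕ, X i k * X j k) + ((n : ℝ) * lam) • (1 : Matrix (Fin n) (Fin n) ℝ)

/-- The ridge regressor `θ̂(y) = Xᵀ (X Xᵀ + n λ Iₙ)⁻¹ y`. -/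
def regressor {n : ℕ} (lam : ℝ) (X : Fin n → ℕ → ℝ) (y : Fin n → ℝ) (k : ℕ) : ℝ :=
  ∑ i, X i k * ((kernelMatrix lam X)⁻¹ *ᵥ y) i

/-- The bias `𝔼_x (xᵀ θ̂(Xθ*) - xᵀθ*)²`, where `f x = xᵀθ*`. -/
def bias {n : ℕ} (μ : Measure (ℕ → ℝ)) (f : (ℕ → ℝ) → ℝ) (lam : ℝ) (X : Fin n → ℕ → ℝ) : ℝ≥0∞ :=
  ∫⁻ x, ENNReal.ofReal
    (((∑' k : ℕ, x k * regressor lam X (fun i => f (X i)) k) - f x) ^ 2) ∂μ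

/-- The joint law of `n` independent samples from `μ`. -/
def sampleLaw (n : ℕ) (μ : Measure (ℕ → ℝ)) : Measure (Fin n → ℕ → ℝ) :=
  Measure.pi (fun _ => μ)

end RidgeRegression

end

/-!
# The bias of ridge regression under polynomial spectral decay

Write `‖u‖²_Σ = ∑ λₗ uₗ²` for the population norm and `|X u|² = ∑ᵢ ⟨xᵢ, u⟩²` for the norm on the
sample. Everything is deduced from a *transfer inequality* (`Transfer`)
`‖u‖²_Σ ≤ t (|X u|² + ν ‖u‖²)` for all `u` in `ℓ²`. Let `ρ = n λ`. The residual `e` of ridge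
regression on a target `g` of `ℓ²` satisfies `|X e|² + ρ ‖e‖² = ρ ⟨e, g⟩` and `‖e‖² ≤ ⟨e, g⟩` (by
`residual_identities`), so the transfer inequality gives `‖e‖²_Σ ≤ t (ν + ρ) ⟨e, g⟩`. Bounding
`⟨e, g⟩` by `‖e‖_Σ` times the dual norm of `g`, the bias is at most `(t (ν + ρ))² ∑ gₗ² / λₗ`, with
the square of `t (ν + ρ)`; bounding it by `‖g‖²`, the bias is at most `t (ν + ρ) ‖g‖²`. The target
is split into its coordinates below `n`, treated in the first way, an intermediate block, treated in
the second way, and a tail. The regressor fitted to the sample values of the tail is controlled by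
Markov's inequality and a lower bound on the smallest eigenvalue of the kernel matrix. This is
`bias_le_of_transfer`; what remains is to establish the transfer inequality and the eigenvalue bound
in each of the two cases.

*Generic features.* The transfer inequality, with `t` and `ν` of the order of `n⁻¹` and `n⁻ᵃ` up to
a factor `n^ε`, amounts to an upper bound on the largest eigenvalue of `T = G (I + ∑ yᵢ yᵢᵀ)⁻¹ G`
for independent vectors `yᵢ` of small norm with second moment matrix `G²`. It follows from a bound
on `𝔼 tr Tᵐ` for a large fixed `m` (`integral_trace_pow_le`): removing the `i`-th vector changes its
contribution by a constant factor only (`loo_moment_ge`), so each contribution is, in the mean,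
comparable to `tr Tᵐ`, while their sum is at most `tr Tᵐ⁻¹`. The `m`-th root makes the dimension
factor as small a power of `n` as desired. The smallest eigenvalue of the kernel matrix is at least
of order `n^{-(2+ε)a}`, since with `n² log n` features the off-diagonal entries of the kernel matrix
of the tail are small in Frobenius norm compared with the diagonal ones (`generic_minEig`). This is
weaker than the order `n⁻ᵃ` that one would like to have, but sufficient: up to powers `n^ε` the bias
comes out as `n^{-min {2r, 2+2a}}`, which is better than claimed, and the difference pays for the
powers `n^ε`.

*Independent features.* Net arguments for matrices with independent sub-Gaussian rows give the
transfer inequality with `t` of order `n⁻¹` and `ν` of order `n⁻ᵃ` (`exists_independent_transfer`).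
The features need not be centered, but as they are both uncorrelated and independent, all except at
most one of them are. With at least `A n` features, for a large constant `A`, the smallest
eigenvalue of the kernel matrix is of order `n⁻ᵃ` (`exists_independent_minEig`). With fewer features
there is no tail, and only the invertibility of the kernel matrix is needed; it follows from an
estimate of Odlyzko for the probability that a vector with independent coordinates lies in a given
subspace (`measure_submodule_mul_pow_le`).
-/

set_option linter.unusedSectionVars false

noncomputable section

namespace RidgeRegression

/-! ### Ridge regression in a Hilbert space -/

section Algebra

variable {H : Type*} [NormedAddCommGroup H] [InnerProductSpace ℝ H] {n : ℕ}

/-- The linear combination `∑ cᵢ xᵢ` of the samples, that is, `Xᵀ c`. -/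
def comb (x : Fin n → H) (c : Fin n → ℝ) : H := ∑ i, c i • x i

/-- `X Xᵀ + ρ I` for samples in an abstract Hilbert space. -/
def gramRidge (x : Fin n → H) (ρ : ℝ) : Matrix (Fin n) (Fin n) ℝ :=
  Matrix.of (fun i j => inner ℝ (x i) (x j)) + ρ • (1 : Matrix (Fin n) (Fin n) ℝ)

lemma inner_comb (x : Fin n → H) (c : Fin n → ℝ) (u : H) :
    inner ℝ (comb x c) u = ∑ i, c i * inner ℝ (x i) u := by
  simp [comb, sum_inner, inner_smul_left]

lemma gramRidge_mulVec (x : Fin n → H) (ρ : ℝ) (c : Fin n → ℝ) (i : Fin n) :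
    (gramRidge x ρ *ᵥ c) i = inner ℝ (x i) (comb x c) + ρ * c i := by
  simp only [gramRidge, Matrix.add_mulVec, Matrix.smul_mulVec, Matrix.one_mulVec, Pi.add_apply,
    Pi.smul_apply, smul_eq_mul, comb, inner_sum, inner_smul_right]
  simp [Matrix.mulVec, dotProduct, mul_comm]

lemma norm_comb_sq (x : Fin n → H) (ρ : ℝ) (c : Fin n → ℝ) :
    ‖comb x c‖ ^ 2 + ρ * ∑ i, c i ^ 2 = ∑ i, c i * (gramRidge x ρ *ᵥ c) i := by
  rw [← real_inner_self_eq_norm_sq, inner_comb, Finset.mul_sum, ← Finset.sum_add_distrib]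
  refine Finset.sum_congr rfl fun i _ => ?_
  rw [gramRidge_mulVec]; ring

variable {x : Fin n → H} {ρ : ℝ}

/-- The normal equations: the residual `e` of ridge regression on `θ` satisfies `X e = ρ c`
and `‖e‖² + ρ |c|² = ⟨e, θ⟩`, where `c = (X Xᵀ + ρ I)⁻¹ X θ`. -/
lemma residual_identities (hA : IsUnit (gramRidge x ρ).det) (θ : H) (c : Fin n → ℝ)
    (hc : c = (gramRidge x ρ)⁻¹ *ᵥ fun i => inner ℝ (x i) θ) :
    (∀ i, inner ℝ (x i) (θ - comb x c) = ρ * c i) ∧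
      ‖θ - comb x c‖ ^ 2 + ρ * ∑ i, c i ^ 2 = inner ℝ (θ - comb x c) θ := by
  have h1 : gramRidge x ρ *ᵥ c = fun i => inner ℝ (x i) θ := by
    rw [hc, Matrix.mulVec_mulVec, Matrix.mul_nonsing_inv _ hA, Matrix.one_mulVec]
  have h2 : ∀ i, inner ℝ (x i) (θ - comb x c) = ρ * c i := by
    intro i
    have := congrFun h1 i
    rw [gramRidge_mulVec] at this
    rw [inner_sub_right]; linarith
  refine ⟨h2, ?_⟩
  have h3 : inner ℝ (comb x c) (θ - comb x c) = ρ * ∑ i, c i ^ 2 := by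
    rw [inner_comb, Finset.mul_sum]
    refine Finset.sum_congr rfl fun i _ => ?_
    rw [h2]; ring
  have h4 : inner ℝ (θ - comb x c) θ
      = inner ℝ (θ - comb x c) (θ - comb x c) + inner ℝ (comb x c) (θ - comb x c) := by
    rw [real_inner_comm (θ - comb x c) (comb x c), ← inner_add_right, sub_add_cancel]
  rw [h4, h3, real_inner_self_eq_norm_sq]

/-- The transfer inequality turns the residual on the samples into the population residual. -/
lemma residual_le_inner (hρ : 0 ≤ ρ) (hA : IsUnit (gramRidge x ρ).det) {Nsq : H → ℝ} {t ν : ℝ}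
    (ht : 0 ≤ t) (hν : 0 ≤ ν)
    (hT : ∀ u, Nsq u ≤ t * (∑ i, inner ℝ (x i) u ^ 2 + ν * ‖u‖ ^ 2)) (θ : H) :
    let e := θ - comb x ((gramRidge x ρ)⁻¹ *ᵥ fun i => inner ℝ (x i) θ)
    0 ≤ inner ℝ e θ ∧ ‖e‖ ^ 2 ≤ inner ℝ e θ ∧ Nsq e ≤ t * (ν + ρ) * inner ℝ e θ := by
  intro e
  obtain ⟨h1, h2⟩ := residual_identities hA θ _ rfl
  set c := (gramRidge x ρ)⁻¹ *ᵥ fun i => inner ℝ (x i) θ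
  have hS : 0 ≤ ∑ i, c i ^ 2 := Finset.sum_nonneg fun i _ => sq_nonneg _
  have he : ‖e‖ ^ 2 + ρ * ∑ i, c i ^ 2 = inner ℝ e θ := h2
  have hρS := mul_nonneg hρ hS
  have hle : ‖e‖ ^ 2 ≤ inner ℝ e θ := by linarith
  have h0 : 0 ≤ inner ℝ e θ := (sq_nonneg _).trans hle
  refine ⟨h0, hle, (hT e).trans ?_⟩
  have hs : ∑ i, inner ℝ (x i) e ^ 2 = ρ * (ρ * ∑ i, c i ^ 2) := by
    have : ∀ i, inner ℝ (x i) e = ρ * c i := h1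
    simp only [this, mul_pow, ← Finset.mul_sum]; ring
  rw [hs, mul_assoc t]
  refine mul_le_mul_of_nonneg_left ?_ ht
  have h3 : ρ * ∑ i, c i ^ 2 ≤ inner ℝ e θ := by nlinarith [sq_nonneg ‖e‖]
  nlinarith [mul_le_mul_of_nonneg_left h3 hρ, mul_le_mul_of_nonneg_left hle hν]

/-- The bias on a target of finite norm `W` in the dual of the population norm. Cancelling one
factor of the population norm of the residual gives the square of `t (ν + ρ)`. -/
lemma residual_le_of_dual (hρ : 0 ≤ ρ) (hA : IsUnit (gramRidge x ρ).det) {Nsq : H → ℝ} {t ν W : ℝ}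
    (ht : 0 ≤ t) (hν : 0 ≤ ν) (hN : ∀ u, 0 ≤ Nsq u) (hW0 : 0 ≤ W)
    (hT : ∀ u, Nsq u ≤ t * (∑ i, inner ℝ (x i) u ^ 2 + ν * ‖u‖ ^ 2)) (θ : H)
    (hW : ∀ u, inner ℝ u θ ^ 2 ≤ Nsq u * W) :
    Nsq (θ - comb x ((gramRidge x ρ)⁻¹ *ᵥ fun i => inner ℝ (x i) θ)) ≤ (t * (ν + ρ)) ^ 2 * W := by
  obtain ⟨h0, -, h2⟩ := residual_le_inner hρ hA ht hν hT θ
  set e := θ - comb x ((gramRidge x ρ)⁻¹ *ᵥ fun i => inner ℝ (x i) θ)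
  rcases (hN e).eq_or_lt with h | h
  · rw [← h]; positivity
  · have hk : 0 ≤ t * (ν + ρ) := by positivity
    have h3 : Nsq e ^ 2 ≤ (t * (ν + ρ)) ^ 2 * (Nsq e * W) :=
      (pow_le_pow_left₀ h.le h2 2).trans (by
        rw [mul_pow]; exact mul_le_mul_of_nonneg_left (hW e) (sq_nonneg _))
    have : Nsq e * Nsq e ≤ Nsq e * ((t * (ν + ρ)) ^ 2 * W) := by nlinarith
    exact le_of_mul_le_mul_left this h

/-- The bias on a target `θ` of the Hilbert space, in terms of its norm. -/
lemma residual_le_of_norm (hρ : 0 ≤ ρ) (hA : IsUnit (gramRidge x ρ).det) {Nsq : H → ℝ} {t ν : ℝ}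
    (ht : 0 ≤ t) (hν : 0 ≤ ν)
    (hT : ∀ u, Nsq u ≤ t * (∑ i, inner ℝ (x i) u ^ 2 + ν * ‖u‖ ^ 2)) (θ : H) :
    Nsq (θ - comb x ((gramRidge x ρ)⁻¹ *ᵥ fun i => inner ℝ (x i) θ)) ≤ t * (ν + ρ) * ‖θ‖ ^ 2 := by
  obtain ⟨-, h1, h2⟩ := residual_le_inner hρ hA ht hν hT θ
  set e := θ - comb x ((gramRidge x ρ)⁻¹ *ᵥ fun i => inner ℝ (x i) θ)
  have h3 := real_inner_le_norm e θ
  have h4 : inner ℝ e θ ≤ ‖θ‖ ^ 2 := by nlinarith [sq_nonneg (‖e‖ - ‖θ‖)]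
  have hk : 0 ≤ t * (ν + ρ) := by positivity
  exact h2.trans (mul_le_mul_of_nonneg_left h4 hk)

/-- The population norm of the ridge regressor fitted to arbitrary labels `h`. -/
lemma fit_le (hρ : 0 ≤ ρ) (hA : IsUnit (gramRidge x ρ).det) {Nsq : H → ℝ} {t ν Q : ℝ}
    (ht : 0 ≤ t) (hν : 0 ≤ ν)
    (hT : ∀ u, Nsq u ≤ t * (∑ i, inner ℝ (x i) u ^ 2 + ν * ‖u‖ ^ 2)) (h : Fin n → ℝ)
    (hQ : h ⬝ᵥ ((gramRidge x ρ)⁻¹ *ᵥ h) ≤ Q) :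
    Nsq (comb x ((gramRidge x ρ)⁻¹ *ᵥ h)) ≤ t * (∑ i, h i ^ 2 + ν * Q) := by
  set c := (gramRidge x ρ)⁻¹ *ᵥ h with hc
  have h1 : gramRidge x ρ *ᵥ c = h := by
    rw [hc, Matrix.mulVec_mulVec, Matrix.mul_nonsing_inv _ hA, Matrix.one_mulVec]
  have h2 := norm_comb_sq x ρ c
  rw [h1] at h2
  have h3 : ∑ i, c i * h i = h ⬝ᵥ c := by simp [dotProduct, mul_comm]
  have hS : 0 ≤ ρ * ∑ i, c i ^ 2 := mul_nonneg hρ (Finset.sum_nonneg fun i _ => sq_nonneg _)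
  have h4 : ∑ i, inner ℝ (x i) (comb x c) ^ 2 ≤ ∑ i, h i ^ 2 := by
    have h5 : ∀ i, inner ℝ (x i) (comb x c) = h i - ρ * c i := by
      intro i
      have := congrFun h1 i
      rw [gramRidge_mulVec] at this
      linarith
    have h6 : ∑ i, inner ℝ (x i) (comb x c) ^ 2
        = ∑ i, h i ^ 2 - 2 * ρ * ∑ i, c i * h i + ρ * (ρ * ∑ i, c i ^ 2) := by
      simp only [h5, Finset.mul_sum, ← Finset.sum_sub_distrib, ← Finset.sum_add_distrib]
      exact Finset.sum_congr rfl fun i _ => by ring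
    have h7 : ρ * ∑ i, c i ^ 2 ≤ ∑ i, c i * h i := by nlinarith [sq_nonneg ‖comb x c‖]
    have h8 : 0 ≤ ∑ i, c i * h i := hS.trans h7
    nlinarith [mul_le_mul_of_nonneg_left h7 hρ, mul_nonneg hρ h8]
  refine (hT _).trans (mul_le_mul_of_nonneg_left (add_le_add h4 ?_) ht)
  refine mul_le_mul_of_nonneg_left ?_ hν
  linarith

/-- If `X Xᵀ + ρ I ≥ ν₀ I`, then the quadratic form of its inverse is at most `|h|² / ν₀`. -/
lemma dotProduct_inv_mulVec_le (hA : IsUnit (gramRidge x ρ).det) {ν₀ : ℝ} (hν₀ : 0 < ν₀)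
    (hpos : ∀ c : Fin n → ℝ, ν₀ * ∑ i, c i ^ 2 ≤ ∑ i, c i * (gramRidge x ρ *ᵥ c) i)
    (h : Fin n → ℝ) :
    h ⬝ᵥ ((gramRidge x ρ)⁻¹ *ᵥ h) ≤ (∑ i, h i ^ 2) / ν₀ := by
  set c := (gramRidge x ρ)⁻¹ *ᵥ h with hc
  have h1 : gramRidge x ρ *ᵥ c = h := by
    rw [hc, Matrix.mulVec_mulVec, Matrix.mul_nonsing_inv _ hA, Matrix.one_mulVec]
  have h2 := hpos c
  rw [h1] at h2
  have h3 : h ⬝ᵥ c = ∑ i, c i * h i := by simp [dotProduct, mul_comm]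
  have h4 : (∑ i, c i * h i) ^ 2 ≤ (∑ i, c i ^ 2) * ∑ i, h i ^ 2 :=
    Finset.sum_mul_sq_le_sq_mul_sq _ _ _
  have h5 : 0 ≤ ∑ i, c i ^ 2 := Finset.sum_nonneg fun i _ => sq_nonneg _
  have h6 : 0 ≤ ∑ i, h i ^ 2 := Finset.sum_nonneg fun i _ => sq_nonneg _
  rw [h3, le_div_iff₀ hν₀]
  set a := ∑ i, c i * h i
  rcases le_or_gt a 0 with ha | ha
  · exact (mul_nonpos_of_nonpos_of_nonneg ha hν₀.le).trans h6
  · have : a * (a * ν₀) ≤ a * ∑ i, h i ^ 2 := by nlinarith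
    exact le_of_mul_le_mul_left this ha

/-- A positive lower bound on the quadratic form makes the kernel matrix invertible. -/
lemma isUnit_det_of_pos
    (hpos : ∀ c : Fin n → ℝ, c ≠ 0 → 0 < ∑ i, c i * (gramRidge x ρ *ᵥ c) i) :
    IsUnit (gramRidge x ρ).det := by
  rw [← Matrix.isUnit_iff_isUnit_det, ← Matrix.mulVec_injective_iff_isUnit,
    ← Matrix.coe_mulVecLin, ← LinearMap.ker_eq_bot, LinearMap.ker_eq_bot']
  intro c hc
  by_contra hne
  have := hpos c hne
  rw [Matrix.mulVecLin_apply] at hc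
  simp [hc] at this

end Algebra

/-! ### The population norm on square-summable sequences -/

/-- The space `ℓ²` of square-summable real sequences. -/
abbrev SeqL2 : Type := lp (fun _ : ℕ => ℝ) 2

/-- `‖u‖²_Σ = ∑ₗ λₗ uₗ²`. -/
def popNormSq (eig u : ℕ → ℝ) : ℝ := ∑' l, eig l * u l ^ 2

lemma memℓp_two_iff {x : ℕ → ℝ} : Memℓp x 2 ↔ Summable fun k => x k ^ 2 := by
  rw [memℓp_gen_iff (by norm_num)]
  simp

lemma seqL2_inner (u v : SeqL2) : inner ℝ u v = ∑' k, u k * v k := by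
  rw [lp.inner_eq_tsum]; simp [mul_comm]

lemma seqL2_summable_mul (u v : SeqL2) : Summable fun k => u k * v k := by
  have := lp.summable_inner (𝕜 := ℝ) u v
  simpa [mul_comm] using this

lemma seqL2_summable_sq (u : SeqL2) : Summable fun k => u k ^ 2 := memℓp_two_iff.1 u.2

lemma seqL2_norm_sq (u : SeqL2) : ‖u‖ ^ 2 = ∑' k, u k ^ 2 := by
  rw [← real_inner_self_eq_norm_sq, seqL2_inner]; simp [sq]

/-- The restriction of `θ` to the coordinates in `[a, b)`. -/
def truncSeq (a b : ℕ) (θ : ℕ → ℝ) : SeqL2 :=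
  ⟨fun k => if k ∈ Finset.Ico a b then θ k else 0, memℓp_two_iff.2 <|
    summable_of_ne_finset_zero (s := Finset.Ico a b) fun k hk => by rw [if_neg hk]; norm_num⟩

lemma truncSeq_apply (a b : ℕ) (θ : ℕ → ℝ) (k : ℕ) :
    truncSeq a b θ k = if k ∈ Finset.Ico a b then θ k else 0 := rfl

lemma inner_truncSeq (u : SeqL2) (a b : ℕ) (θ : ℕ → ℝ) :
    inner ℝ u (truncSeq a b θ) = ∑ k ∈ Finset.Ico a b, u k * θ k := by
  rw [seqL2_inner, tsum_eq_sum (s := Finset.Ico a b) fun k hk => by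
    rw [truncSeq_apply, if_neg hk, mul_zero]]
  exact Finset.sum_congr rfl fun k hk => by rw [truncSeq_apply, if_pos hk]

lemma truncSeq_norm_sq (a b : ℕ) (θ : ℕ → ℝ) :
    ‖truncSeq a b θ‖ ^ 2 = ∑ k ∈ Finset.Ico a b, θ k ^ 2 := by
  rw [← real_inner_self_eq_norm_sq, inner_truncSeq]
  exact Finset.sum_congr rfl fun k hk => by rw [truncSeq_apply, if_pos hk, sq]

section FeatureLaw

variable {p : ℕ∞} {eig : ℕ → ℝ} {μ : Measure (ℕ → ℝ)}

lemma IsFeatureLaw.nonneg (h : IsFeatureLaw p eig μ) (k : ℕ) : 0 ≤ eig k := by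
  rcases lt_or_ge (k : ℕ∞) p with hk | hk
  · exact (h.pos k hk).le
  · exact (h.zero k hk).ge

lemma IsFeatureLaw.summable_popNorm (h : IsFeatureLaw p eig μ) (u : SeqL2) :
    Summable fun l => eig l * u l ^ 2 :=
  Summable.of_nonneg_of_le (fun l => mul_nonneg (h.nonneg l) (sq_nonneg _))
    (fun l => mul_le_mul_of_nonneg_right (h.antitone (Nat.zero_le l)) (sq_nonneg _))
    ((seqL2_summable_sq u).mul_left (eig 0))

lemma IsFeatureLaw.popNormSq_nonneg (h : IsFeatureLaw p eig μ) (u : ℕ → ℝ) :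
    0 ≤ popNormSq eig u :=
  tsum_nonneg fun l => mul_nonneg (h.nonneg l) (sq_nonneg _)

lemma sum_sq_expand (s : Finset ℕ) (a x : ℕ → ℝ) :
    (∑ k ∈ s, x k * a k) ^ 2 = ∑ i ∈ s, ∑ j ∈ s, a i * a j * (x i * x j) := by
  rw [sq, Finset.sum_mul_sum]
  exact Finset.sum_congr rfl fun i _ => Finset.sum_congr rfl fun j _ => by ring

lemma IsFeatureLaw.integrable_sum_sq (h : IsFeatureLaw p eig μ) (s : Finset ℕ) (a : ℕ → ℝ) :
    Integrable (fun x : ℕ → ℝ => (∑ k ∈ s, x k * a k) ^ 2) μ := by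
  simp only [sum_sq_expand]
  exact integrable_finsetSum _ fun i _ => integrable_finsetSum _ fun j _ =>
    (h.integrable i j).const_mul _

lemma IsFeatureLaw.integral_sum_sq (h : IsFeatureLaw p eig μ) (s : Finset ℕ) (a : ℕ → ℝ) :
    ∫ x : ℕ → ℝ, (∑ k ∈ s, x k * a k) ^ 2 ∂μ = ∑ k ∈ s, eig k * a k ^ 2 := by
  simp only [sum_sq_expand]
  rw [integral_finsetSum _ fun i _ => integrable_finsetSum _ fun j _ =>
    (h.integrable i j).const_mul _]
  refine Finset.sum_congr rfl fun i hi => ?_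
  rw [integral_finsetSum _ fun j _ => (h.integrable i j).const_mul _]
  simp only [integral_const_mul, h.secondMoment, mul_ite, mul_zero]
  rw [Finset.sum_ite_eq, if_pos hi]; ring

lemma IsFeatureLaw.lintegral_sum_sq (h : IsFeatureLaw p eig μ) (s : Finset ℕ) (a : ℕ → ℝ) :
    ∫⁻ x : ℕ → ℝ, ENNReal.ofReal ((∑ k ∈ s, x k * a k) ^ 2) ∂μ
      = ENNReal.ofReal (∑ k ∈ s, eig k * a k ^ 2) := by
  rw [← h.integral_sum_sq, ofReal_integral_eq_lintegral_ofReal (h.integrable_sum_sq s a)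
    (ae_of_all _ fun _ => sq_nonneg _)]

lemma IsFeatureLaw.lintegral_sq (h : IsFeatureLaw p eig μ) (k : ℕ) :
    ∫⁻ x : ℕ → ℝ, ENNReal.ofReal (x k ^ 2) ∂μ = ENNReal.ofReal (eig k) := by
  simpa using h.lintegral_sum_sq {k} 1

/-- Features are almost surely square summable when the trace of `Σ` is finite. -/
lemma IsFeatureLaw.ae_memℓp (h : IsFeatureLaw p eig μ) (hs : Summable eig) :
    ∀ᵐ x ∂μ, Memℓp x 2 := by
  have h1 : ∫⁻ x : ℕ → ℝ, ∑' k, ENNReal.ofReal (x k ^ 2) ∂μ ≠ ∞ := by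
    rw [lintegral_tsum fun k => (by fun_prop : Measurable _).aemeasurable]
    simp only [h.lintegral_sq]
    exact hs.tsum_ofReal_ne_top
  have h2 : AEMeasurable (fun x : ℕ → ℝ => ∑' k, ENNReal.ofReal (x k ^ 2)) μ := by
    exact (Measurable.tsum fun k => by fun_prop).aemeasurable
  filter_upwards [ae_lt_top' h2 h1] with x hx
  rw [memℓp_two_iff]
  have := ENNReal.summable_toReal hx.ne
  simpa [ENNReal.toReal_ofReal, sq_nonneg] using this

/-- `𝔼 (xᵀu)² ≤ ‖u‖²_Σ` for square-summable `u`, by Fatou's lemma. -/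
lemma IsFeatureLaw.lintegral_tsum_sq_le (h : IsFeatureLaw p eig μ) (hs : Summable eig)
    (u : SeqL2) :
    ∫⁻ x : ℕ → ℝ, ENNReal.ofReal ((∑' k, x k * u k) ^ 2) ∂μ
      ≤ ENNReal.ofReal (popNormSq eig u) := by
  have h1 : ∀ᵐ x ∂μ, ENNReal.ofReal ((∑' k, x k * u k) ^ 2)
      = liminf (fun N => ENNReal.ofReal ((∑ k ∈ Finset.range N, x k * u k) ^ 2)) atTop := by
    filter_upwards [h.ae_memℓp hs] with x hx
    have h2 := (seqL2_summable_mul ⟨x, hx⟩ u).hasSum.tendsto_sum_nat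
    exact ((ENNReal.continuous_ofReal.tendsto _).comp (h2.pow 2)).liminf_eq.symm
  rw [lintegral_congr_ae h1]
  refine (lintegral_liminf_le fun N => by fun_prop).trans ?_
  refine liminf_le_of_le (by isBoundedDefault) fun b hb => ?_
  obtain ⟨N, hN⟩ := hb.exists
  refine hN.trans ?_
  rw [h.lintegral_sum_sq]
  exact ENNReal.ofReal_le_ofReal ((h.summable_popNorm u).sum_le_tsum _
    fun l _ => mul_nonneg (h.nonneg l) (sq_nonneg _))

/-- The second moment of the part of the target beyond the first `K` coordinates. -/
lemma IsFeatureLaw.lintegral_target_tail_le (h : IsFeatureLaw p eig μ) {θ : ℕ → ℝ}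
    {f : (ℕ → ℝ) → ℝ} (hf : IsTargetFunction μ θ f) (K : ℕ) {E : ℝ}
    (hE : ∀ N, ∑ k ∈ Finset.Ico K N, eig k * θ k ^ 2 ≤ E) :
    ∫⁻ x : ℕ → ℝ, ENNReal.ofReal ((f x - ∑ k ∈ Finset.range K, x k * θ k) ^ 2) ∂μ
      ≤ ENNReal.ofReal E := by
  have key : ∀ g : (ℕ → ℝ) → ℝ, ∫⁻ x, ENNReal.ofReal (g x ^ 2) ∂μ = eLpNorm g 2 μ ^ 2 := by
    intro g
    rw [eLpNorm_eq_lintegral_rpow_enorm_toReal (by norm_num) (by norm_num)]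
    rw [← ENNReal.rpow_natCast, ← ENNReal.rpow_mul]
    norm_num
    refine lintegral_congr fun x => ?_
    rw [← ofReal_norm, ← ENNReal.ofReal_pow (norm_nonneg _), Real.norm_eq_abs, sq_abs]
  rw [key]
  have hE0 : 0 ≤ E := by simpa using hE K
  suffices hh : eLpNorm (fun x => f x - ∑ k ∈ Finset.range K, x k * θ k) 2 μ
      ≤ ENNReal.ofReal (√E) by
    calc _ ≤ ENNReal.ofReal (√E) ^ 2 := by gcongr
      _ = ENNReal.ofReal E := by
        rw [← ENNReal.ofReal_pow (Real.sqrt_nonneg _), Real.sq_sqrt hE0]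
  have hmeas : ∀ N : ℕ, AEStronglyMeasurable
      (fun x : ℕ → ℝ => ∑ k ∈ Finset.range N, x k * θ k) μ :=
    fun N => (by fun_prop : Measurable _).aestronglyMeasurable
  have hlim : Tendsto (fun N : ℕ =>
      eLpNorm (fun x => f x - ∑ k ∈ Finset.range N, x k * θ k) 2 μ + ENNReal.ofReal (√E))
      atTop (𝓝 (0 + ENNReal.ofReal (√E))) := hf.2.add tendsto_const_nhds
  rw [zero_add] at hlim
  refine ge_of_tendsto hlim ?_
  filter_upwards [eventually_ge_atTop K] with N hN
  have h1 : (fun x : ℕ → ℝ => f x - ∑ k ∈ Finset.range K, x k * θ k)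
      = (fun x => f x - ∑ k ∈ Finset.range N, x k * θ k)
        + fun x => ∑ k ∈ Finset.Ico K N, x k * θ k := by
    funext x
    simp only [Pi.add_apply]
    rw [Finset.sum_Ico_eq_sub _ hN]; ring
  rw [h1]
  refine (eLpNorm_add_le (hf.1.aestronglyMeasurable.sub (hmeas N))
    ((by fun_prop : Measurable _).aestronglyMeasurable) (by norm_num)).trans ?_
  refine add_le_add le_rfl ?_
  have h2 : eLpNorm (fun x : ℕ → ℝ => ∑ k ∈ Finset.Ico K N, x k * θ k) 2 μ ^ 2
      ≤ ENNReal.ofReal (√E) ^ 2 := by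
    rw [← key, h.lintegral_sum_sq, ← ENNReal.ofReal_pow (Real.sqrt_nonneg _), Real.sq_sqrt hE0]
    exact ENNReal.ofReal_le_ofReal (hE N)
  exact (ENNReal.pow_le_pow_left_iff two_ne_zero).1 h2

/-! ### The bias on the event that the transfer inequality holds -/

lemma kernelMatrix_eq_gramRidge {n : ℕ} (lam : ℝ) (x : Fin n → SeqL2) :
    kernelMatrix lam (fun i => (x i : ℕ → ℝ)) = gramRidge x (n * lam) := by
  simp only [kernelMatrix, gramRidge, seqL2_inner]

lemma comb_apply {n : ℕ} (x : Fin n → SeqL2) (c : Fin n → ℝ) (k : ℕ) :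
    comb x c k = ∑ i, x i k * c i := by
  have : ((∑ i, c i • x i : SeqL2) : ℕ → ℝ) = ∑ i, ((c i • x i : SeqL2) : ℕ → ℝ) :=
    lp.coeFn_sum _ _
  rw [comb, this, Finset.sum_apply]
  simp [mul_comm]

/-- The bias on the event that the transfer inequality holds. The target is split into its
coordinates below `J`, those in `[J, K)`, and the rest; the corresponding four terms are the
residuals of the first two parts, the regressor fitted to the sample values `h` of the rest, and the
rest itself. -/
lemma bias_le_of_transfer [IsProbabilityMeasure μ] (hL : IsFeatureLaw p eig μ) (hs : Summable eig)
    {θ : ℕ → ℝ} {f : (ℕ → ℝ) → ℝ} {n : ℕ} {lam : ℝ} (hlam : 0 ≤ lam) (x : Fin n → SeqL2)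
    (hA : IsUnit (gramRidge x (n * lam)).det) {t ν : ℝ} (ht : 0 ≤ t) (hν : 0 ≤ ν)
    (hT : ∀ u : SeqL2, popNormSq eig u ≤ t * (∑ i, inner ℝ (x i) u ^ 2 + ν * ‖u‖ ^ 2))
    {J K : ℕ} (hJK : J ≤ K) (hJ : ∀ l < J, 0 < eig l) {Q E : ℝ} (hE0 : 0 ≤ E)
    {h : Fin n → ℝ} (hh : ∀ i, h i = f (x i) - ∑ k ∈ Finset.range K, x i k * θ k)
    (hQ : h ⬝ᵥ ((gramRidge x (n * lam))⁻¹ *ᵥ h) ≤ Q) (hQ0 : 0 ≤ Q)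
    (hE : ∫⁻ x : ℕ → ℝ, ENNReal.ofReal ((f x - ∑ k ∈ Finset.range K, x k * θ k) ^ 2) ∂μ
      ≤ ENNReal.ofReal E) :
    bias μ f lam (fun i => (x i : ℕ → ℝ)) ≤ ENNReal.ofReal (4 * (
      (t * (ν + n * lam)) ^ 2 * (∑ k ∈ Finset.range J, θ k ^ 2 / eig k)
      + t * (ν + n * lam) * (∑ k ∈ Finset.Ico J K, θ k ^ 2)
      + t * (∑ i, h i ^ 2 + ν * Q) + E)) := by
  set ρ : ℝ := n * lam with hρd
  have hρ : 0 ≤ ρ := by positivity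
  set A := gramRidge x ρ with hAd
  set g := truncSeq 0 J θ with hg
  set g' := truncSeq J K θ with hg'
  set eg := g - comb x (A⁻¹ *ᵥ fun i => inner ℝ (x i) g) with heg
  set eg' := g' - comb x (A⁻¹ *ᵥ fun i => inner ℝ (x i) g') with heg'
  set u := comb x (A⁻¹ *ᵥ h) with hu
  set W := ∑ k ∈ Finset.range J, θ k ^ 2 / eig k with hWd
  have hW0 : 0 ≤ W := Finset.sum_nonneg fun k _ => div_nonneg (sq_nonneg _) (hL.nonneg k)
  have hdual : ∀ v : SeqL2, inner ℝ v g ^ 2 ≤ popNormSq eig v * W := by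
    intro v
    rw [hg, inner_truncSeq, Nat.Ico_zero_eq_range]
    calc (∑ k ∈ Finset.range J, v k * θ k) ^ 2
        = (∑ k ∈ Finset.range J, (√(eig k) * v k) * (θ k / √(eig k))) ^ 2 := by
          congr 1
          refine Finset.sum_congr rfl fun k hk => ?_
          have := (Real.sqrt_pos.2 (hJ k (Finset.mem_range.1 hk))).ne'
          field_simp
      _ ≤ (∑ k ∈ Finset.range J, (√(eig k) * v k) ^ 2)
            * ∑ k ∈ Finset.range J, (θ k / √(eig k)) ^ 2 := Finset.sum_mul_sq_le_sq_mul_sq _ _ _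
      _ = (∑ k ∈ Finset.range J, eig k * v k ^ 2) * W := by
          simp only [mul_pow, div_pow, Real.sq_sqrt (hL.nonneg _), hWd]
      _ ≤ _ := mul_le_mul_of_nonneg_right ((hL.summable_popNorm v).sum_le_tsum _
          fun l _ => mul_nonneg (hL.nonneg l) (sq_nonneg _)) hW0
  have b1 : popNormSq eig eg ≤ (t * (ν + ρ)) ^ 2 * W :=
    residual_le_of_dual (Nsq := fun v : SeqL2 => popNormSq eig v) hρ hA ht hν
      (fun v => hL.popNormSq_nonneg v) hW0 hT g hdual
  have b2 : popNormSq eig eg' ≤ t * (ν + ρ) * ∑ k ∈ Finset.Ico J K, θ k ^ 2 := by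
    rw [← truncSeq_norm_sq]
    exact residual_le_of_norm (Nsq := fun v : SeqL2 => popNormSq eig v) hρ hA ht hν hT g'
  have b3 : popNormSq eig u ≤ t * (∑ i, h i ^ 2 + ν * Q) :=
    fit_le (Nsq := fun v : SeqL2 => popNormSq eig v) hρ hA ht hν hT h hQ
  -- the regressor is linear in the labels
  have hreg : ∀ k, regressor lam (fun i => (x i : ℕ → ℝ)) (fun i => f (x i)) k
      = (g - eg + (g' - eg') + u : SeqL2) k := by
    intro k
    have hy : (fun i => f (x i)) = (fun i => inner ℝ (x i) g) + (fun i => inner ℝ (x i) g') + h := by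
      funext i
      simp only [Pi.add_apply, hh i, hg, hg', inner_truncSeq, Nat.Ico_zero_eq_range]
      rw [Finset.sum_Ico_eq_sub _ hJK]; ring
    have : (g - eg + (g' - eg') + u : SeqL2) = comb x (A⁻¹ *ᵥ fun i => f (x i)) := by
      rw [hy, Matrix.mulVec_add, Matrix.mulVec_add, heg, heg', hu]
      simp only [comb, Pi.add_apply, add_smul, Finset.sum_add_distrib]
      abel
    rw [this, comb_apply, regressor, kernelMatrix_eq_gramRidge]
  have hpt : ∀ᵐ z ∂μ, ENNReal.ofReal
      (((∑' k : ℕ, z k * regressor lam (fun i => (x i : ℕ → ℝ)) (fun i => f (x i)) k) - f z) ^ 2)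
      ≤ 4 * (ENNReal.ofReal ((∑' k, z k * eg k) ^ 2) + ENNReal.ofReal ((∑' k, z k * eg' k) ^ 2)
        + ENNReal.ofReal ((∑' k, z k * u k) ^ 2)
        + ENNReal.ofReal ((f z - ∑ k ∈ Finset.range K, z k * θ k) ^ 2)) := by
    filter_upwards [hL.ae_memℓp hs] with z hz
    have e1 : ∑' k : ℕ, z k * regressor lam (fun i => (x i : ℕ → ℝ)) (fun i => f (x i)) k
        = ∑ k ∈ Finset.range K, z k * θ k - ∑' k, z k * eg k - ∑' k, z k * eg' k
          + ∑' k, z k * u k := by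
      simp only [hreg]
      have hin : ∀ v : SeqL2, ∑' k, z k * v k = inner ℝ (⟨z, hz⟩ : SeqL2) v :=
        fun v => (seqL2_inner ⟨z, hz⟩ v).symm
      simp only [hin, inner_add_right, inner_sub_right]
      rw [hg, hg', inner_truncSeq, inner_truncSeq, Nat.Ico_zero_eq_range,
        Finset.sum_Ico_eq_sub _ hJK]
      ring
    rw [e1, ← ENNReal.ofReal_add (sq_nonneg _) (sq_nonneg _),
      ← ENNReal.ofReal_add (by positivity) (sq_nonneg _),
      ← ENNReal.ofReal_add (by positivity) (sq_nonneg _),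
      show (4 : ℝ≥0∞) = ENNReal.ofReal 4 by norm_num, ← ENNReal.ofReal_mul (by norm_num)]
    refine ENNReal.ofReal_le_ofReal ?_
    set a := ∑' k, z k * eg k
    set b := ∑' k, z k * eg' k
    set c := ∑' k, z k * u k
    set s := ∑ k ∈ Finset.range K, z k * θ k
    nlinarith [sq_nonneg (a - b), sq_nonneg (a + c), sq_nonneg (b + c), sq_nonneg (a - (f z - s)),
      sq_nonneg (b - (f z - s)), sq_nonneg (c + (f z - s))]
  have hm : ∀ v : SeqL2, AEMeasurable (fun z : ℕ → ℝ => ENNReal.ofReal ((∑' k, z k * v k) ^ 2)) μ := by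
    intro v
    have : AEMeasurable (fun z : ℕ → ℝ => ∑' k, z k * v k) μ := by
      refine aemeasurable_of_tendsto_metrizable_ae atTop
        (f := fun N (z : ℕ → ℝ) => ∑ k ∈ Finset.range N, z k * v k)
        (fun N => (by fun_prop : Measurable _).aemeasurable) ?_
      filter_upwards [hL.ae_memℓp hs] with z hz
      exact (seqL2_summable_mul ⟨z, hz⟩ v).hasSum.tendsto_sum_nat
    fun_prop
  refine (lintegral_mono_ae hpt).trans ?_
  rw [lintegral_const_mul' _ _ (by norm_num), lintegral_add_left'
      (by have := hm eg; have := hm eg'; have := hm u; fun_prop),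
    lintegral_add_left' (by have := hm eg; have := hm eg'; fun_prop), lintegral_add_left' (hm eg)]
  have hV : 0 ≤ t * (ν + ρ) * ∑ k ∈ Finset.Ico J K, θ k ^ 2 := by positivity
  have hh0 : 0 ≤ t * (∑ i, h i ^ 2 + ν * Q) := by positivity
  rw [ENNReal.ofReal_mul (by norm_num), show ENNReal.ofReal 4 = 4 by norm_num,
    ENNReal.ofReal_add (by positivity) hE0, ENNReal.ofReal_add (by positivity) hh0,
    ENNReal.ofReal_add (by positivity) hV]
  gcongr
  · exact (hL.lintegral_tsum_sq_le hs eg).trans (ENNReal.ofReal_le_ofReal b1)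
  · exact (hL.lintegral_tsum_sq_le hs eg').trans (ENNReal.ofReal_le_ofReal b2)
  · exact (hL.lintegral_tsum_sq_le hs u).trans (ENNReal.ofReal_le_ofReal b3)

end FeatureLaw

/-! ### Sums of powers -/

lemma rpow_neg_succ_le_sub {a : ℝ} (ha : 0 < a) {l : ℕ} (hl : 1 ≤ l) :
    ((l : ℝ) + 1) ^ (-1 - a) ≤ ((l : ℝ) ^ (-a) - ((l : ℝ) + 1) ^ (-a)) / a := by
  have hl' : (0 : ℝ) < l := by exact_mod_cast hl
  have h1 : (0 : ℝ) < l + 1 := by linarith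
  have h2 : (l : ℝ) ^ (-a) = ((l : ℝ) + 1) ^ (-a) * (1 - 1 / ((l : ℝ) + 1)) ^ (-a) := by
    rw [← Real.mul_rpow h1.le (by rw [sub_nonneg, div_le_one h1]; linarith)]
    congr 1; field_simp; ring
  have h3 : 1 + a / ((l : ℝ) + 1) ≤ (1 - 1 / ((l : ℝ) + 1)) ^ (-a) := by
    have hpos : 0 < 1 - 1 / ((l : ℝ) + 1) := by rw [sub_pos, div_lt_one h1]; linarith
    rw [Real.rpow_def_of_pos hpos]
    have := Real.log_le_sub_one_of_pos hpos
    refine le_trans ?_ (Real.add_one_le_exp _)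
    have : a * (1 / ((l : ℝ) + 1)) ≤ a * -Real.log (1 - 1 / ((l : ℝ) + 1)) :=
      mul_le_mul_of_nonneg_left (by linarith) ha.le
    have e : a / ((l : ℝ) + 1) = a * (1 / ((l : ℝ) + 1)) := by ring
    rw [e]; linarith
  have h4 : ((l : ℝ) + 1) ^ (-1 - a) = ((l : ℝ) + 1) ^ (-a) / ((l : ℝ) + 1) := by
    rw [show -1 - a = -a - 1 by ring, Real.rpow_sub_one h1.ne']
  rw [h4, le_div_iff₀ ha, h2]
  have h5 : 0 < ((l : ℝ) + 1) ^ (-a) := by positivity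
  have := mul_le_mul_of_nonneg_left h3 h5.le
  calc _ = ((l : ℝ) + 1) ^ (-a) * (1 + a / ((l : ℝ) + 1)) - ((l : ℝ) + 1) ^ (-a) := by
        field_simp; ring
    _ ≤ _ := by linarith

lemma sum_Ico_rpow_le {a : ℝ} (ha : 0 < a) {k : ℕ} (hk : 1 ≤ k) (N : ℕ) :
    ∑ l ∈ Finset.Ico k N, ((l : ℝ) + 1) ^ (-1 - a) ≤ (k : ℝ) ^ (-a) / a := by
  rcases le_total N k with h | h
  · rw [Finset.Ico_eq_empty_of_le h, Finset.sum_empty]; positivity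
  have h1 : ∑ l ∈ Finset.Ico k N, ((l : ℝ) + 1) ^ (-1 - a)
      ≤ ((k : ℝ) ^ (-a) - (N : ℝ) ^ (-a)) / a := by
    induction N, h using Nat.le_induction with
    | base => simp
    | succ N hN ih =>
      rw [Finset.sum_Ico_succ_top hN]
      have := rpow_neg_succ_le_sub ha (hk.trans hN)
      push_cast
      calc _ ≤ _ := add_le_add ih this
        _ = _ := by ring
  refine h1.trans (div_le_div_of_nonneg_right ?_ ha.le)
  have : (0 : ℝ) ≤ (N : ℝ) ^ (-a) := by positivity
  linarith

lemma rpow_sub_one_le_sub {γ : ℝ} (h0 : 0 < γ) (h1 : γ ≤ 1) (l : ℕ) :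
    ((l : ℝ) + 1) ^ (γ - 1) ≤ (((l : ℝ) + 1) ^ γ - (l : ℝ) ^ γ) / γ := by
  have hp : (0 : ℝ) < l + 1 := by positivity
  have h2 : (l : ℝ) ^ γ = ((l : ℝ) + 1) ^ γ * (1 + -(1 / ((l : ℝ) + 1))) ^ γ := by
    rw [← Real.mul_rpow hp.le]
    · congr 1; field_simp; ring
    · have : 1 / ((l : ℝ) + 1) ≤ 1 := by rw [div_le_one hp]; linarith [(Nat.cast_nonneg l : (0:ℝ) ≤ l)]
      linarith
  have h3 := rpow_one_add_le_one_add_mul_self (s := -(1 / ((l : ℝ) + 1)))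
    (by have : 1 / ((l : ℝ) + 1) ≤ 1 := by
          rw [div_le_one hp]; linarith [(Nat.cast_nonneg l : (0:ℝ) ≤ l)]
        linarith) h0.le h1
  rw [Real.rpow_sub_one hp.ne', le_div_iff₀ h0, h2]
  have h5 : 0 < ((l : ℝ) + 1) ^ γ := by positivity
  have := mul_le_mul_of_nonneg_left h3 h5.le
  calc _ = ((l : ℝ) + 1) ^ γ - ((l : ℝ) + 1) ^ γ * (1 + γ * -(1 / ((l : ℝ) + 1))) := by
        field_simp; ring
    _ ≤ _ := by linarith

/-- `∑_{l ≤ n} l^{γ-1}` is `O(n^γ)`, `O(log n)` or `O(1)` according to the sign of `γ`. -/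
lemma exists_sum_range_rpow_le (γ : ℝ) : ∃ C : ℝ, 0 < C ∧ ∀ n : ℕ, 2 ≤ n →
    ∑ l ∈ Finset.range n, ((l : ℝ) + 1) ^ (γ - 1)
      ≤ C * Real.log n ^ (if γ = 0 then 1 else 0) * (n : ℝ) ^ max γ 0 := by
  rcases lt_trichotomy γ 0 with h | h | h
  · refine ⟨1 + 1 / (-γ), by have := neg_pos.2 h; positivity, fun n hn => ?_⟩
    rw [if_neg h.ne, max_eq_right h.le, pow_zero, Real.rpow_zero, mul_one, mul_one,
      Finset.range_eq_Ico, Finset.sum_eq_sum_Ico_succ_bot (by omega)]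
    have := sum_Ico_rpow_le (neg_pos.2 h) (le_refl 1) n
    simp only [sub_neg_eq_add, Nat.cast_one, Real.one_rpow] at this
    simp only [Nat.cast_zero, zero_add, Real.one_rpow]
    have e : γ - 1 = -1 + γ := by ring
    rw [e]
    exact add_le_add le_rfl this
  · refine ⟨1 / Real.log 2 + 1, by have := Real.log_pos one_lt_two; positivity, fun n hn => ?_⟩
    rw [if_pos h, h, max_self, pow_one, Real.rpow_zero, mul_one, zero_sub]
    have h1 : ∑ l ∈ Finset.range n, ((l : ℝ) + 1) ^ (-1 : ℝ) = (harmonic n : ℝ) := by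
      simp [harmonic, Real.rpow_neg_one]
    rw [h1]
    have h2 := harmonic_le_one_add_log n
    have h3 : Real.log 2 ≤ Real.log n := Real.log_le_log two_pos (by exact_mod_cast hn)
    have h4 : (1 : ℝ) ≤ 1 / Real.log 2 * Real.log n := by
      rw [one_div, ← div_eq_inv_mul, le_div_iff₀ (Real.log_pos one_lt_two)]; linarith
    linarith
  · rcases le_total γ 1 with h1 | h1
    · refine ⟨1 / γ, by positivity, fun n hn => ?_⟩
      rw [if_neg h.ne', max_eq_left h.le, pow_zero, mul_one]
      have h2 : ∀ m : ℕ, ∑ l ∈ Finset.range m, ((l : ℝ) + 1) ^ (γ - 1) ≤ (m : ℝ) ^ γ / γ := by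
        intro m
        induction m with
        | zero => simp [Real.zero_rpow h.ne']
        | succ m ih =>
          rw [Finset.sum_range_succ]
          push_cast
          calc _ ≤ _ := add_le_add ih (rpow_sub_one_le_sub h h1 m)
            _ = _ := by ring
      rw [one_div_mul_eq_div]
      exact h2 n
    · refine ⟨1, one_pos, fun n hn => ?_⟩
      rw [if_neg h.ne', max_eq_left h.le, pow_zero, mul_one, one_mul]
      have hn0 : (0 : ℝ) < n := by positivity
      calc _ ≤ ∑ l ∈ Finset.range n, (n : ℝ) ^ (γ - 1) := by
            refine Finset.sum_le_sum fun l hl => ?_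
            have : (l : ℝ) + 1 ≤ n := by exact_mod_cast Finset.mem_range.1 hl
            exact Real.rpow_le_rpow (by positivity) this (by linarith)
        _ = _ := by
            rw [Finset.sum_const, Finset.card_range, nsmul_eq_mul, Real.rpow_sub_one hn0.ne']
            field_simp

/-! ### Powers of positive semidefinite matrices -/

section PSD

variable {ι : Type*} [Fintype ι] [DecidableEq ι]

lemma exists_spectral {S : Matrix ι ι ℝ} (hS : S.PosSemidef) :
    ∃ (V : Matrix ι ι ℝ) (σ : ι → ℝ), (∀ i, 0 ≤ σ i) ∧ V * Vᵀ = 1 ∧ Vᵀ * V = 1 ∧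
      ∀ j : ℕ, S ^ j = V * Matrix.diagonal (fun i => σ i ^ j) * Vᵀ := by
  obtain ⟨V, σ, hσ, h1, h2, h3⟩ : ∃ (V : Matrix ι ι ℝ) (σ : ι → ℝ), (∀ i, 0 ≤ σ i) ∧
      V * Vᵀ = 1 ∧ Vᵀ * V = 1 ∧ S = V * Matrix.diagonal σ * Vᵀ := by
    refine ⟨hS.1.eigenvectorUnitary, hS.1.eigenvalues, hS.eigenvalues_nonneg,
      Unitary.coe_mul_star_self hS.1.eigenvectorUnitary,
      Unitary.coe_star_mul_self hS.1.eigenvectorUnitary, ?_⟩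
    have := hS.1.spectral_theorem
    rw [Unitary.conjStarAlgAut_apply] at this
    exact this
  refine ⟨V, σ, hσ, h1, h2, fun j => ?_⟩
  induction j with
  | zero => simp [h1]
  | succ j ih =>
    rw [pow_succ, ih, h3]
    calc _ = V * Matrix.diagonal (fun i => σ i ^ j) * (Vᵀ * V) * Matrix.diagonal σ * Vᵀ := by
            simp only [Matrix.mul_assoc]
      _ = _ := by
        rw [h2, Matrix.mul_one, Matrix.mul_assoc _ (Matrix.diagonal _) (Matrix.diagonal _),
          Matrix.diagonal_mul_diagonal]
        simp only [pow_succ]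

lemma dotProduct_conj_diagonal (V : Matrix ι ι ℝ) (d x : ι → ℝ) :
    x ⬝ᵥ ((V * Matrix.diagonal d * Vᵀ) *ᵥ x) = ∑ i, d i * (Vᵀ *ᵥ x) i ^ 2 := by
  rw [← Matrix.mulVec_mulVec, ← Matrix.mulVec_mulVec, Matrix.dotProduct_mulVec,
    ← Matrix.mulVec_transpose]
  simp only [dotProduct, Matrix.mulVec_diagonal]
  exact Finset.sum_congr rfl fun i _ => by ring

lemma sum_sq_transpose_mulVec {V : Matrix ι ι ℝ} (h : V * Vᵀ = 1) (x : ι → ℝ) :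
    ∑ i, (Vᵀ *ᵥ x) i ^ 2 = x ⬝ᵥ x := by
  have := dotProduct_conj_diagonal V (fun _ => 1) x
  rw [Matrix.diagonal_one, Matrix.mul_one, h, Matrix.one_mulVec] at this
  rw [this]; simp

/-- Chebyshev's sum inequality for the moments of a spectral measure. -/
lemma moment_mul_le {S : Matrix ι ι ℝ} (hS : S.PosSemidef) (z : ι → ℝ) (p q : ℕ) :
    (z ⬝ᵥ (S ^ p *ᵥ z)) * (z ⬝ᵥ (S ^ q *ᵥ z)) ≤ (z ⬝ᵥ z) * (z ⬝ᵥ (S ^ (p + q) *ᵥ z)) := by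
  obtain ⟨V, σ, hσ, h1, -, h3⟩ := exists_spectral hS
  rw [h3, h3, h3, dotProduct_conj_diagonal, dotProduct_conj_diagonal, dotProduct_conj_diagonal,
    ← sum_sq_transpose_mulVec h1]
  set y := Vᵀ *ᵥ z
  have key : 0 ≤ ∑ i, ∑ j, y i ^ 2 * y j ^ 2 * ((σ i ^ p - σ j ^ p) * (σ i ^ q - σ j ^ q)) := by
    refine Finset.sum_nonneg fun i _ => Finset.sum_nonneg fun j _ => mul_nonneg (by positivity) ?_
    rcases le_total (σ i) (σ j) with h | h
    · exact mul_nonneg_of_nonpos_of_nonpos (sub_nonpos.2 (pow_le_pow_left₀ (hσ i) h p))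
        (sub_nonpos.2 (pow_le_pow_left₀ (hσ i) h q))
    · exact mul_nonneg (sub_nonneg.2 (pow_le_pow_left₀ (hσ j) h p))
        (sub_nonneg.2 (pow_le_pow_left₀ (hσ j) h q))
  have e : ∑ i, ∑ j, y i ^ 2 * y j ^ 2 * ((σ i ^ p - σ j ^ p) * (σ i ^ q - σ j ^ q))
      = (∑ i, σ i ^ (p + q) * y i ^ 2) * (∑ j, y j ^ 2)
        - (∑ i, σ i ^ p * y i ^ 2) * (∑ j, σ j ^ q * y j ^ 2)
        - (∑ i, σ i ^ q * y i ^ 2) * (∑ j, σ j ^ p * y j ^ 2)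
        + (∑ i, y i ^ 2) * (∑ j, σ j ^ (p + q) * y j ^ 2) := by
    simp only [Finset.sum_mul_sum, ← Finset.sum_sub_distrib, ← Finset.sum_add_distrib]
    exact Finset.sum_congr rfl fun i _ => Finset.sum_congr rfl fun j _ => by ring
  rw [e] at key
  nlinarith

/-- Jensen's inequality for the spectral measure of a unit vector. -/
lemma moment_one_pow_le {S : Matrix ι ι ℝ} (hS : S.PosSemidef) {z : ι → ℝ} (hz : z ⬝ᵥ z = 1)
    (m : ℕ) : (z ⬝ᵥ (S *ᵥ z)) ^ m ≤ z ⬝ᵥ (S ^ m *ᵥ z) := by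
  have h0 : 0 ≤ z ⬝ᵥ (S *ᵥ z) := by simpa using hS.dotProduct_mulVec_nonneg z
  induction m with
  | zero => simp [hz]
  | succ m ih =>
    have := moment_mul_le hS z m 1
    rw [hz, one_mul, pow_one] at this
    rw [pow_succ]
    exact (mul_le_mul_of_nonneg_right ih h0).trans this

lemma trace_conj_diagonal {V : Matrix ι ι ℝ} (h : Vᵀ * V = 1) (d : ι → ℝ) :
    (V * Matrix.diagonal d * Vᵀ).trace = ∑ i, d i := by
  rw [Matrix.trace_mul_comm, ← Matrix.mul_assoc, h, Matrix.one_mul, Matrix.trace_diagonal]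

/-- `tr T^m` is monotone in the Loewner order: evaluate the larger form on the eigenvectors of the
smaller one, and use `⟨b, S b⟩^m ≤ ⟨b, S^m b⟩` for unit vectors `b`. -/
lemma trace_pow_mono {T T' : Matrix ι ι ℝ} (hT : T.PosSemidef) (hT' : T'.PosSemidef)
    (h : ∀ x, x ⬝ᵥ (T *ᵥ x) ≤ x ⬝ᵥ (T' *ᵥ x)) (m : ℕ) : (T ^ m).trace ≤ (T' ^ m).trace := by
  obtain ⟨V, σ, hσ, h1, h2, h3⟩ := exists_spectral hT
  have h4 : (T' ^ m).trace = ∑ i, V.col i ⬝ᵥ (T' ^ m *ᵥ V.col i) := by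
    calc (T' ^ m).trace = (T' ^ m * (V * Vᵀ)).trace := by rw [h1, Matrix.mul_one]
      _ = (Vᵀ * (T' ^ m * V)).trace := by rw [← Matrix.mul_assoc, Matrix.trace_mul_comm]
      _ = _ := by
        simp only [Matrix.trace, Matrix.diag, Matrix.mul_apply, dotProduct, Matrix.mulVec,
          Matrix.transpose_apply, Matrix.col_apply]
  rw [h4, h3, trace_conj_diagonal h2]
  refine Finset.sum_le_sum fun i _ => ?_
  have e : Vᵀ *ᵥ V.col i = Pi.single i 1 := by
    have : V.col i = V *ᵥ Pi.single i 1 := by simp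
    rw [this, Matrix.mulVec_mulVec, h2, Matrix.one_mulVec]
  have h5 : V.col i ⬝ᵥ V.col i = 1 := by
    rw [← sum_sq_transpose_mulVec h1, e, Finset.sum_eq_single i]
    · simp
    · intro j _ hj; simp [hj]
    · simp
  have h6 : V.col i ⬝ᵥ (T *ᵥ V.col i) = σ i := by
    have := h3 1
    rw [pow_one] at this
    rw [this, dotProduct_conj_diagonal, e, Finset.sum_eq_single i]
    · simp
    · intro j _ hj; simp [hj]
    · simp
  calc σ i ^ m ≤ (V.col i ⬝ᵥ (T' *ᵥ V.col i)) ^ m := pow_le_pow_left₀ (hσ i) (h6 ▸ h _) m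
    _ ≤ _ := moment_one_pow_le hT' h5 m

/-- Each eigenvalue `σ` satisfies `σ ^ m ≤ σ ^ (m + 1) / A + A ^ m`. -/
lemma trace_pow_le_succ {T : Matrix ι ι ℝ} (hT : T.PosSemidef) {A : ℝ} (hA : 0 < A) (m : ℕ) :
    (T ^ m).trace ≤ (T ^ (m + 1)).trace / A + Fintype.card ι * A ^ m := by
  obtain ⟨V, σ, hσ, -, h2, h3⟩ := exists_spectral hT
  rw [h3, h3, trace_conj_diagonal h2, trace_conj_diagonal h2, Finset.sum_div]
  have : (Fintype.card ι : ℝ) * A ^ m = ∑ _i : ι, A ^ m := by simp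
  rw [this, ← Finset.sum_add_distrib]
  refine Finset.sum_le_sum fun i _ => ?_
  rcases le_total (σ i) A with h | h
  · have := pow_le_pow_left₀ (hσ i) h m
    have h' : 0 ≤ σ i ^ (m + 1) / A := div_nonneg (pow_nonneg (hσ i) _) hA.le
    linarith
  · have : σ i ^ m ≤ σ i ^ (m + 1) / A := by
      rw [le_div_iff₀ hA, pow_succ]
      exact mul_le_mul_of_nonneg_left h (pow_nonneg (hσ i) _)
    have h' : 0 ≤ A ^ m := by positivity
    linarith

/-- A bound on a trace moment bounds the largest eigenvalue. -/
lemma quad_le_of_trace_pow_le {T : Matrix ι ι ℝ} (hT : T.PosSemidef) {t : ℝ} (ht : 0 ≤ t) {m : ℕ}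
    (h : (T ^ (m + 1)).trace ≤ t ^ (m + 1)) (v : ι → ℝ) : v ⬝ᵥ (T *ᵥ v) ≤ t * (v ⬝ᵥ v) := by
  obtain ⟨V, σ, hσ, h1, h2, h3⟩ := exists_spectral hT
  rw [h3, trace_conj_diagonal h2] at h
  have h4 : ∀ i, σ i ≤ t := by
    intro i
    refine le_of_pow_le_pow_left₀ (Nat.succ_ne_zero m) ht (le_trans ?_ h)
    exact Finset.single_le_sum (f := fun i => σ i ^ (m + 1))
      (fun j _ => pow_nonneg (hσ j) _) (Finset.mem_univ i)
  have := h3 1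
  rw [pow_one] at this
  rw [this, dotProduct_conj_diagonal, ← sum_sq_transpose_mulVec h1, Finset.mul_sum]
  exact Finset.sum_le_sum fun i _ => by
    rw [pow_one]; exact mul_le_mul_of_nonneg_right (h4 i) (sq_nonneg _)

lemma exists_factor {S : Matrix ι ι ℝ} (hS : S.PosSemidef) : ∃ B : Matrix ι ι ℝ, S = Bᵀ * B := by
  obtain ⟨V, σ, hσ, -, -, h3⟩ := exists_spectral hS
  refine ⟨Matrix.diagonal (fun i => √(σ i)) * Vᵀ, ?_⟩
  have := h3 1
  rw [pow_one] at this
  rw [this, Matrix.transpose_mul, Matrix.transpose_transpose, Matrix.diagonal_transpose]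
  calc _ = V * (Matrix.diagonal (fun i => √(σ i)) * Matrix.diagonal (fun i => √(σ i))) * Vᵀ := by
        rw [Matrix.diagonal_mul_diagonal]
        simp only [pow_one, Real.mul_self_sqrt (hσ _)]
    _ = _ := by simp only [Matrix.mul_assoc]

lemma mul_pow_transpose (C : Matrix ι ι ℝ) (j : ℕ) : C * (Cᵀ * C) ^ j * Cᵀ = (C * Cᵀ) ^ (j + 1) := by
  induction j with
  | zero => simp
  | succ j ih =>
    rw [pow_succ (C * Cᵀ), ← ih, pow_succ]; simp only [Matrix.mul_assoc]

/-- For a vector in the range of `Cᵀ`, the moments of `Cᵀ C` are those of `C Cᵀ` with exponents shifted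
by one; hence `moment_mul_le` gains one power. -/
lemma moment_mul_le_of_factor (C : Matrix ι ι ℝ) (ζ : ι → ℝ) (i j : ℕ) :
    ((Cᵀ *ᵥ ζ) ⬝ᵥ ((Cᵀ * C) ^ i *ᵥ (Cᵀ *ᵥ ζ))) * ((Cᵀ *ᵥ ζ) ⬝ᵥ ((Cᵀ * C) ^ j *ᵥ (Cᵀ *ᵥ ζ)))
      ≤ (ζ ⬝ᵥ ζ) * ((Cᵀ *ᵥ ζ) ⬝ᵥ ((Cᵀ * C) ^ (i + j + 1) *ᵥ (Cᵀ *ᵥ ζ))) := by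
  have e : ∀ k, (Cᵀ *ᵥ ζ) ⬝ᵥ ((Cᵀ * C) ^ k *ᵥ (Cᵀ *ᵥ ζ)) = ζ ⬝ᵥ ((C * Cᵀ) ^ (k + 1) *ᵥ ζ) := by
    intro k
    rw [← mul_pow_transpose, ← Matrix.mulVec_mulVec, ← Matrix.mulVec_mulVec,
      Matrix.dotProduct_mulVec ζ C, ← Matrix.mulVec_transpose C ζ]
  have hS : (C * Cᵀ).PosSemidef := by
    have := Matrix.posSemidef_self_mul_conjTranspose C
    rwa [Matrix.conjTranspose_eq_transpose_of_trivial] at this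
  rw [e, e, e]
  have := moment_mul_le hS ζ (i + 1) (j + 1)
  rwa [show i + 1 + (j + 1) = i + j + 1 + 1 by ring] at this

lemma quad_pow_nonneg {T : Matrix ι ι ℝ} (hT : T.PosSemidef) (u : ι → ℝ) (m : ℕ) :
    0 ≤ u ⬝ᵥ (T ^ m *ᵥ u) := by simpa using (hT.pow m).dotProduct_mulVec_nonneg u

/-- How the moments of `T₀` along `u` change under the rank-one downdate `T = T₀ - ρ u uᵀ`. -/
lemma moment_rankOne_sub {T T₀ : Matrix ι ι ℝ} {u : ι → ℝ} {ρ : ℝ}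
    (h : T = T₀ - ρ • Matrix.vecMulVec u u) (m : ℕ) :
    u ⬝ᵥ (T₀ ^ m *ᵥ u) - u ⬝ᵥ (T ^ m *ᵥ u)
      = ρ * ∑ i ∈ Finset.range m, (u ⬝ᵥ (T₀ ^ i *ᵥ u)) * (u ⬝ᵥ (T ^ (m - 1 - i) *ᵥ u)) := by
  have tele : ∀ m : ℕ, ∀ x : ι → ℝ, x ⬝ᵥ (T₀ ^ m *ᵥ u) - x ⬝ᵥ (T ^ m *ᵥ u)
      = ρ * ∑ i ∈ Finset.range m, (x ⬝ᵥ (T₀ ^ i *ᵥ u)) * (u ⬝ᵥ (T ^ (m - 1 - i) *ᵥ u)) := by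
    intro m
    induction m with
    | zero => simp
    | succ m ih =>
      intro x
      have h1 : x ⬝ᵥ (T₀ ^ (m + 1) *ᵥ u) = (x ᵥ* T₀) ⬝ᵥ (T₀ ^ m *ᵥ u) := by
        rw [pow_succ', ← Matrix.mulVec_mulVec, Matrix.dotProduct_mulVec]
      have h2 : x ⬝ᵥ (T ^ (m + 1) *ᵥ u)
          = (x ᵥ* T₀) ⬝ᵥ (T ^ m *ᵥ u) - ρ * ((x ⬝ᵥ u) * (u ⬝ᵥ (T ^ m *ᵥ u))) := by
        rw [pow_succ', ← Matrix.mulVec_mulVec, ← Matrix.dotProduct_mulVec]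
        nth_rewrite 1 [h]
        rw [Matrix.sub_mulVec, dotProduct_sub, Matrix.smul_mulVec, dotProduct_smul,
          Matrix.vecMulVec_mulVec, smul_eq_mul]
        simp [dotProduct_smul, mul_comm]
      rw [h1, h2, Finset.sum_range_succ', ← sub_add, ih]
      have h3 : ∀ i ∈ Finset.range m, (x ⬝ᵥ (T₀ ^ (i + 1) *ᵥ u)) * (u ⬝ᵥ (T ^ (m + 1 - 1 - (i + 1)) *ᵥ u))
          = ((x ᵥ* T₀) ⬝ᵥ (T₀ ^ i *ᵥ u)) * (u ⬝ᵥ (T ^ (m - 1 - i) *ᵥ u)) := by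
        intro i hi
        rw [pow_succ', ← Matrix.mulVec_mulVec, Matrix.dotProduct_mulVec x]
        congr 4; omega
      rw [Finset.sum_congr rfl h3]
      simp
      ring
  exact tele m u

/-- A rank-one downdate of small relative size `ν` hardly decreases the moments: by `hν`, each of the
`m` terms in `moment_rankOne_sub` is at most `ν` times the `m`-th moment. -/
lemma moment_rankOne_ge {T T₀ : Matrix ι ι ℝ} {u : ι → ℝ} {ρ ν : ℝ}
    (h : T = T₀ - ρ • Matrix.vecMulVec u u) (hT : T.PosSemidef) (hT₀ : T₀.PosSemidef)
    (hρ0 : 0 ≤ ρ) (hρ1 : ρ ≤ 1)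
    (hν : ∀ i j, (u ⬝ᵥ (T₀ ^ i *ᵥ u)) * (u ⬝ᵥ (T₀ ^ j *ᵥ u)) ≤ ν * (u ⬝ᵥ (T₀ ^ (i + j + 1) *ᵥ u)))
    (m : ℕ) : (1 - m * ν) * (u ⬝ᵥ (T₀ ^ m *ᵥ u)) ≤ u ⬝ᵥ (T ^ m *ᵥ u) := by
  have hle : ∀ k, u ⬝ᵥ (T ^ k *ᵥ u) ≤ u ⬝ᵥ (T₀ ^ k *ᵥ u) := by
    intro k
    have := moment_rankOne_sub h k
    have h0 : 0 ≤ ρ * ∑ i ∈ Finset.range k,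
        (u ⬝ᵥ (T₀ ^ i *ᵥ u)) * (u ⬝ᵥ (T ^ (k - 1 - i) *ᵥ u)) :=
      mul_nonneg hρ0 (Finset.sum_nonneg fun i _ =>
        mul_nonneg (quad_pow_nonneg hT₀ u i) (quad_pow_nonneg hT u _))
    linarith
  have h1 := moment_rankOne_sub h m
  have h2 : ∑ i ∈ Finset.range m, (u ⬝ᵥ (T₀ ^ i *ᵥ u)) * (u ⬝ᵥ (T ^ (m - 1 - i) *ᵥ u))
      ≤ m * (ν * (u ⬝ᵥ (T₀ ^ m *ᵥ u))) := by
    calc _ ≤ ∑ i ∈ Finset.range m, ν * (u ⬝ᵥ (T₀ ^ m *ᵥ u)) := by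
          refine Finset.sum_le_sum fun i hi => ?_
          have hi' := Finset.mem_range.1 hi
          have := (mul_le_mul_of_nonneg_left (hle (m - 1 - i)) (quad_pow_nonneg hT₀ u i)).trans
            (hν i (m - 1 - i))
          rwa [show i + (m - 1 - i) + 1 = m by omega] at this
      _ = _ := by simp
  have h0 : 0 ≤ ∑ i ∈ Finset.range m, (u ⬝ᵥ (T₀ ^ i *ᵥ u)) * (u ⬝ᵥ (T ^ (m - 1 - i) *ᵥ u)) :=
    Finset.sum_nonneg fun i _ => mul_nonneg (quad_pow_nonneg hT₀ u i) (quad_pow_nonneg hT u _)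
  have h3 := mul_le_mul_of_nonneg_right hρ1 h0
  nlinarith

end PSD

/-! ### Leave-one-out trace moments of a weighted resolvent -/

section Resolvent

variable {ι : Type*} [Fintype ι] [DecidableEq ι]

/-- `I + ∑ⱼ yⱼ yⱼᵀ`. -/
def covMat {n : ℕ} (y : Fin n → ι → ℝ) : Matrix ι ι ℝ := 1 + ∑ j, Matrix.vecMulVec (y j) (y j)

/-- The weighted resolvent `G M⁻¹ G` for the diagonal matrix `G` with entries `g`. -/
def weightedInv (g : ι → ℝ) (M : Matrix ι ι ℝ) : Matrix ι ι ℝ :=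
  Matrix.diagonal g * M⁻¹ * Matrix.diagonal g

lemma dotProduct_covMat_mulVec {n : ℕ} (y : Fin n → ι → ℝ) (u : ι → ℝ) :
    u ⬝ᵥ (covMat y *ᵥ u) = u ⬝ᵥ u + ∑ j, (y j ⬝ᵥ u) ^ 2 := by
  rw [covMat, Matrix.add_mulVec, Matrix.one_mulVec, dotProduct_add, Matrix.sum_mulVec,
    dotProduct_sum]
  congr 1
  refine Finset.sum_congr rfl fun j _ => ?_
  rw [Matrix.vecMulVec_mulVec]
  simp [dotProduct_smul, sq, dotProduct_comm]

lemma covMat_isHermitian {n : ℕ} (y : Fin n → ι → ℝ) : (covMat y).IsHermitian := by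
  rw [Matrix.IsHermitian, Matrix.conjTranspose_eq_transpose_of_trivial, covMat,
    Matrix.transpose_add, Matrix.transpose_one, Matrix.transpose_sum]
  simp [Matrix.transpose_vecMulVec]

lemma covMat_posDef {n : ℕ} (y : Fin n → ι → ℝ) : (covMat y).PosDef := by
  refine Matrix.PosDef.of_dotProduct_mulVec_pos (covMat_isHermitian y) fun {x} hx => ?_
  rw [star_trivial, dotProduct_covMat_mulVec]
  have h1 : 0 < x ⬝ᵥ x := by
    have := (Matrix.dotProduct_star_self_pos_iff (v := x)).2 hx
    simpa using this
  have h2 : 0 ≤ ∑ j, (y j ⬝ᵥ x) ^ 2 := Finset.sum_nonneg fun j _ => sq_nonneg _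
  linarith

lemma dotProduct_self_le_covMat {n : ℕ} (y : Fin n → ι → ℝ) (u : ι → ℝ) :
    u ⬝ᵥ u ≤ u ⬝ᵥ (covMat y *ᵥ u) := by
  rw [dotProduct_covMat_mulVec]
  have h2 : 0 ≤ ∑ j, (y j ⬝ᵥ u) ^ 2 := Finset.sum_nonneg fun j _ => sq_nonneg _
  linarith

variable {M : Matrix ι ι ℝ} {ξ g : ι → ℝ}

lemma inv_transpose_of_posDef (hM : M.PosDef) : (M⁻¹)ᵀ = M⁻¹ := by
  have := hM.inv.1
  rwa [Matrix.IsHermitian, Matrix.conjTranspose_eq_transpose_of_trivial] at this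

lemma weightedInv_posSemidef (hM : M.PosDef) (g : ι → ℝ) : (weightedInv g M).PosSemidef := by
  have := hM.inv.posSemidef.mul_mul_conjTranspose_same (Matrix.diagonal g)
  rwa [Matrix.conjTranspose_eq_transpose_of_trivial, Matrix.diagonal_transpose] at this

lemma dotProduct_weightedInv (g : ι → ℝ) (M : Matrix ι ι ℝ) (v : ι → ℝ) :
    v ⬝ᵥ (weightedInv g M *ᵥ v)
      = (Matrix.diagonal g *ᵥ v) ⬝ᵥ (M⁻¹ *ᵥ (Matrix.diagonal g *ᵥ v)) := by
  rw [weightedInv, ← Matrix.mulVec_mulVec, ← Matrix.mulVec_mulVec, Matrix.dotProduct_mulVec,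
    ← Matrix.mulVec_transpose, Matrix.diagonal_transpose]

lemma mulVec_inv_mulVec (hM : M.PosDef) (v : ι → ℝ) : M *ᵥ (M⁻¹ *ᵥ v) = v := by
  rw [Matrix.mulVec_mulVec, Matrix.mul_nonsing_inv _ (hM.isUnit.map Matrix.detMonoidHom),
    Matrix.one_mulVec]

lemma dotProduct_inv_le (hM : M.PosDef) (h1 : ∀ u, u ⬝ᵥ u ≤ u ⬝ᵥ (M *ᵥ u)) (v : ι → ℝ) :
    0 ≤ v ⬝ᵥ (M⁻¹ *ᵥ v) ∧ v ⬝ᵥ (M⁻¹ *ᵥ v) ≤ v ⬝ᵥ v := by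
  refine ⟨by simpa using hM.inv.posSemidef.dotProduct_mulVec_nonneg v, ?_⟩
  have h2 := h1 (M⁻¹ *ᵥ v)
  rw [mulVec_inv_mulVec hM, dotProduct_comm _ v] at h2
  have h3 : 0 ≤ (v - M⁻¹ *ᵥ v) ⬝ᵥ (v - M⁻¹ *ᵥ v) := by
    exact Finset.sum_nonneg fun i _ => mul_self_nonneg _
  rw [sub_dotProduct, dotProduct_sub, dotProduct_sub, dotProduct_comm (M⁻¹ *ᵥ v) v] at h3
  linarith

lemma weightedInv_le_diagonal (hM : M.PosDef) (h1 : ∀ u, u ⬝ᵥ u ≤ u ⬝ᵥ (M *ᵥ u)) (v : ι → ℝ) :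
    v ⬝ᵥ (weightedInv g M *ᵥ v) ≤ v ⬝ᵥ (Matrix.diagonal (fun i => g i ^ 2) *ᵥ v) := by
  rw [dotProduct_weightedInv]
  refine (dotProduct_inv_le hM h1 _).2.trans (le_of_eq ?_)
  simp only [dotProduct, Matrix.mulVec_diagonal]
  exact Finset.sum_congr rfl fun i _ => by ring

/-- The Sherman–Morrison formula. -/
lemma inv_add_vecMulVec (hM : M.PosDef) (ξ : ι → ℝ) :
    (M + Matrix.vecMulVec ξ ξ)⁻¹
      = M⁻¹ - (1 + ξ ⬝ᵥ (M⁻¹ *ᵥ ξ))⁻¹ • Matrix.vecMulVec (M⁻¹ *ᵥ ξ) (M⁻¹ *ᵥ ξ) := by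
  have h0 : 0 ≤ ξ ⬝ᵥ (M⁻¹ *ᵥ ξ) := by simpa using hM.inv.posSemidef.dotProduct_mulVec_nonneg ξ
  refine Matrix.inv_eq_right_inv ?_
  have h1 : Matrix.vecMulVec ξ ξ * M⁻¹ = Matrix.vecMulVec ξ (M⁻¹ *ᵥ ξ) := by
    rw [Matrix.vecMulVec_mul, ← Matrix.mulVec_transpose, inv_transpose_of_posDef hM]
  have h2 : M * Matrix.vecMulVec (M⁻¹ *ᵥ ξ) (M⁻¹ *ᵥ ξ) = Matrix.vecMulVec ξ (M⁻¹ *ᵥ ξ) := by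
    rw [Matrix.mul_vecMulVec, mulVec_inv_mulVec hM]
  have h3 : Matrix.vecMulVec ξ ξ * Matrix.vecMulVec (M⁻¹ *ᵥ ξ) (M⁻¹ *ᵥ ξ)
      = (ξ ⬝ᵥ (M⁻¹ *ᵥ ξ)) • Matrix.vecMulVec ξ (M⁻¹ *ᵥ ξ) := by
    rw [Matrix.vecMulVec_mul_vecMulVec]
    ext i j
    simp [Matrix.vecMulVec_apply]
    ring
  rw [add_mul, mul_sub, mul_sub, Matrix.mul_nonsing_inv _ (hM.isUnit.map Matrix.detMonoidHom),
    Matrix.mul_smul, Matrix.mul_smul, h1, h2, h3, smul_smul]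
  have h4 : (1 + ξ ⬝ᵥ (M⁻¹ *ᵥ ξ))⁻¹ * ξ ⬝ᵥ (M⁻¹ *ᵥ ξ) = 1 - (1 + ξ ⬝ᵥ (M⁻¹ *ᵥ ξ))⁻¹ := by
    field_simp; ring
  rw [h4, sub_smul, one_smul]
  abel

lemma inv_add_vecMulVec_mulVec (hM : M.PosDef) (ξ : ι → ℝ) :
    (M + Matrix.vecMulVec ξ ξ)⁻¹ *ᵥ ξ = (1 + ξ ⬝ᵥ (M⁻¹ *ᵥ ξ))⁻¹ • (M⁻¹ *ᵥ ξ) := by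
  have h0 : 0 ≤ ξ ⬝ᵥ (M⁻¹ *ᵥ ξ) := by simpa using hM.inv.posSemidef.dotProduct_mulVec_nonneg ξ
  rw [inv_add_vecMulVec hM, Matrix.sub_mulVec, Matrix.smul_mulVec, Matrix.vecMulVec_mulVec]
  ext i
  simp [dotProduct_comm (M⁻¹ *ᵥ ξ) ξ]
  field_simp; ring

lemma weightedInv_add_vecMulVec (hM : M.PosDef) (ξ g : ι → ℝ) :
    weightedInv g (M + Matrix.vecMulVec ξ ξ) = weightedInv g M - (1 + ξ ⬝ᵥ (M⁻¹ *ᵥ ξ))⁻¹ •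
      Matrix.vecMulVec (Matrix.diagonal g *ᵥ (M⁻¹ *ᵥ ξ)) (Matrix.diagonal g *ᵥ (M⁻¹ *ᵥ ξ)) := by
  rw [weightedInv, weightedInv, inv_add_vecMulVec hM, mul_sub, sub_mul, Matrix.mul_smul,
    Matrix.smul_mul, Matrix.mul_vecMulVec, Matrix.vecMulVec_mul, ← Matrix.mulVec_transpose,
    Matrix.diagonal_transpose]

lemma posDef_add_vecMulVec (hM : M.PosDef) (ξ : ι → ℝ) : (M + Matrix.vecMulVec ξ ξ).PosDef := by
  have := Matrix.posSemidef_vecMulVec_self_star ξ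
  rw [star_trivial] at this
  exact hM.add_posSemidef this

/-- Adding a sample decreases the weighted resolvent in the Loewner order. -/
lemma weightedInv_add_le (hM : M.PosDef) (ξ g v : ι → ℝ) :
    v ⬝ᵥ (weightedInv g (M + Matrix.vecMulVec ξ ξ) *ᵥ v) ≤ v ⬝ᵥ (weightedInv g M *ᵥ v) := by
  have h0 : 0 ≤ ξ ⬝ᵥ (M⁻¹ *ᵥ ξ) := by simpa using hM.inv.posSemidef.dotProduct_mulVec_nonneg ξ
  rw [weightedInv_add_vecMulVec hM, Matrix.sub_mulVec, dotProduct_sub, Matrix.smul_mulVec,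
    dotProduct_smul, Matrix.vecMulVec_mulVec, smul_eq_mul]
  set w := Matrix.diagonal g *ᵥ (M⁻¹ *ᵥ ξ)
  have : v ⬝ᵥ (MulOpposite.op (w ⬝ᵥ v) • w) = (w ⬝ᵥ v) ^ 2 := by
    simp [dotProduct_smul, sq, dotProduct_comm]
  rw [this]
  have : 0 ≤ (1 + ξ ⬝ᵥ (M⁻¹ *ᵥ ξ))⁻¹ * (w ⬝ᵥ v) ^ 2 := by positivity
  linarith

/-- Adding a sample of small leverage changes its own contribution to the trace moments only by
a constant factor. -/
lemma loo_moment_ge (hM : M.PosDef) (h1 : ∀ u, u ⬝ᵥ u ≤ u ⬝ᵥ (M *ᵥ u)) {τ : ℝ} {m : ℕ}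
    (hξ : ξ ⬝ᵥ ξ ≤ τ) (hτ : τ ≤ 1 / 2) (hm : m * τ ≤ 1 / 2) :
    2 / 9 * ((Matrix.diagonal g *ᵥ (M⁻¹ *ᵥ ξ))
        ⬝ᵥ (weightedInv g M ^ m *ᵥ (Matrix.diagonal g *ᵥ (M⁻¹ *ᵥ ξ))))
      ≤ (Matrix.diagonal g *ᵥ ((M + Matrix.vecMulVec ξ ξ)⁻¹ *ᵥ ξ))
        ⬝ᵥ (weightedInv g (M + Matrix.vecMulVec ξ ξ) ^ m *ᵥ
          (Matrix.diagonal g *ᵥ ((M + Matrix.vecMulVec ξ ξ)⁻¹ *ᵥ ξ))) := by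
  obtain ⟨h0, hle⟩ := dotProduct_inv_le hM h1 ξ
  set ν := ξ ⬝ᵥ (M⁻¹ *ᵥ ξ) with hν
  set u := Matrix.diagonal g *ᵥ (M⁻¹ *ᵥ ξ) with hu
  have hντ : ν ≤ τ := hle.trans hξ
  obtain ⟨B, hB⟩ := exists_factor hM.inv.posSemidef
  have hC : weightedInv g M = (B * Matrix.diagonal g)ᵀ * (B * Matrix.diagonal g) := by
    rw [weightedInv, hB, Matrix.transpose_mul, Matrix.diagonal_transpose]
    simp only [Matrix.mul_assoc]
  have hCu : (B * Matrix.diagonal g)ᵀ *ᵥ (B *ᵥ ξ) = u := by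
    rw [hu, hB, Matrix.transpose_mul, Matrix.diagonal_transpose, Matrix.mulVec_mulVec,
      Matrix.mulVec_mulVec, Matrix.mul_assoc]
  have hζ : (B *ᵥ ξ) ⬝ᵥ (B *ᵥ ξ) = ν := by
    rw [hν, hB, ← Matrix.mulVec_mulVec, Matrix.dotProduct_mulVec ξ, ← Matrix.mulVec_transpose,
      Matrix.transpose_transpose]
  have hmom : ∀ i j, (u ⬝ᵥ (weightedInv g M ^ i *ᵥ u)) * (u ⬝ᵥ (weightedInv g M ^ j *ᵥ u))
      ≤ ν * (u ⬝ᵥ (weightedInv g M ^ (i + j + 1) *ᵥ u)) := by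
    intro i j
    have := moment_mul_le_of_factor (B * Matrix.diagonal g) (B *ᵥ ξ) i j
    rwa [hCu, ← hC, hζ] at this
  have hge := moment_rankOne_ge (weightedInv_add_vecMulVec hM ξ g)
    (weightedInv_posSemidef (posDef_add_vecMulVec hM ξ) g) (weightedInv_posSemidef hM g)
    (by positivity) (inv_le_one_of_one_le₀ (by linarith)) hmom m
  rw [inv_add_vecMulVec_mulVec hM, Matrix.mulVec_smul, Matrix.mulVec_smul, smul_dotProduct,
    dotProduct_smul, ← hu, ← hν, smul_eq_mul, smul_eq_mul]
  have hq := quad_pow_nonneg (weightedInv_posSemidef hM g) u m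
  have hmν : (m : ℝ) * ν ≤ 1 / 2 :=
    (mul_le_mul_of_nonneg_left hντ (Nat.cast_nonneg m)).trans hm
  have h2 : (2 / 3 : ℝ) ≤ (1 + ν)⁻¹ := by
    rw [show (2 / 3 : ℝ) = (3 / 2)⁻¹ by norm_num]
    exact inv_anti₀ (by linarith) (by linarith)
  set q := u ⬝ᵥ (weightedInv g M ^ m *ᵥ u)
  set q' := u ⬝ᵥ (weightedInv g (M + Matrix.vecMulVec ξ ξ) ^ m *ᵥ u)
  -- the moments are at least halved, and `M⁻¹ ξ` is scaled by a factor of at least `2 / 3`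
  have h3 : q / 2 ≤ q' := by nlinarith
  have h4 : (4 / 9 : ℝ) ≤ (1 + ν)⁻¹ * (1 + ν)⁻¹ := by nlinarith
  have h5 : 0 ≤ q' := by linarith
  nlinarith [mul_le_mul_of_nonneg_right h4 h5]

/-- With `L = G M⁻¹`, the contributions of the samples add up to `tr (T ^ m L (M - 1) Lᵀ)`, which equals
`tr T ^ (m + 1)` up to a nonpositive term. -/
lemma sum_moment_le_trace {n : ℕ} (y : Fin n → ι → ℝ) (g : ι → ℝ) (m : ℕ) :
    ∑ j, (Matrix.diagonal g *ᵥ ((covMat y)⁻¹ *ᵥ y j))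
        ⬝ᵥ (weightedInv g (covMat y) ^ m *ᵥ (Matrix.diagonal g *ᵥ ((covMat y)⁻¹ *ᵥ y j)))
      ≤ (weightedInv g (covMat y) ^ (m + 1)).trace := by
  have hM := covMat_posDef y
  set M := covMat y with hMd
  set T := weightedInv g M with hT
  set L := Matrix.diagonal g * M⁻¹ with hL
  have hLt : Lᵀ = M⁻¹ * Matrix.diagonal g := by
    rw [hL, Matrix.transpose_mul, inv_transpose_of_posDef hM, Matrix.diagonal_transpose]
  have e1 : ∀ v : ι → ℝ, v ⬝ᵥ (T ^ m *ᵥ v) = (T ^ m * Matrix.vecMulVec v v).trace := by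
    intro v
    rw [Matrix.mul_vecMulVec, Matrix.trace_vecMulVec, dotProduct_comm]
  have e2 : ∀ j, Matrix.vecMulVec (Matrix.diagonal g *ᵥ (M⁻¹ *ᵥ y j))
      (Matrix.diagonal g *ᵥ (M⁻¹ *ᵥ y j)) = L * Matrix.vecMulVec (y j) (y j) * Lᵀ := by
    intro j
    rw [Matrix.mul_vecMulVec, Matrix.vecMulVec_mul, ← Matrix.mulVec_transpose,
      Matrix.transpose_transpose, Matrix.mulVec_mulVec]
  simp only [e1, e2]
  have e3 : ∑ j, (T ^ m * (L * Matrix.vecMulVec (y j) (y j) * Lᵀ)).trace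
      = (T ^ m * (L * (M - 1) * Lᵀ)).trace := by
    rw [← Matrix.trace_sum, ← Matrix.mul_sum, ← Matrix.sum_mul, ← Matrix.mul_sum]
    congr 4
    rw [hMd, covMat]; abel
  have e4 : L * (M - 1) * Lᵀ = T - L * Lᵀ := by
    have : L * M = Matrix.diagonal g := by
      rw [hL, Matrix.mul_assoc, Matrix.nonsing_inv_mul _ (hM.isUnit.map Matrix.detMonoidHom),
        Matrix.mul_one]
    rw [mul_sub, this, Matrix.mul_one, sub_mul, hLt, hT, weightedInv]
    simp only [Matrix.mul_assoc]
  have e5 : 0 ≤ (T ^ m * (L * Lᵀ)).trace := by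
    have h := ((weightedInv_posSemidef hM g).pow m).conjTranspose_mul_mul_same L
    rw [Matrix.conjTranspose_eq_transpose_of_trivial] at h
    have := h.trace_nonneg
    rwa [Matrix.trace_mul_comm, ← Matrix.mul_assoc, Matrix.trace_mul_comm] at this
  rw [e3, e4, mul_sub, Matrix.trace_sub, ← pow_succ]
  linarith

lemma continuous_covMat_inv {n : ℕ} :
    Continuous fun y : Fin n → ι → ℝ => (covMat y)⁻¹ := by
  have h1 : Continuous fun y : Fin n → ι → ℝ => covMat y := by
    unfold covMat
    refine continuous_const.add (continuous_finsetSum _ fun j _ => ?_)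
    exact (continuous_apply j).matrix_vecMulVec (continuous_apply j)
  simp only [Matrix.inv_def, Ring.inverse_eq_inv']
  exact (h1.matrix_det.inv₀ fun y => (covMat_posDef y).det_pos.ne').smul h1.matrix_adjugate

lemma continuous_weightedInv {n : ℕ} (g : ι → ℝ) :
    Continuous fun y : Fin n → ι → ℝ => weightedInv g (covMat y) :=
  (continuous_const.matrix_mul continuous_covMat_inv).matrix_mul continuous_const

end Resolvent

section TraceMoment

variable {ι : Type*} [Fintype ι] [DecidableEq ι]

lemma quad_form_expand (H : Matrix ι ι ℝ) (v : ι → ℝ) :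
    v ⬝ᵥ (H *ᵥ v) = ∑ a, ∑ b, H a b * (v a * v b) := by
  simp only [dotProduct, Matrix.mulVec, Finset.mul_sum]
  exact Finset.sum_congr rfl fun a _ => Finset.sum_congr rfl fun b _ => by ring

lemma mulVec_quad (D N T : Matrix ι ι ℝ) (hD : Dᵀ = D) (hN : Nᵀ = N) (v : ι → ℝ) :
    (D *ᵥ (N *ᵥ v)) ⬝ᵥ (T *ᵥ (D *ᵥ (N *ᵥ v))) = v ⬝ᵥ ((N * D * T * D * N) *ᵥ v) := by
  have e : ∀ w : ι → ℝ, (D *ᵥ (N *ᵥ v)) ⬝ᵥ w = v ⬝ᵥ (N *ᵥ (D *ᵥ w)) := by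
    intro w
    rw [Matrix.dotProduct_mulVec v, Matrix.dotProduct_mulVec, ← Matrix.mulVec_transpose,
      ← Matrix.mulVec_transpose, hD, hN]
  rw [e]
  simp only [Matrix.mulVec_mulVec, Matrix.mul_assoc]

/-- The mean of the contribution of a further sample, with second moment matrix `G²`, is a trace
moment. -/
lemma trace_pow_add_two (g : ι → ℝ) (M : Matrix ι ι ℝ) (m : ℕ) :
    ∑ a, (M⁻¹ * Matrix.diagonal g * weightedInv g M ^ m * Matrix.diagonal g * M⁻¹) a a * g a ^ 2
      = (weightedInv g M ^ (m + 2)).trace := by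
  have h : weightedInv g M ^ (m + 2) = weightedInv g M ^ m *
      ((Matrix.diagonal g * M⁻¹ * Matrix.diagonal g) * (Matrix.diagonal g * M⁻¹ * Matrix.diagonal g)) := by
    rw [pow_add, sq]; rfl
  have h2 : ∑ a, (M⁻¹ * Matrix.diagonal g * weightedInv g M ^ m * Matrix.diagonal g * M⁻¹) a a * g a ^ 2
      = (M⁻¹ * Matrix.diagonal g * weightedInv g M ^ m * Matrix.diagonal g * M⁻¹ *
        (Matrix.diagonal g * Matrix.diagonal g)).trace := by
    rw [Matrix.diagonal_mul_diagonal]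
    simp only [Matrix.trace, Matrix.diag, Matrix.mul_diagonal, sq]
  rw [h2, h]
  rw [show M⁻¹ * Matrix.diagonal g * weightedInv g M ^ m * Matrix.diagonal g * M⁻¹ *
        (Matrix.diagonal g * Matrix.diagonal g) = (M⁻¹ * Matrix.diagonal g) *
        (weightedInv g M ^ m * (Matrix.diagonal g * M⁻¹ * (Matrix.diagonal g * Matrix.diagonal g))) by
      simp only [Matrix.mul_assoc], Matrix.trace_mul_comm]
  congr 1
  simp only [Matrix.mul_assoc]

variable {α : Type*} [MeasurableSpace α] {μ : Measure α} [IsProbabilityMeasure μ]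

lemma integral_quad_form {ξ : α → ι → ℝ} {g : ι → ℝ} {H : Matrix ι ι ℝ}
    (hint : ∀ a b, Integrable (fun x => ξ x a * ξ x b) μ)
    (hmom : ∀ a b, ∫ x, ξ x a * ξ x b ∂μ = if a = b then g a ^ 2 else 0) :
    ∫ x, ξ x ⬝ᵥ (H *ᵥ ξ x) ∂μ = ∑ a, H a a * g a ^ 2 := by
  have hi : ∀ a b, Integrable (fun x => H a b * (ξ x a * ξ x b)) μ := fun a b =>
    (hint a b).const_mul _
  calc ∫ x, ξ x ⬝ᵥ (H *ᵥ ξ x) ∂μ = ∫ x, ∑ a, ∑ b, H a b * (ξ x a * ξ x b) ∂μ := by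
        simp only [quad_form_expand]
    _ = ∑ a, ∑ b, ∫ x, H a b * (ξ x a * ξ x b) ∂μ := by
        rw [integral_finsetSum _ fun a _ => integrable_finsetSum _ fun b _ => hi a b]
        exact Finset.sum_congr rfl fun a _ => integral_finsetSum _ fun b _ => hi a b
    _ = _ := by
        simp only [integral_const_mul, hmom, mul_ite, mul_zero, Finset.sum_ite_eq, Finset.mem_univ,
          if_true]

/-- For `n + 1` independent samples `ξᵢ` with second moment matrix `G²` and small norm, the trace
moments of `G (I + ∑ ξᵢ ξᵢᵀ)⁻¹ G` are as small as if `∑ ξᵢ ξᵢᵀ` were of order `n G²`. The sum over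
`i` of the contribution of the `i`-th sample is bounded by the trace of one power less, whereas
each contribution is, in the mean, comparable to the trace itself, by leaving out the sample. -/
lemma integral_trace_pow_le {n : ℕ} {ξ : α → ι → ℝ} (hξ : Measurable ξ) {g : ι → ℝ}
    (hmom : ∀ a b, ∫ x, ξ x a * ξ x b ∂μ = if a = b then g a ^ 2 else 0) {τ : ℝ} {m : ℕ}
    (hb : ∀ x, ξ x ⬝ᵥ ξ x ≤ τ) (hτ : τ ≤ 1 / 2) (hm : m * τ ≤ 1 / 2) :
    Integrable (fun X : Fin (n + 1) → α =>
        (weightedInv g (covMat fun i => ξ (X i)) ^ (m + 2)).trace) (Measure.pi fun _ => μ) ∧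
      ∫ X : Fin (n + 1) → α, (weightedInv g (covMat fun i => ξ (X i)) ^ (m + 2)).trace
        ∂(Measure.pi fun _ => μ) ≤ Fintype.card ι * (9 / (n + 1 : ℝ)) ^ (m + 2) := by
  set P : Measure (Fin (n + 1) → α) := Measure.pi fun _ => μ with hP
  set P' : Measure (Fin n → α) := Measure.pi fun _ => μ with hP'
  set y : (Fin (n + 1) → α) → Fin (n + 1) → ι → ℝ := fun X i => ξ (X i) with hy
  have hym : Measurable y := by fun_prop
  set T : (Fin (n + 1) → α) → Matrix ι ι ℝ := fun X => weightedInv g (covMat (y X)) with hTd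
  set D : ℕ → ℝ := fun k => (Matrix.diagonal (fun i => g i ^ 2) ^ k).trace with hD
  have hDps : (Matrix.diagonal (fun i => g i ^ 2)).PosSemidef :=
    Matrix.PosSemidef.diagonal fun i => sq_nonneg _
  have htr : ∀ k X, 0 ≤ (T X ^ k).trace ∧ (T X ^ k).trace ≤ D k := fun k X =>
    ⟨((weightedInv_posSemidef (covMat_posDef _) g).pow k).trace_nonneg,
      trace_pow_mono (weightedInv_posSemidef (covMat_posDef _) g) hDps
        (weightedInv_le_diagonal (covMat_posDef _) (dotProduct_self_le_covMat _)) k⟩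
  have hcT : ∀ k, Continuous fun z : Fin (n + 1) → ι → ℝ => (weightedInv g (covMat z) ^ k).trace :=
    fun k => ((continuous_weightedInv g).pow k).matrix_trace
  have hmT : ∀ k, Measurable fun X => (T X ^ k).trace := fun k => (hcT k).measurable.comp hym
  have hiT : ∀ k, Integrable (fun X => (T X ^ k).trace) P := fun k =>
    Integrable.of_bound (hmT k).aestronglyMeasurable (D k) (ae_of_all _ fun X => by
      rw [Real.norm_of_nonneg (htr k X).1]; exact (htr k X).2)
  set φ : Fin (n + 1) → (Fin (n + 1) → α) → ℝ := fun i X =>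
    (Matrix.diagonal g *ᵥ ((covMat (y X))⁻¹ *ᵥ y X i))
        ⬝ᵥ (T X ^ m *ᵥ (Matrix.diagonal g *ᵥ ((covMat (y X))⁻¹ *ᵥ y X i))) with hφ
  have hφ0 : ∀ i X, 0 ≤ φ i X := fun i X =>
    quad_pow_nonneg (weightedInv_posSemidef (covMat_posDef _) g) _ m
  have hφs : ∀ X, ∑ i, φ i X ≤ (T X ^ (m + 1)).trace := fun X => sum_moment_le_trace (y X) g m
  have hφle : ∀ i X, φ i X ≤ D (m + 1) := fun i X =>
    (Finset.single_le_sum (f := fun j => φ j X) (fun j _ => hφ0 j X) (Finset.mem_univ i)).trans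
      ((hφs X).trans (htr _ X).2)
  have hmφ : ∀ i, Measurable (φ i) := by
    intro i
    have hc : Continuous fun z : Fin (n + 1) → ι → ℝ =>
        (Matrix.diagonal g *ᵥ ((covMat z)⁻¹ *ᵥ z i)) ⬝ᵥ (weightedInv g (covMat z) ^ m *ᵥ
          (Matrix.diagonal g *ᵥ ((covMat z)⁻¹ *ᵥ z i))) := by
      have h1 : Continuous fun z : Fin (n + 1) → ι → ℝ =>
          Matrix.diagonal g *ᵥ ((covMat z)⁻¹ *ᵥ z i) :=
        continuous_const.matrix_mulVec (continuous_covMat_inv.matrix_mulVec (continuous_apply i))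
      exact h1.dotProduct (((continuous_weightedInv g).pow m).matrix_mulVec h1)
    exact hc.measurable.comp hym
  have hiφ : ∀ i, Integrable (φ i) P := fun i =>
    Integrable.of_bound (hmφ i).aestronglyMeasurable (D (m + 1)) (ae_of_all _ fun X => by
      rw [Real.norm_of_nonneg (hφ0 i X)]; exact hφle i X)
  -- the contribution of each sample, integrated over that sample first
  have hkey : ∀ i, 2 / 9 * ∫ X, (T X ^ (m + 2)).trace ∂P ≤ ∫ X, φ i X ∂P := by
    intro i
    have hmp := (measurePreserving_piFinSuccAbove (fun _ : Fin (n + 1) => μ) i).symm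
    rw [← integral_const_mul, ← hmp.integral_comp' (g := φ i),
      ← hmp.integral_comp' (g := fun X => 2 / 9 * (T X ^ (m + 2)).trace)]
    have hI1 := hmp.integrable_comp_of_integrable ((hiT (m + 2)).const_mul (2 / 9))
    have hI2 := hmp.integrable_comp_of_integrable (hiφ i)
    change ∫ z, ((fun x => 2 / 9 * (T x ^ (m + 2)).trace) ∘
        (MeasurableEquiv.piFinSuccAbove (fun _ => α) i).symm) z ∂_
      ≤ ∫ z, (φ i ∘ (MeasurableEquiv.piFinSuccAbove (fun _ => α) i).symm) z ∂_
    rw [integral_prod_symm _ hI1, integral_prod_symm _ hI2]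
    refine integral_mono_ae hI1.integral_prod_right hI2.integral_prod_right ?_
    filter_upwards [hI1.prod_left_ae, hI2.prod_left_ae] with Y hY1 hY2
    have hsplit : ∀ x : α, covMat (y ((MeasurableEquiv.piFinSuccAbove (fun _ => α) i).symm (x, Y)))
        = covMat (fun j => ξ (Y j)) + Matrix.vecMulVec (ξ x) (ξ x) := by
      intro x
      simp only [covMat, hy, MeasurableEquiv.piFinSuccAbove_symm_apply, Fin.insertNthEquiv]
      rw [Fin.sum_univ_succAbove _ i]
      simp only [Equiv.coe_fn_mk, Fin.insertNth_apply_same, Fin.insertNth_apply_succAbove]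
      abel
    set M₀ := covMat (fun j => ξ (Y j)) with hM₀
    have hpd : M₀.PosDef := covMat_posDef _
    have hyi : ∀ x : α, y ((MeasurableEquiv.piFinSuccAbove (fun _ => α) i).symm (x, Y)) i = ξ x := by
      intro x
      simp [hy, MeasurableEquiv.piFinSuccAbove_symm_apply, Fin.insertNthEquiv]
    set H := M₀⁻¹ * Matrix.diagonal g * weightedInv g M₀ ^ m * Matrix.diagonal g * M₀⁻¹ with hH
    have hξc : ∀ a, Measurable fun x => ξ x a := fun a => (measurable_pi_apply a).comp hξ
    have hτ0 : ∀ x a, |ξ x a| ≤ 1 := by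
      intro x a
      have : ξ x a * ξ x a ≤ ξ x ⬝ᵥ ξ x :=
        Finset.single_le_sum (f := fun a => ξ x a * ξ x a) (fun b _ => mul_self_nonneg _)
          (Finset.mem_univ a)
      rw [← sq_le_one_iff_abs_le_one]
      nlinarith [hb x]
    have hint : ∀ a b, Integrable (fun x => ξ x a * ξ x b) μ := fun a b =>
      Integrable.of_bound ((hξc a).mul (hξc b)).aestronglyMeasurable 1 (ae_of_all _ fun x => by
        rw [Real.norm_eq_abs, abs_mul]; exact mul_le_one₀ (hτ0 x a) (abs_nonneg _) (hτ0 x b))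
    have hquadI : Integrable (fun x => ξ x ⬝ᵥ (H *ᵥ ξ x)) μ := by
      simp only [quad_form_expand]
      exact integrable_finsetSum _ fun a _ => integrable_finsetSum _ fun b _ =>
        (hint a b).const_mul _
    have hquad : ∫ x, ξ x ⬝ᵥ (H *ᵥ ξ x) ∂μ = (weightedInv g M₀ ^ (m + 2)).trace := by
      rw [integral_quad_form hint hmom, ← trace_pow_add_two, hH]
    calc ∫ x, 2 / 9 * (T ((MeasurableEquiv.piFinSuccAbove (fun _ => α) i).symm (x, Y)) ^ (m + 2)).trace ∂μ
        ≤ ∫ _x, 2 / 9 * (weightedInv g M₀ ^ (m + 2)).trace ∂μ := by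
          refine integral_mono hY1 (integrable_const _) fun x => ?_
          refine mul_le_mul_of_nonneg_left ?_ (by norm_num)
          simp only [hTd]
          rw [hsplit x]
          exact trace_pow_mono (weightedInv_posSemidef (posDef_add_vecMulVec hpd _) g)
            (weightedInv_posSemidef hpd g) (weightedInv_add_le hpd _ g) _
      _ = ∫ x, 2 / 9 * (ξ x ⬝ᵥ (H *ᵥ ξ x)) ∂μ := by
          rw [integral_const_mul, integral_const_mul, hquad]; simp
      _ ≤ _ := by
          refine integral_mono (hquadI.const_mul _) hY2 fun x => ?_
          have := loo_moment_ge (g := g) hpd (dotProduct_self_le_covMat _) (m := m) (hb x) hτ hm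
          rw [mulVec_quad _ _ _ (Matrix.diagonal_transpose _) (inv_transpose_of_posDef hpd)] at this
          simp only [hφ, hTd, Function.comp]
          rw [hsplit x, hyi x]
          exact this
  refine ⟨hiT (m + 2), ?_⟩
  set F := ∫ X, (T X ^ (m + 2)).trace ∂P with hF
  have hn : (0 : ℝ) < n + 1 := by positivity
  have h1 : (n + 1 : ℝ) * (2 / 9 * F) ≤ ∫ X, (T X ^ (m + 1)).trace ∂P := by
    calc (n + 1 : ℝ) * (2 / 9 * F) = ∑ _i : Fin (n + 1), 2 / 9 * F := by simp
      _ ≤ ∑ i, ∫ X, φ i X ∂P := Finset.sum_le_sum fun i _ => hkey i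
      _ = ∫ X, ∑ i, φ i X ∂P := (integral_finsetSum _ fun i _ => hiφ i).symm
      _ ≤ _ := integral_mono (integrable_finsetSum _ fun i _ => hiφ i) (hiT _) hφs
  -- with this `A`, the term `F / A` is half of the left-hand side of `h1`
  set A : ℝ := 9 / (n + 1) with hA
  have hA0 : 0 < A := by positivity
  have h2 : ∫ X, (T X ^ (m + 1)).trace ∂P ≤ F / A + Fintype.card ι * A ^ (m + 1) := by
    calc _ ≤ ∫ X, ((T X ^ (m + 2)).trace / A + Fintype.card ι * A ^ (m + 1)) ∂P :=
          integral_mono (hiT _) (((hiT _).div_const _).add (integrable_const _)) fun X =>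
            trace_pow_le_succ (weightedInv_posSemidef (covMat_posDef _) g) hA0 (m + 1)
      _ = _ := by
          rw [integral_add ((hiT _).div_const _) (integrable_const _), integral_div]
          simp [hF]
  have h3 : F / A = (n + 1) / 9 * F := by rw [hA]; field_simp
  have h4 : (n + 1 : ℝ) / 9 * F ≤ Fintype.card ι * A ^ (m + 1) := by
    have := h1.trans h2
    rw [h3] at this
    linarith
  calc F = A * ((n + 1 : ℝ) / 9 * F) := by rw [hA]; field_simp
    _ ≤ A * (Fintype.card ι * A ^ (m + 1)) := mul_le_mul_of_nonneg_left h4 hA0.le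
    _ = _ := by ring

/-- If all eigenvalues of `G M⁻¹ G` are at most `t`, then `G² ≤ t M` in the Loewner order. -/
lemma weighted_le_of_trace_pow_le {n : ℕ} (y : Fin n → ι → ℝ) (g : ι → ℝ) {t : ℝ} (ht : 0 < t)
    {m : ℕ} (h : (weightedInv g (covMat y) ^ (m + 1)).trace ≤ t ^ (m + 1)) (u : ι → ℝ) :
    ∑ a, g a ^ 2 * u a ^ 2 ≤ t * (u ⬝ᵥ u + ∑ j, (y j ⬝ᵥ u) ^ 2) := by
  have hM := covMat_posDef y
  rw [← dotProduct_covMat_mulVec]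
  set M := covMat y with hMd
  set w := Matrix.diagonal g *ᵥ u with hw
  have h1 := quad_le_of_trace_pow_le (weightedInv_posSemidef hM g) ht.le h w
  rw [dotProduct_weightedInv] at h1
  have hs : ∑ a, g a ^ 2 * u a ^ 2 = w ⬝ᵥ w := by
    simp only [hw, dotProduct, Matrix.mulVec_diagonal]
    exact Finset.sum_congr rfl fun i _ => by ring
  rw [hs]
  set v := Matrix.diagonal g *ᵥ w with hv
  have hwv : w ⬝ᵥ w = u ⬝ᵥ v := by
    simp only [hv, hw, dotProduct, Matrix.mulVec_diagonal]
    exact Finset.sum_congr rfl fun i _ => by ring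
  have h0 : 0 ≤ w ⬝ᵥ w := Finset.sum_nonneg fun i _ => mul_self_nonneg _
  -- expand the nonnegative form of `M` at `t u - M⁻¹ v`
  have h2 : 0 ≤ (t • u - M⁻¹ *ᵥ v) ⬝ᵥ (M *ᵥ (t • u - M⁻¹ *ᵥ v)) := by
    simpa using hM.posSemidef.dotProduct_mulVec_nonneg (t • u - M⁻¹ *ᵥ v)
  have h3 : (M⁻¹ *ᵥ v) ⬝ᵥ (M *ᵥ u) = u ⬝ᵥ v := by
    rw [Matrix.dotProduct_mulVec, ← Matrix.mulVec_transpose,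
      show Mᵀ = M from covMat_isHermitian y, mulVec_inv_mulVec hM, dotProduct_comm]
  rw [Matrix.mulVec_sub, Matrix.mulVec_smul, mulVec_inv_mulVec hM, sub_dotProduct, dotProduct_sub,
    dotProduct_sub, smul_dotProduct, smul_dotProduct, dotProduct_smul, dotProduct_smul, h3,
    dotProduct_comm (M⁻¹ *ᵥ v) v, smul_eq_mul, smul_eq_mul, smul_eq_mul, ← hwv] at h2
  have h5 : t * (w ⬝ᵥ w) ≤ t * (t * (u ⬝ᵥ (M *ᵥ u))) := by nlinarith
  exact le_of_mul_le_mul_left h5 ht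

/-- The transfer inequality for bounded samples holds up to a small power of the dimension. -/
lemma measure_not_transfer_le {n : ℕ} (hn : 0 < n) {ξ : α → ι → ℝ} (hξ : Measurable ξ) {g : ι → ℝ}
    (hmom : ∀ a b, ∫ x, ξ x a * ξ x b ∂μ = if a = b then g a ^ 2 else 0) {τ : ℝ} {m : ℕ}
    (hb : ∀ x, ξ x ⬝ᵥ ξ x ≤ τ) (hτ : τ ≤ 1 / 2) (hm : m * τ ≤ 1 / 2) {t : ℝ} (ht : 0 < t) :
    (Measure.pi fun _ : Fin n => μ)
      {X | ¬ ∀ u : ι → ℝ, ∑ a, g a ^ 2 * u a ^ 2 ≤ t * (u ⬝ᵥ u + ∑ j, (ξ (X j) ⬝ᵥ u) ^ 2)}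
      ≤ ENNReal.ofReal (Fintype.card ι * (9 / (n * t)) ^ (m + 2)) := by
  obtain ⟨n, rfl⟩ : ∃ k, n = k + 1 := ⟨n - 1, by omega⟩
  obtain ⟨hI, hle⟩ := integral_trace_pow_le (n := n) hξ hmom hb hτ hm
  set P : Measure (Fin (n + 1) → α) := Measure.pi fun _ => μ with hP
  have h0 : 0 ≤ᵐ[P] fun X : Fin (n + 1) → α =>
      (weightedInv g (covMat fun i => ξ (X i)) ^ (m + 2)).trace := ae_of_all _ fun X =>
    ((weightedInv_posSemidef (covMat_posDef _) g).pow _).trace_nonneg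
  have hmk := mul_meas_ge_le_integral_of_nonneg h0 hI (t ^ (m + 2))
  have hsub : {X : Fin (n + 1) → α | ¬ ∀ u : ι → ℝ,
      ∑ a, g a ^ 2 * u a ^ 2 ≤ t * (u ⬝ᵥ u + ∑ j, (ξ (X j) ⬝ᵥ u) ^ 2)}
      ⊆ {X | t ^ (m + 2) ≤ (weightedInv g (covMat fun i => ξ (X i)) ^ (m + 2)).trace} := by
    intro X hX
    by_contra hcon
    exact hX fun u => weighted_le_of_trace_pow_le (fun i => ξ (X i)) g ht (m := m + 1)
      (not_le.1 hcon).le u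
  refine (measure_mono hsub).trans ?_
  rw [← ofReal_measureReal]
  refine ENNReal.ofReal_le_ofReal ?_
  have hp : 0 < t ^ (m + 2) := by positivity
  rw [← mul_le_mul_iff_right₀ hp]
  refine hmk.trans (hle.trans (le_of_eq ?_))
  push_cast
  rw [div_pow, div_pow, mul_pow]
  field_simp

end TraceMoment

/-! ### Consequences of the power laws -/

section PowerLaws

variable {p : ℕ∞} {eig θ : ℕ → ℝ} {μ : Measure (ℕ → ℝ)} {a r cE CE CT : ℝ}

lemma eig_le_of_decay (hL : IsFeatureLaw p eig μ) (hCE : 0 < CE) (hE : EigenDecay p a cE CE eig)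
    (l : ℕ) : eig l ≤ CE * ((l : ℝ) + 1) ^ (-1 - a) := by
  rcases lt_or_ge (l : ℕ∞) p with h | h
  · exact (hE l h).2
  · rw [hL.zero l h]; positivity

lemma summable_eig (ha : 0 < a) (hL : IsFeatureLaw p eig μ) (hCE : 0 < CE)
    (hE : EigenDecay p a cE CE eig) : Summable eig := by
  refine summable_of_sum_range_le (c := eig 0 + CE * (1 / a)) hL.nonneg fun n => ?_
  rcases n with _ | n
  · simp only [Finset.range_zero, Finset.sum_empty]
    have := hL.nonneg 0
    positivity
  rw [Finset.range_eq_Ico, Finset.sum_eq_sum_Ico_succ_bot (by omega)]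
  refine add_le_add le_rfl ?_
  calc _ ≤ ∑ l ∈ Finset.Ico 1 (n + 1), CE * ((l : ℝ) + 1) ^ (-1 - a) :=
        Finset.sum_le_sum fun l _ => eig_le_of_decay hL hCE hE l
    _ ≤ _ := by
        rw [← Finset.mul_sum]
        have := sum_Ico_rpow_le ha (le_refl 1) (n + 1)
        rw [Nat.cast_one, Real.one_rpow] at this
        exact mul_le_mul_of_nonneg_left this hCE.le

lemma tsum_eig_tail_le (ha : 0 < a) (hL : IsFeatureLaw p eig μ) (hCE : 0 < CE)
    (hE : EigenDecay p a cE CE eig) {k : ℕ} (hk : 1 ≤ k) :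
    ∑' l, eig (k + l) ≤ CE * ((k : ℝ) ^ (-a) / a) := by
  refine Real.tsum_le_of_sum_range_le (fun l => hL.nonneg _) fun N => ?_
  calc ∑ l ∈ Finset.range N, eig (k + l) = ∑ l ∈ Finset.Ico k (k + N), eig l := by
        rw [Finset.sum_Ico_eq_sum_range]; simp
    _ ≤ ∑ l ∈ Finset.Ico k (k + N), CE * ((l : ℝ) + 1) ^ (-1 - a) :=
        Finset.sum_le_sum fun l _ => eig_le_of_decay hL hCE hE l
    _ ≤ _ := by
        rw [← Finset.mul_sum]
        exact mul_le_mul_of_nonneg_left (sum_Ico_rpow_le ha hk _) hCE.le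

/-- The second moment of the target beyond the first `K` coordinates is `O(K^{-2r-a})`. -/
lemma sum_target_tail_le (ha : 0 < a) (hr : 0 < r) (hL : IsFeatureLaw p eig μ) (hCE : 0 < CE)
    (hE : EigenDecay p a cE CE eig) (hθ : TargetDecay p r CT θ) {K : ℕ} (hK : 1 ≤ K) (N : ℕ) :
    ∑ l ∈ Finset.Ico K N, eig l * θ l ^ 2
      ≤ CE * CT ^ 2 / (a + 2 * r) * (K : ℝ) ^ (-(a + 2 * r)) := by
  have har : 0 < a + 2 * r := by positivity
  calc _ ≤ ∑ l ∈ Finset.Ico K N, CE * CT ^ 2 * ((l : ℝ) + 1) ^ (-1 - (a + 2 * r)) := by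
        refine Finset.sum_le_sum fun l _ => ?_
        have hl : (0 : ℝ) < l + 1 := by positivity
        rcases lt_or_ge (l : ℕ∞) p with h | h
        · have h1 := (hE l h).2
          have h2 : θ l ^ 2 ≤ CT ^ 2 * ((l : ℝ) + 1) ^ (-(2 * r)) := by
            have := pow_le_pow_left₀ (abs_nonneg _) (hθ l h) 2
            rw [sq_abs, mul_pow, ← Real.rpow_natCast (_ ^ (-r)), ← Real.rpow_mul hl.le] at this
            rw [show -(2 * r) = -r * (2 : ℕ) by push_cast; ring]
            exact this
          calc eig l * θ l ^ 2 ≤ (CE * ((l : ℝ) + 1) ^ (-1 - a)) *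
                (CT ^ 2 * ((l : ℝ) + 1) ^ (-(2 * r))) :=
                mul_le_mul h1 h2 (sq_nonneg _) (by positivity)
            _ = CE * CT ^ 2 * (((l : ℝ) + 1) ^ (-1 - a) * ((l : ℝ) + 1) ^ (-(2 * r))) := by ring
            _ = _ := by rw [← Real.rpow_add hl]; congr 2; ring
        · rw [hL.zero l h, zero_mul]; positivity
    _ ≤ CE * CT ^ 2 * ((K : ℝ) ^ (-(a + 2 * r)) / (a + 2 * r)) := by
        rw [← Finset.mul_sum]
        exact mul_le_mul_of_nonneg_left (sum_Ico_rpow_le har hK N) (by positivity)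
    _ = _ := by ring

lemma sum_sq_div_eig_le (hcE : 0 < cE) (hE : EigenDecay p a cE CE eig)
    (hθ : TargetDecay p r CT θ) {J : ℕ} (hJ : (J : ℕ∞) ≤ p) :
    ∑ l ∈ Finset.range J, θ l ^ 2 / eig l
      ≤ CT ^ 2 / cE * ∑ l ∈ Finset.range J, ((l : ℝ) + 1) ^ ((2 + a - 2 * r) - 1) := by
  rw [Finset.mul_sum]
  refine Finset.sum_le_sum fun l hl => ?_
  have hl' : (l : ℕ∞) < p := lt_of_lt_of_le (by exact_mod_cast Finset.mem_range.1 hl) hJ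
  have hl0 : (0 : ℝ) < l + 1 := by positivity
  have h1 := (hE l hl').1
  have h2 : θ l ^ 2 ≤ CT ^ 2 * ((l : ℝ) + 1) ^ (-(2 * r)) := by
    have := pow_le_pow_left₀ (abs_nonneg _) (hθ l hl') 2
    rw [sq_abs, mul_pow, ← Real.rpow_natCast (_ ^ (-r)), ← Real.rpow_mul hl0.le] at this
    rw [show -(2 * r) = -r * (2 : ℕ) by push_cast; ring]
    exact this
  have hpos : 0 < cE * ((l : ℝ) + 1) ^ (-1 - a) := by positivity
  calc θ l ^ 2 / eig l ≤ (CT ^ 2 * ((l : ℝ) + 1) ^ (-(2 * r))) / (cE * ((l : ℝ) + 1) ^ (-1 - a)) :=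
        div_le_div₀ (by positivity) h2 hpos h1
    _ = CT ^ 2 / cE * (((l : ℝ) + 1) ^ (-(2 * r)) / ((l : ℝ) + 1) ^ (-1 - a)) := by
        field_simp
    _ = _ := by rw [← Real.rpow_sub hl0]; congr 2; ring

lemma ridge_bounds {b : EReal} (hb : ((1 + a : ℝ) : EReal) ≤ b) {cR CR : ℝ} (hcR : 0 < cR)
    (hCR : 0 < CR) {n : ℕ} (hn : 1 ≤ n) {lam : ℝ} (h : RidgeDecay b cR CR n lam) :
    0 ≤ lam ∧ n * lam ≤ CR * (n : ℝ) ^ (-a) := by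
  have hn0 : (0 : ℝ) < n := by exact_mod_cast hn
  unfold RidgeDecay at h
  split_ifs at h with hbt
  · rw [h]; exact ⟨le_rfl, by rw [mul_zero]; positivity⟩
  · have h1 : 1 + a ≤ b.toReal := by
      have := EReal.toReal_le_toReal hb (EReal.coe_ne_bot _) hbt
      rwa [EReal.toReal_coe] at this
    refine ⟨le_trans (by positivity) h.1, ?_⟩
    calc (n : ℝ) * lam ≤ n * (CR * (n : ℝ) ^ (-(1 + a))) := by
          refine mul_le_mul_of_nonneg_left (h.2.trans ?_) hn0.le
          refine mul_le_mul_of_nonneg_left ?_ hCR.le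
          exact Real.rpow_le_rpow_of_exponent_le (by exact_mod_cast hn) (by linarith)
      _ = CR * ((n : ℝ) ^ (1 : ℝ) * (n : ℝ) ^ (-(1 + a))) := by rw [Real.rpow_one]; ring
      _ = _ := by rw [← Real.rpow_add hn0]; congr 2; ring

end PowerLaws

/-! ### Events for the sample -/

section Events

variable {p : ℕ∞} {eig θ : ℕ → ℝ} {μ : Measure (ℕ → ℝ)} [IsProbabilityMeasure μ] {n : ℕ}

instance : IsProbabilityMeasure (sampleLaw n μ) := by unfold sampleLaw; infer_instance

lemma ae_sample {Q : (ℕ → ℝ) → Prop} (h : ∀ᵐ x ∂μ, Q x) :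
    ∀ᵐ X ∂(sampleLaw n μ), ∀ i, Q (X i) := by
  rw [ae_all_iff]
  intro i
  exact (Measure.quasiMeasurePreserving_eval (fun _ : Fin n => μ) i).ae h

/-- The transfer inequality `‖u‖²_Σ ≤ t (|X u|² + ν ‖u‖²)` on `ℓ²`, for square-summable samples. -/
def Transfer (eig : ℕ → ℝ) (X : Fin n → ℕ → ℝ) (t ν : ℝ) : Prop :=
  ∃ x : Fin n → SeqL2, (X = fun i => (x i : ℕ → ℝ)) ∧
    ∀ u : SeqL2, popNormSq eig u ≤ t * (∑ i, inner ℝ (x i) u ^ 2 + ν * ‖u‖ ^ 2)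

/-- Markov's inequality for the squared norm of the sample values of a function. -/
lemma measure_sum_sq_ge_le {h : (ℕ → ℝ) → ℝ} (hm : AEMeasurable h μ) {E δ : ℝ} (hE : 0 < E)
    (hδ : 0 < δ) (hn : 1 ≤ n) (hh : ∫⁻ x, ENNReal.ofReal (h x ^ 2) ∂μ ≤ ENNReal.ofReal E) :
    sampleLaw n μ {X | n * E / δ ≤ ∑ i, h (X i) ^ 2} ≤ ENNReal.ofReal δ := by
  have hn0 : (0 : ℝ) < n := by exact_mod_cast hn
  have hmp : ∀ i : Fin n, MeasurePreserving (fun X : Fin n → ℕ → ℝ => X i) (sampleLaw n μ) μ :=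
    fun i => measurePreserving_eval (fun _ : Fin n => μ) i
  have hmi : ∀ i : Fin n, AEMeasurable (fun X : Fin n → ℕ → ℝ => ENNReal.ofReal (h (X i) ^ 2))
      (sampleLaw n μ) := fun i => by
    have := hm.comp_quasiMeasurePreserving (hmp i).quasiMeasurePreserving
    exact (this.pow_const 2).ennreal_ofReal
  have h1 : ∫⁻ X, ∑ i : Fin n, ENNReal.ofReal (h (X i) ^ 2) ∂(sampleLaw n μ)
      ≤ ENNReal.ofReal (n * E) := by
    rw [lintegral_finsetSum' _ fun i _ => hmi i]
    calc _ = ∑ _i : Fin n, ∫⁻ x, ENNReal.ofReal (h x ^ 2) ∂μ := by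
          refine Finset.sum_congr rfl fun i _ => ?_
          have := (hm.pow_const 2).ennreal_ofReal
          rw [← (hmp i).map_eq] at this
          nth_rewrite 2 [← (hmp i).map_eq]
          rw [lintegral_map' this (hmp i).measurable.aemeasurable]
      _ ≤ ∑ _i : Fin n, ENNReal.ofReal E := Finset.sum_le_sum fun _ _ => hh
      _ = _ := by
          rw [Finset.sum_const, Finset.card_univ, Fintype.card_fin, nsmul_eq_mul,
            ENNReal.ofReal_mul hn0.le, ENNReal.ofReal_natCast]
  have h2 := mul_meas_ge_le_lintegral₀ (μ := sampleLaw n μ)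
    (Finset.aemeasurable_fun_sum Finset.univ fun i _ => hmi i) (ENNReal.ofReal (n * E / δ))
  have h3 : {X : Fin n → ℕ → ℝ | n * E / δ ≤ ∑ i, h (X i) ^ 2}
      ⊆ {X | ENNReal.ofReal (n * E / δ) ≤ ∑ i, ENNReal.ofReal (h (X i) ^ 2)} := by
    intro X hX
    rw [Set.mem_ofPred_eq, ← ENNReal.ofReal_sum_of_nonneg fun i _ => sq_nonneg _]
    exact ENNReal.ofReal_le_ofReal hX
  refine (measure_mono h3).trans ?_
  have h4 : 0 < n * E / δ := by positivity
  have h5 : ENNReal.ofReal (n * E) = ENNReal.ofReal (n * E / δ) * ENNReal.ofReal δ := by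
    rw [← ENNReal.ofReal_mul h4.le]; congr 1; field_simp
  rw [h5] at h1
  exact (ENNReal.mul_le_mul_iff_right (by simpa using h4) ENNReal.ofReal_ne_top).1 (h2.trans h1)

/-- Passing from a bound on the probability of the complement to a lower bound. -/
lemma le_measureReal_of_compl_le {S B : Set (Fin n → ℕ → ℝ)} {c : ℝ} (hc : 0 ≤ c)
    (hB : sampleLaw n μ B ≤ ENNReal.ofReal c) (h : ∀ᵐ X ∂(sampleLaw n μ), X ∉ B → X ∈ S) :
    1 - c ≤ (sampleLaw n μ).real S := by
  have h1 : sampleLaw n μ Sᶜ ≤ ENNReal.ofReal c := by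
    refine (measure_mono_ae ?_).trans hB
    filter_upwards [h] with X hX hS
    by_contra hcon
    exact hS (hX hcon)
  have h2 : (1 : ℝ≥0∞) ≤ sampleLaw n μ S + sampleLaw n μ Sᶜ := by
    rw [← measure_univ (μ := sampleLaw n μ), ← Set.union_compl_self S]
    exact measure_union_le _ _
  have h3 : (1 : ℝ≥0∞) ≤ sampleLaw n μ S + ENNReal.ofReal c := h2.trans (by gcongr)
  have h4 := ENNReal.toReal_mono (by finiteness) h3
  rw [ENNReal.toReal_add (by finiteness) (by finiteness), ENNReal.toReal_ofReal hc,
    ENNReal.toReal_one] at h4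
  simp only [Measure.real]
  linarith

end Events

/-! ### Generic features -/

section Generic

variable {p : ℕ∞} {eig θ : ℕ → ℝ} {μ : Measure (ℕ → ℝ)} [IsProbabilityMeasure μ] {n : ℕ}
  {a cE CE α β : ℝ}

lemma ae_eq_zero_of_eig_eq_zero (hL : IsFeatureLaw p eig μ) :
    ∀ᵐ x ∂μ, ∀ l, eig l = 0 → x l = 0 := by
  rw [ae_all_iff]
  intro l
  by_cases h : eig l = 0
  · have := hL.lintegral_sq l
    rw [h, ENNReal.ofReal_zero, lintegral_eq_zero_iff (by fun_prop)] at this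
    filter_upwards [this] with x hx _
    simp only [Pi.zero_apply, ENNReal.ofReal_eq_zero] at hx
    exact pow_eq_zero_iff two_ne_zero |>.1 (le_antisymm hx (sq_nonneg _))
  · exact ae_of_all _ fun x h' => absurd h' h

lemma tailNormSq_one {k : ℕ} {x : ℕ → ℝ} (h0 : ∀ l, 0 ≤ eig l) (h : ∀ l, eig l = 0 → x l = 0) :
    tailNormSq eig 1 k x = ∑' l, ENNReal.ofReal (x (k + l) ^ 2) := by
  refine tsum_congr fun l => ?_
  congr 1
  rw [pow_one, whiten, div_pow, Real.sq_sqrt (h0 _)]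
  rcases eq_or_ne (eig (k + l)) 0 with h1 | h1
  · rw [h _ h1]; simp
  · field_simp

lemma tailTrace_one (hL : IsFeatureLaw p eig μ) (hs : Summable eig) (k : ℕ) :
    tailTrace eig 1 k = ENNReal.ofReal (∑' l, eig (k + l)) := by
  have hs' : Summable fun l => eig (k + l) := by
    simpa only [add_comm k] using (summable_nat_add_iff k).2 hs
  rw [ENNReal.ofReal_tsum_of_nonneg (fun l => hL.nonneg _) hs']
  simp [tailTrace]

lemma tsum_tail_pos (hL : IsFeatureLaw p eig μ) (hs : Summable eig) {k : ℕ} (hk : (k : ℕ∞) < p) :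
    0 < ∑' l, eig (k + l) := by
  have hs' : Summable fun l => eig (k + l) := by
    simpa only [add_comm k] using (summable_nat_add_iff k).2 hs
  exact hs'.tsum_pos (fun l => hL.nonneg _) 0 (hL.pos k hk)

lemma generic_head_le (hβ : 0 < β) (hG : GenericFeatures p eig μ α β) {k : ℕ} (hk : (k : ℕ∞) < p) :
    ∀ᵐ x ∂μ, ∑ l ∈ Finset.range k, whiten eig x l ^ 2 ≤ β * k := by
  filter_upwards [ENNReal.ae_le_essSup (μ := μ) (fun x => max (headNormSq eig k x / (k : ℝ≥0∞))
    (max (tailNormSq eig 1 k x / tailTrace eig 1 k)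
      (tailNormSq eig 2 k x / tailTrace eig 2 k)))] with x hx
  rcases Nat.eq_zero_or_pos k with rfl | hk0
  · simp
  have h1 : headNormSq eig k x / (k : ℝ≥0∞) ≤ ENNReal.ofReal β :=
    (le_max_left _ _).trans (hx.trans (hG k hk).2)
  rw [ENNReal.div_le_iff (by exact_mod_cast hk0.ne') (ENNReal.natCast_ne_top k)] at h1
  have h2 : ENNReal.ofReal (∑ l ∈ Finset.range k, whiten eig x l ^ 2) ≤ ENNReal.ofReal (β * k) := by
    rw [ENNReal.ofReal_sum_of_nonneg fun i _ => sq_nonneg _, ENNReal.ofReal_mul hβ.le,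
      ENNReal.ofReal_natCast]
    exact h1
  exact (ENNReal.ofReal_le_ofReal_iff (by positivity)).1 h2

lemma generic_tail_le (hβ : 0 < β) (hL : IsFeatureLaw p eig μ) (hs : Summable eig)
    (hG : GenericFeatures p eig μ α β) (k : ℕ) :
    ∀ᵐ x ∂μ, (Summable fun l => x (k + l) ^ 2) ∧
      ∑' l, x (k + l) ^ 2 ≤ β * ∑' l, eig (k + l) := by
  have htr : 0 ≤ ∑' l, eig (k + l) := tsum_nonneg fun l => hL.nonneg _
  rcases lt_or_ge (k : ℕ∞) p with hk | hk
  · filter_upwards [ENNReal.ae_le_essSup (μ := μ) (fun x => max (headNormSq eig k x / (k : ℝ≥0∞))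
      (max (tailNormSq eig 1 k x / tailTrace eig 1 k)
        (tailNormSq eig 2 k x / tailTrace eig 2 k))), ae_eq_zero_of_eig_eq_zero hL,
        hL.ae_memℓp hs] with x hx hx0 hxm
    have hsx : Summable fun l => x (k + l) ^ 2 := by
      simpa only [add_comm k] using (summable_nat_add_iff k).2 (memℓp_two_iff.1 hxm)
    refine ⟨hsx, ?_⟩
    have h1 : tailNormSq eig 1 k x / tailTrace eig 1 k ≤ ENNReal.ofReal β :=
      (le_max_left _ _).trans ((le_max_right _ _).trans (hx.trans (hG k hk).2))
    rw [tailTrace_one hL hs, ENNReal.div_le_iff (by simpa using tsum_tail_pos hL hs hk)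
      ENNReal.ofReal_ne_top, tailNormSq_one hL.nonneg hx0, ← ENNReal.ofReal_mul hβ.le,
      ← ENNReal.ofReal_tsum_of_nonneg (fun l => sq_nonneg _) hsx] at h1
    exact (ENNReal.ofReal_le_ofReal_iff (by positivity)).1 h1
  · filter_upwards [ae_eq_zero_of_eig_eq_zero hL] with x hx
    have h0 : ∀ l, x (k + l) = 0 := fun l => hx _ (hL.zero _ (hk.trans (by simp)))
    simp only [h0]
    refine ⟨by simp, ?_⟩
    simp only [ne_eq, OfNat.ofNat_ne_zero, not_false_eq_true, zero_pow, tsum_zero]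
    positivity

lemma generic_tail_ge (hα : 0 < α) (hL : IsFeatureLaw p eig μ) (hs : Summable eig)
    (hG : GenericFeatures p eig μ α β) {k : ℕ} (hk : (k : ℕ∞) < p) :
    ∀ᵐ x ∂μ, α * ∑' l, eig (k + l) ≤ ∑' l, x (k + l) ^ 2 := by
  filter_upwards [ae_essInf_le (μ := μ) (f := fun x => tailNormSq eig 1 k x / tailTrace eig 1 k),
    ae_eq_zero_of_eig_eq_zero hL, hL.ae_memℓp hs] with x hx hx0 hxm
  have hsx : Summable fun l => x (k + l) ^ 2 := by
    simpa only [add_comm k] using (summable_nat_add_iff k).2 (memℓp_two_iff.1 hxm)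
  have hpos := tsum_tail_pos hL hs hk
  have h1 : ENNReal.ofReal α ≤ tailNormSq eig 1 k x / tailTrace eig 1 k := (hG k hk).1.trans hx
  rw [tailTrace_one hL hs, ENNReal.le_div_iff_mul_le (Or.inl (by simpa using hpos))
    (Or.inl ENNReal.ofReal_ne_top), tailNormSq_one hL.nonneg hx0, ← ENNReal.ofReal_mul hα.le,
    ← ENNReal.ofReal_tsum_of_nonneg (fun l => sq_nonneg _) hsx] at h1
  exact (ENNReal.ofReal_le_ofReal_iff (tsum_nonneg fun l => sq_nonneg _)).1 h1

/-- The restricted samples, whitened by `ν + s Σ`. -/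
def scaledSample (eig : ℕ → ℝ) (N : ℕ) (s ν : ℝ) (x : ℕ → ℝ) (i : Fin N) : ℝ :=
  x i / √(ν + s * eig i)

lemma scaledSample_sq_le (hL : IsFeatureLaw p eig μ) {k N : ℕ} (hk : (k : ℕ∞) < p) (hkN : k ≤ N)
    {s ν b c : ℝ} (hs : 0 < s) (hν : 0 < ν) {x : ℕ → ℝ}
    (h1 : ∑ l ∈ Finset.range k, whiten eig x l ^ 2 ≤ b) (hx : Summable fun l => x (k + l) ^ 2)
    (h2 : ∑' l, x (k + l) ^ 2 ≤ c) :
    scaledSample eig N s ν x ⬝ᵥ scaledSample eig N s ν x ≤ b / s + c / ν := by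
  have hw : ∀ l, 0 < ν + s * eig l := fun l => by have := hL.nonneg l; positivity
  have e : scaledSample eig N s ν x ⬝ᵥ scaledSample eig N s ν x
      = ∑ l ∈ Finset.range N, x l ^ 2 / (ν + s * eig l) := by
    rw [← Fin.sum_univ_eq_sum_range (fun l => x l ^ 2 / (ν + s * eig l))]
    refine Finset.sum_congr rfl fun i _ => ?_
    rw [scaledSample, ← sq, div_pow, Real.sq_sqrt (hw _).le]
  rw [e, ← Finset.sum_range_add_sum_Ico _ hkN]
  refine add_le_add ?_ ?_
  · refine le_trans ?_ (div_le_div_of_nonneg_right h1 hs.le)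
    rw [Finset.sum_div]
    refine Finset.sum_le_sum fun l hl => ?_
    have hl' : 0 < eig l := hL.pos l (lt_trans (by exact_mod_cast Finset.mem_range.1 hl) hk)
    rw [whiten, div_pow, Real.sq_sqrt hl'.le, div_div]
    exact div_le_div_of_nonneg_left (sq_nonneg _) (by positivity) (by linarith)
  · refine le_trans ?_ (div_le_div_of_nonneg_right h2 hν.le)
    rw [Finset.sum_Ico_eq_sum_range]
    refine le_trans ?_ (div_le_div_of_nonneg_right
      (hx.sum_le_tsum (Finset.range (N - k)) fun l _ => sq_nonneg _) hν.le)
    rw [Finset.sum_div]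
    refine Finset.sum_le_sum fun l _ => ?_
    have := hL.nonneg (k + l)
    refine div_le_div_of_nonneg_left (sq_nonneg _) hν ?_
    have : 0 ≤ s * eig (k + l) := by positivity
    linarith

/-- From the transfer inequality on the first `N` coordinates, with a ridge `ν + s Σ`, to the
transfer inequality on `ℓ²`: the part `s Σ` is absorbed, and the coordinates beyond `N` are
negligible. -/
lemma transfer_of_finite (hL : IsFeatureLaw p eig μ) {N : ℕ} {s ν t c : ℝ} (hs : 0 < s)
    (hν : 0 < ν) (ht : 0 < t) (hts : t * s ≤ 1 / 2) (hN : eig N ≤ t * ν) (hc : n * c ≤ ν)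
    (x : Fin n → SeqL2) (hx : ∀ i, ∑' l, x i (N + l) ^ 2 ≤ c)
    (h : ∀ u : Fin N → ℝ, ∑ l : Fin N, √(eig l / (ν + s * eig l)) ^ 2 * u l ^ 2
      ≤ t * (u ⬝ᵥ u + ∑ j, (scaledSample eig N s ν (x j) ⬝ᵥ u) ^ 2)) (u : SeqL2) :
    popNormSq eig u ≤ 8 * t * (∑ i, inner ℝ (x i) u ^ 2 + ν * ‖u‖ ^ 2) := by
  have hw : ∀ l, 0 < ν + s * eig l := fun l => by have := hL.nonneg l; positivity
  have hu2 := seqL2_summable_sq u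
  have h1 := h fun l => √(ν + s * eig l) * u l
  have e1 : ∑ l : Fin N, √(eig l / (ν + s * eig l)) ^ 2 * (√(ν + s * eig l) * u l) ^ 2
      = ∑ l ∈ Finset.range N, eig l * u l ^ 2 := by
    rw [← Fin.sum_univ_eq_sum_range (fun l => eig l * u l ^ 2)]
    refine Finset.sum_congr rfl fun l _ => ?_
    have := (hw l).ne'
    rw [Real.sq_sqrt (div_nonneg (hL.nonneg _) (hw l).le), mul_pow, Real.sq_sqrt (hw l).le,
      ← mul_assoc, div_mul_cancel₀ _ this]
  have e2 : (fun l : Fin N => √(ν + s * eig l) * u l) ⬝ᵥ (fun l : Fin N => √(ν + s * eig l) * u l)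
      = ν * ∑ l ∈ Finset.range N, u l ^ 2 + s * ∑ l ∈ Finset.range N, eig l * u l ^ 2 := by
    rw [Finset.mul_sum, Finset.mul_sum, ← Finset.sum_add_distrib,
      ← Fin.sum_univ_eq_sum_range (fun l => ν * u l ^ 2 + s * (eig l * u l ^ 2))]
    refine Finset.sum_congr rfl fun l _ => ?_
    rw [← sq, mul_pow, Real.sq_sqrt (hw l).le]; ring
  have e3 : ∀ j, scaledSample eig N s ν (x j) ⬝ᵥ (fun l : Fin N => √(ν + s * eig l) * u l)
      = ∑ l ∈ Finset.range N, x j l * u l := by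
    intro j
    rw [← Fin.sum_univ_eq_sum_range (fun l => x j l * u l)]
    refine Finset.sum_congr rfl fun l _ => ?_
    have := (Real.sqrt_pos.2 (hw l)).ne'
    rw [scaledSample]; field_simp
  rw [e1, e2] at h1
  simp only [e3] at h1
  have hsplit : ∀ j, inner ℝ (x j) u = ∑ l ∈ Finset.range N, x j l * u l
      + ∑' l, x j (N + l) * u (N + l) := by
    intro j
    rw [seqL2_inner, ← (seqL2_summable_mul (x j) u).sum_add_tsum_nat_add N]
    simp only [add_comm]
  have hsu : Summable fun l => u (N + l) ^ 2 := by
    simpa only [add_comm N] using (summable_nat_add_iff N).2 hu2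
  have htailu : ∑' l, u (N + l) ^ 2 ≤ ‖u‖ ^ 2 := by
    rw [seqL2_norm_sq, ← hu2.sum_add_tsum_nat_add N]
    have h0 : 0 ≤ ∑ l ∈ Finset.range N, u l ^ 2 := Finset.sum_nonneg fun _ _ => sq_nonneg _
    simp only [add_comm N]
    linarith
  have hheadu : ∑ l ∈ Finset.range N, u l ^ 2 ≤ ‖u‖ ^ 2 := by
    rw [seqL2_norm_sq]
    exact hu2.sum_le_tsum _ fun _ _ => sq_nonneg _
  have hsx : ∀ j, Summable fun l => x j (N + l) ^ 2 := fun j => by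
    simpa only [add_comm N] using (summable_nat_add_iff N).2 (seqL2_summable_sq (x j))
  have htail : ∀ j, (∑' l, x j (N + l) * u (N + l)) ^ 2 ≤ c * ‖u‖ ^ 2 := by
    intro j
    have hm : Summable fun l => x j (N + l) * u (N + l) := by
      simpa only [add_comm N] using (summable_nat_add_iff N).2 (seqL2_summable_mul (x j) u)
    have hlim := (hm.hasSum.tendsto_sum_nat).pow 2
    refine le_of_tendsto hlim (Eventually.of_forall fun m => ?_)
    calc (∑ l ∈ Finset.range m, x j (N + l) * u (N + l)) ^ 2
        ≤ (∑ l ∈ Finset.range m, x j (N + l) ^ 2) * ∑ l ∈ Finset.range m, u (N + l) ^ 2 :=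
          Finset.sum_mul_sq_le_sq_mul_sq _ _ _
      _ ≤ c * ‖u‖ ^ 2 := by
          refine mul_le_mul (((hsx j).sum_le_tsum _ fun _ _ => sq_nonneg _).trans (hx j))
            ((hsu.sum_le_tsum _ fun _ _ => sq_nonneg _).trans htailu)
            (Finset.sum_nonneg fun _ _ => sq_nonneg _) ?_
          exact (tsum_nonneg fun _ => sq_nonneg _).trans (hx j)
  have hfin : ∑ j, (∑ l ∈ Finset.range N, x j l * u l) ^ 2
      ≤ 2 * ∑ j, inner ℝ (x j) u ^ 2 + 2 * (ν * ‖u‖ ^ 2) := by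
    calc _ ≤ ∑ j : Fin n, (2 * inner ℝ (x j) u ^ 2 + 2 * (c * ‖u‖ ^ 2)) := by
          refine Finset.sum_le_sum fun j _ => ?_
          have h2 := htail j
          have h3 : ∑ l ∈ Finset.range N, x j l * u l
              = inner ℝ (x j) u - ∑' l, x j (N + l) * u (N + l) := by rw [hsplit j]; ring
          rw [h3]
          nlinarith [sq_nonneg (inner ℝ (x j) u + ∑' l, x j (N + l) * u (N + l))]
      _ = 2 * ∑ j, inner ℝ (x j) u ^ 2 + 2 * ((n * c) * ‖u‖ ^ 2) := by
          rw [Finset.sum_add_distrib, ← Finset.mul_sum]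
          simp; ring
      _ ≤ _ := by
          have := mul_le_mul_of_nonneg_right hc (sq_nonneg ‖u‖)
          linarith
  have hpop : popNormSq eig u ≤ ∑ l ∈ Finset.range N, eig l * u l ^ 2 + t * ν * ‖u‖ ^ 2 := by
    rw [popNormSq, ← (hL.summable_popNorm u).sum_add_tsum_nat_add N]
    refine add_le_add le_rfl ?_
    calc ∑' l, eig (l + N) * u (l + N) ^ 2 ≤ ∑' l, t * ν * u (l + N) ^ 2 := by
          refine Summable.tsum_le_tsum (fun l => ?_)
            ((summable_nat_add_iff N).2 (hL.summable_popNorm u))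
            (((summable_nat_add_iff N).2 hu2).mul_left _)
          exact mul_le_mul_of_nonneg_right ((hL.antitone (by omega)).trans hN) (sq_nonneg _)
      _ = t * ν * ∑' l, u (N + l) ^ 2 := by rw [tsum_mul_left]; simp only [add_comm N]
      _ ≤ _ := mul_le_mul_of_nonneg_left htailu (by positivity)
  set A := ∑ l ∈ Finset.range N, eig l * u l ^ 2 with hA
  have hA0 : 0 ≤ A := Finset.sum_nonneg fun l _ => mul_nonneg (hL.nonneg l) (sq_nonneg _)
  set S := ∑ j, inner ℝ (x j) u ^ 2 with hS
  have hS0 : 0 ≤ S := Finset.sum_nonneg fun _ _ => sq_nonneg _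
  have hνu : 0 ≤ ν * ‖u‖ ^ 2 := by positivity
  have h5 : A ≤ t * (ν * ‖u‖ ^ 2 + (2 * S + 2 * (ν * ‖u‖ ^ 2))) + 1 / 2 * A := by
    refine h1.trans ?_
    have h6 := mul_le_mul_of_nonneg_left hheadu hν.le
    have h7 : t * (ν * ∑ l ∈ Finset.range N, u l ^ 2 + s * A
        + ∑ j, (∑ l ∈ Finset.range N, x j l * u l) ^ 2)
        ≤ t * (ν * ‖u‖ ^ 2 + s * A + (2 * S + 2 * (ν * ‖u‖ ^ 2))) :=
      mul_le_mul_of_nonneg_left (by linarith) ht.le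
    have h8 := mul_le_mul_of_nonneg_right hts hA0
    nlinarith
  have h9 : 0 ≤ t * S := by positivity
  have h10 : 0 ≤ t * (ν * ‖u‖ ^ 2) := by positivity
  nlinarith

/-- The transfer inequality for generic features, at explicit parameters. -/
lemma generic_transfer (ha : 0 < a) (hCE : 0 < CE) (hβ : 0 < β) (hL : IsFeatureLaw p eig μ)
    (hE : EigenDecay p a cE CE eig) (hG : GenericFeatures p eig μ α β) (hn : 0 < n)
    {k N m : ℕ} (hk0 : 1 ≤ k) (hk : (k : ℕ∞) < p) (hkN : k ≤ N) {s ν t τ : ℝ} (hs : 0 < s)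
    (hν : 0 < ν) (ht : 0 < t) (hτd : β * k / s + β * (CE * ((k : ℝ) ^ (-a) / a)) / ν ≤ τ)
    (hτ : τ ≤ 1 / 2) (hm : m * τ ≤ 1 / 2) (hts : t * s ≤ 1 / 2)
    (hN : CE * ((N : ℝ) + 1) ^ (-1 - a) ≤ t * ν)
    (hc : n * (β * (CE * ((N : ℝ) ^ (-a) / a))) ≤ ν) :
    sampleLaw n μ {X | ¬ Transfer eig X (8 * t) ν}
      ≤ ENNReal.ofReal (N * (9 / (n * t)) ^ (m + 2)) := by
  have hsum := summable_eig ha hL hCE hE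
  have hw : ∀ l, 0 < ν + s * eig l := fun l => by have := hL.nonneg l; positivity
  -- the scaled sample is redefined on a null set so as to be bounded everywhere
  set ξ : (ℕ → ℝ) → Fin N → ℝ := fun x =>
    if scaledSample eig N s ν x ⬝ᵥ scaledSample eig N s ν x ≤ τ then scaledSample eig N s ν x
    else 0 with hξ
  have hsm : Measurable (scaledSample eig N s ν) := by
    unfold scaledSample; fun_prop
  have hsm2 : Measurable fun x => scaledSample eig N s ν x ⬝ᵥ scaledSample eig N s ν x := by
    simp only [dotProduct]
    unfold scaledSample; fun_prop
  have hξm : Measurable ξ := Measurable.ite (measurableSet_le hsm2 measurable_const) hsm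
    measurable_const
  have hτ0 : 0 ≤ τ := le_trans (by positivity) hτd
  have hb : ∀ x, ξ x ⬝ᵥ ξ x ≤ τ := by
    intro x
    simp only [hξ]
    split_ifs with h
    · exact h
    · simpa using hτ0
  have hae : ∀ᵐ x ∂μ, ξ x = scaledSample eig N s ν x := by
    filter_upwards [generic_head_le hβ hG hk, generic_tail_le hβ hL hsum hG k] with x h1 h2
    have h3 := scaledSample_sq_le hL hk hkN hs hν h1 h2.1
      (h2.2.trans (mul_le_mul_of_nonneg_left (tsum_eig_tail_le ha hL hCE hE hk0) hβ.le))
    simp only [hξ]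
    rw [if_pos (h3.trans hτd)]
  have hmom : ∀ i j : Fin N, ∫ x, ξ x i * ξ x j ∂μ
      = if i = j then √(eig i / (ν + s * eig i)) ^ 2 else 0 := by
    intro i j
    have e : ∫ x, ξ x i * ξ x j ∂μ
        = ∫ x, (√(ν + s * eig i) * √(ν + s * eig j))⁻¹ * (x i * x j) ∂μ := by
      refine integral_congr_ae ?_
      filter_upwards [hae] with x hx
      rw [hx, scaledSample, scaledSample]
      field_simp
    rw [e, integral_const_mul, hL.secondMoment]
    by_cases hij : i = j
    · subst hij
      rw [if_pos rfl, if_pos rfl, Real.mul_self_sqrt (hw _).le,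
        Real.sq_sqrt (div_nonneg (hL.nonneg _) (hw _).le)]
      field_simp
    · rw [if_neg hij, if_neg (fun h => hij (Fin.ext h)), mul_zero]
  have hmain := measure_not_transfer_le (n := n) hn hξm hmom hb hτ hm ht
  rw [Fintype.card_fin] at hmain
  refine le_trans (measure_mono_ae ?_) hmain
  filter_upwards [ae_sample (n := n) hae, ae_sample (n := n) (hL.ae_memℓp hsum),
    ae_sample (n := n) (generic_tail_le hβ hL hsum hG N)] with X hX1 hX2 hX3 hbad hgood
  refine hbad ⟨fun i => ⟨X i, hX2 i⟩, rfl, ?_⟩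
  refine transfer_of_finite (c := β * (CE * ((N : ℝ) ^ (-a) / a))) hL hs hν ht hts
    ((eig_le_of_decay hL hCE hE N).trans hN) hc _ (fun i => ?_) ?_
  · exact (hX3 i).2.trans (mul_le_mul_of_nonneg_left
      (tsum_eig_tail_le ha hL hCE hE (hk0.trans hkN)) hβ.le)
  · simpa only [hX1] using hgood

/-- The smallest eigenvalue of the kernel matrix for generic features: on the coordinates in
`[K, N)` the diagonal of the Gram matrix is bounded below almost surely, and the off-diagonal part
is small in Frobenius norm by Chebyshev's inequality. -/
lemma generic_minEig (hα : 0 < α) (hβ : 0 < β) (hL : IsFeatureLaw p eig μ) (hsum : Summable eig)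
    (hG : GenericFeatures p eig μ α β) {K N : ℕ} (hKN : K ≤ N) (hK : (K : ℕ∞) < p)
    (hN : β * ∑' l, eig (N + l) ≤ α / 2 * ∑' l, eig (K + l)) :
    sampleLaw n μ {X | ¬ ∀ c : Fin n → ℝ, α / 4 * (∑' l, eig (K + l)) * ∑ i, c i ^ 2
        ≤ ∑ l ∈ Finset.Ico K N, (∑ i, c i * X i l) ^ 2}
      ≤ ENNReal.ofReal (n ^ 2 * (∑ l ∈ Finset.Ico K N, eig l ^ 2)
          / (α / 4 * ∑' l, eig (K + l)) ^ 2) := by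
  set tr := ∑' l, eig (K + l) with htr
  have htr0 : 0 < tr := tsum_tail_pos hL hsum hK
  set B : (Fin n → ℕ → ℝ) → Fin n → Fin n → ℝ := fun X i j =>
    ∑ l ∈ Finset.Ico K N, X i l * X j l with hB
  set S : (Fin n → ℕ → ℝ) → ℝ := fun X => ∑ i, ∑ j, if i = j then 0 else B X i j ^ 2 with hS
  have hS0 : ∀ X, 0 ≤ S X := fun X => Finset.sum_nonneg fun i _ => Finset.sum_nonneg fun j _ => by
    split_ifs <;> positivity
  have hmp : ∀ i : Fin n, MeasurePreserving (fun X : Fin n → ℕ → ℝ => X i) (sampleLaw n μ) μ :=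
    fun i => measurePreserving_eval (fun _ : Fin n => μ) i
  have hind : iIndepFun (fun (i : Fin n) (X : Fin n → ℕ → ℝ) => X i) (sampleLaw n μ) :=
    iIndepFun_pi (X := fun (_ : Fin n) (x : ℕ → ℝ) => x) fun _ => aemeasurable_id
  have hprod : ∀ i j : Fin n, i ≠ j → ∀ l l' : ℕ,
      Integrable (fun X : Fin n → ℕ → ℝ => (X i l * X i l') * (X j l * X j l')) (sampleLaw n μ) ∧
      ∫ X : Fin n → ℕ → ℝ, (X i l * X i l') * (X j l * X j l') ∂(sampleLaw n μ)
        = if l = l' then eig l ^ 2 else 0 := by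
    intro i j hij l l'
    have hI : ∀ i : Fin n, Integrable (fun X : Fin n → ℕ → ℝ => X i l * X i l') (sampleLaw n μ) :=
      fun i => (hmp i).integrable_comp_of_integrable (hL.integrable l l')
    have hval : ∀ i : Fin n, ∫ X : Fin n → ℕ → ℝ, X i l * X i l' ∂(sampleLaw n μ)
        = if l = l' then eig l else 0 := by
      intro i
      have h1 := integral_map (μ := sampleLaw n μ) (hmp i).measurable.aemeasurable
        (f := fun x : ℕ → ℝ => x l * x l') (by fun_prop)
      rw [(hmp i).map_eq, hL.secondMoment] at h1
      exact h1.symm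
    have hindep : IndepFun (fun X : Fin n → ℕ → ℝ => X i l * X i l')
        (fun X : Fin n → ℕ → ℝ => X j l * X j l') (sampleLaw n μ) :=
      (hind.indepFun hij).comp (φ := fun x : ℕ → ℝ => x l * x l')
        (ψ := fun x : ℕ → ℝ => x l * x l') (by fun_prop) (by fun_prop)
    refine ⟨hindep.integrable_mul (hI i) (hI j), ?_⟩
    rw [hindep.integral_fun_mul_eq_mul_integral (hI i).aestronglyMeasurable (hI j).aestronglyMeasurable, hval, hval]
    split_ifs <;> ring
  have hBsq : ∀ X i j, B X i j ^ 2 = ∑ l ∈ Finset.Ico K N, ∑ l' ∈ Finset.Ico K N,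
      (X i l * X i l') * (X j l * X j l') := by
    intro X i j
    simp only [hB]
    rw [sq, Finset.sum_mul_sum]
    exact Finset.sum_congr rfl fun _ _ => Finset.sum_congr rfl fun _ _ => by ring
  have hBint : ∀ i j : Fin n, i ≠ j → Integrable (fun X => B X i j ^ 2) (sampleLaw n μ) ∧
      ∫ X, B X i j ^ 2 ∂(sampleLaw n μ) = ∑ l ∈ Finset.Ico K N, eig l ^ 2 := by
    intro i j hij
    simp only [hBsq]
    refine ⟨integrable_finsetSum _ fun l _ => integrable_finsetSum _ fun l' _ =>
      (hprod i j hij l l').1, ?_⟩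
    rw [integral_finsetSum _ fun l _ => integrable_finsetSum _ fun l' _ => (hprod i j hij l l').1]
    refine Finset.sum_congr rfl fun l hl => ?_
    rw [integral_finsetSum _ fun l' _ => (hprod i j hij l l').1]
    simp only [(hprod i j hij _ _).2]
    rw [Finset.sum_ite_eq, if_pos hl]
  have hSint : Integrable S (sampleLaw n μ) := by
    refine integrable_finsetSum _ fun i _ => integrable_finsetSum _ fun j _ => ?_
    by_cases hij : i = j
    · simp [hij]
    · simpa only [if_neg hij] using (hBint i j hij).1
  have hSval : ∫ X, S X ∂(sampleLaw n μ) ≤ n ^ 2 * ∑ l ∈ Finset.Ico K N, eig l ^ 2 := by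
    have hsq : 0 ≤ ∑ l ∈ Finset.Ico K N, eig l ^ 2 := Finset.sum_nonneg fun _ _ => sq_nonneg _
    have hint : ∀ i j : Fin n,
        Integrable (fun X => if i = j then 0 else B X i j ^ 2) (sampleLaw n μ) := by
      intro i j
      by_cases hij : i = j
      · simp [hij]
      · simpa only [if_neg hij] using (hBint i j hij).1
    simp only [hS]
    rw [integral_finsetSum _ fun i _ => integrable_finsetSum _ fun j _ => hint i j]
    calc _ ≤ ∑ _i : Fin n, ∑ _j : Fin n, ∑ l ∈ Finset.Ico K N, eig l ^ 2 := by
          refine Finset.sum_le_sum fun i _ => ?_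
          rw [integral_finsetSum _ fun j _ => hint i j]
          refine Finset.sum_le_sum fun j _ => ?_
          by_cases hij : i = j
          · simpa [hij] using hsq
          · simp only [if_neg hij]; exact (hBint i j hij).2.le
      _ = _ := by simp; ring
  have hmk := mul_meas_ge_le_integral_of_nonneg (ae_of_all _ hS0) hSint ((α / 4 * tr) ^ 2)
  have hpos : 0 < (α / 4 * tr) ^ 2 := by positivity
  have hmk2 : sampleLaw n μ {X | (α / 4 * tr) ^ 2 ≤ S X}
      ≤ ENNReal.ofReal (n ^ 2 * (∑ l ∈ Finset.Ico K N, eig l ^ 2) / (α / 4 * tr) ^ 2) := by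
    rw [← ofReal_measureReal]
    refine ENNReal.ofReal_le_ofReal ?_
    rw [le_div_iff₀ hpos, mul_comm]
    exact hmk.trans hSval
  refine le_trans (measure_mono_ae ?_) hmk2
  filter_upwards [ae_sample (n := n) (generic_tail_le hβ hL hsum hG N),
    ae_sample (n := n) (generic_tail_ge hα hL hsum hG hK),
    ae_sample (n := n) (hL.ae_memℓp hsum)] with X h1 h2 h3 hbad
  by_contra hcon
  have hSlt : S X < (α / 4 * tr) ^ 2 := not_le.1 hcon
  refine hbad fun c => ?_
  -- the coordinates beyond `N` take away at most half of the diagonal entry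
  have hdiag : ∀ i, α / 2 * tr ≤ B X i i := by
    intro i
    have hsx : Summable fun l => X i (K + l) ^ 2 := by
      simpa only [add_comm K] using (summable_nat_add_iff K).2 (memℓp_two_iff.1 (h3 i))
    have hsplit := hsx.sum_add_tsum_nat_add (N - K)
    have e1 : ∑ l ∈ Finset.range (N - K), X i (K + l) ^ 2 = B X i i := by
      simp only [hB]
      rw [Finset.sum_Ico_eq_sum_range]
      exact Finset.sum_congr rfl fun _ _ => sq _
    have e2 : ∑' l, X i (K + (l + (N - K))) ^ 2 = ∑' l, X i (N + l) ^ 2 := by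
      refine tsum_congr fun l => ?_
      congr 2; omega
    rw [e1, e2] at hsplit
    have := (h1 i).2
    have := h2 i
    linarith
  have hexp : ∑ l ∈ Finset.Ico K N, (∑ i, c i * X i l) ^ 2 = ∑ i, ∑ j, c i * c j * B X i j := by
    calc _ = ∑ l ∈ Finset.Ico K N, ∑ i, ∑ j, c i * X i l * (c j * X j l) :=
          Finset.sum_congr rfl fun l _ => by rw [sq, Finset.sum_mul_sum]
      _ = _ := by
          rw [Finset.sum_comm]
          refine Finset.sum_congr rfl fun i _ => ?_
          rw [Finset.sum_comm]
          refine Finset.sum_congr rfl fun j _ => ?_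
          simp only [hB]
          rw [Finset.mul_sum]
          exact Finset.sum_congr rfl fun l _ => by ring
  rw [hexp]
  set q := ∑ i, c i ^ 2 with hq
  have hq0 : 0 ≤ q := Finset.sum_nonneg fun _ _ => sq_nonneg _
  have hoff : |∑ i, ∑ j, c i * c j * (if i = j then 0 else B X i j)| ≤ q * (α / 4 * tr) := by
    refine abs_le_of_sq_le_sq ?_ (by positivity)
    have hcs : (∑ i, ∑ j, c i * c j * (if i = j then 0 else B X i j)) ^ 2
        ≤ (∑ i, ∑ j, (c i * c j) ^ 2) * ∑ i, ∑ j, (if i = j then 0 else B X i j) ^ 2 := by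
      simp only [← Finset.sum_product']
      exact Finset.sum_mul_sq_le_sq_mul_sq _ _ _
    have e1 : ∑ i, ∑ j, (c i * c j) ^ 2 = q ^ 2 := by
      rw [sq q, hq, Finset.sum_mul_sum]
      exact Finset.sum_congr rfl fun _ _ => Finset.sum_congr rfl fun _ _ => by ring
    have e2 : ∑ i, ∑ j, (if i = j then 0 else B X i j) ^ 2 = S X := by
      simp only [hS]
      refine Finset.sum_congr rfl fun _ _ => Finset.sum_congr rfl fun _ _ => ?_
      split_ifs <;> simp
    rw [e1, e2] at hcs
    rw [mul_pow]
    exact hcs.trans (mul_le_mul_of_nonneg_left hSlt.le (sq_nonneg _))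
  -- the diagonal and the off-diagonal part
  have hsum2 : ∑ i, ∑ j, c i * c j * B X i j
      = ∑ i, c i ^ 2 * B X i i + ∑ i, ∑ j, c i * c j * (if i = j then 0 else B X i j) := by
    rw [← Finset.sum_add_distrib]
    refine Finset.sum_congr rfl fun i _ => ?_
    have : c i ^ 2 * B X i i = ∑ j, if i = j then c i * c j * B X i j else 0 := by
      rw [Finset.sum_ite_eq, if_pos (Finset.mem_univ _), sq]
    rw [this, ← Finset.sum_add_distrib]
    refine Finset.sum_congr rfl fun j _ => ?_
    split_ifs <;> simp
  have hd : α / 2 * tr * q ≤ ∑ i, c i ^ 2 * B X i i := by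
    rw [hq, Finset.mul_sum]
    refine Finset.sum_le_sum fun i _ => ?_
    rw [mul_comm]
    exact mul_le_mul_of_nonneg_left (hdiag i) (sq_nonneg _)
  rw [hsum2]
  have := (abs_le.1 hoff).1
  nlinarith

end Generic

/-! ### The bias for generic features -/

/-- A lower bound on the quadratic form of the kernel matrix from finitely many coordinates. -/
lemma le_gramRidge_of_sum_sq {n : ℕ} (x : Fin n → SeqL2) {ρ ν₀ : ℝ} (hρ : 0 ≤ ρ) (F : Finset ℕ)
    (h : ∀ c : Fin n → ℝ, ν₀ * ∑ i, c i ^ 2 ≤ ∑ l ∈ F, (∑ i, c i * x i l) ^ 2) (c : Fin n → ℝ) :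
    ν₀ * ∑ i, c i ^ 2 ≤ ∑ i, c i * (gramRidge x ρ *ᵥ c) i := by
  rw [← norm_comb_sq, seqL2_norm_sq]
  have h1 := (seqL2_summable_sq (comb x c)).sum_le_tsum F fun _ _ => sq_nonneg _
  have h2 : ∑ l ∈ F, (comb x c l) ^ 2 = ∑ l ∈ F, (∑ i, c i * x i l) ^ 2 := by
    refine Finset.sum_congr rfl fun l _ => ?_
    rw [comb_apply]
    simp only [mul_comm]
  have h3 : 0 ≤ ρ * ∑ i, c i ^ 2 := mul_nonneg hρ (Finset.sum_nonneg fun _ _ => sq_nonneg _)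
  have := h c
  linarith

lemma isUnit_gramRidge_det {n : ℕ} (x : Fin n → SeqL2) {ρ ν₀ : ℝ} (hν₀ : 0 < ν₀)
    (h : ∀ c : Fin n → ℝ, ν₀ * ∑ i, c i ^ 2 ≤ ∑ i, c i * (gramRidge x ρ *ᵥ c) i) :
    IsUnit (gramRidge x ρ).det := by
  refine isUnit_det_of_pos fun c hc => lt_of_lt_of_le ?_ (h c)
  obtain ⟨i, hi⟩ := Function.ne_iff.1 hc
  have : 0 < ∑ i, c i ^ 2 :=
    Finset.sum_pos' (fun _ _ => sq_nonneg _) ⟨i, Finset.mem_univ _, by simpa using sq_pos_of_ne_zero hi⟩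
  positivity

section GenericAsymptotics

variable {a cE CE α β κ : ℝ}

lemma half_le_floor {x : ℝ} (hx : 1 ≤ x) : x / 2 ≤ (⌊x⌋₊ : ℝ) := by
  have h1 := Nat.lt_floor_add_one x
  have h2 : (1 : ℝ) ≤ ⌊x⌋₊ := by exact_mod_cast Nat.le_floor (by simpa using hx)
  linarith

/-- With `k ≈ n^{1-ε}` and `s ≈ n^{1-ε/2}`, the transfer inequality for generic features holds with
`t ≈ n^{-1+ε/4}` and `ν ≈ n^{-a+ε(1+a)}`, outside an event of probability `O(1/n)`. -/
lemma exists_generic_transfer (ha : 0 < a) (hCE : 0 < CE) (hβ : 0 < β) {ε : ℝ} (hε : 0 < ε)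
    (hε1 : ε < 1) :
    ∃ C : ℝ, 0 < C ∧ ∃ n₀ : ℕ, ∀ n ≥ n₀, ∀ (p : ℕ∞) (eig : ℕ → ℝ) (μ : Measure (ℕ → ℝ)),
      IsProbabilityMeasure μ → IsFeatureLaw p eig μ → EigenDecay p a cE CE eig →
      GenericFeatures p eig μ α β → (n : ℕ∞) < p →
      sampleLaw n μ {X | ¬ Transfer eig X (8 * (n : ℝ) ^ (-1 + ε / 4))
          ((n : ℝ) ^ (-a + ε * (1 + a)))} ≤ ENNReal.ofReal (C / n) := by
  obtain ⟨d, hd⟩ := exists_nat_ge ((1 + a) / a)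
  obtain ⟨m, hm⟩ := exists_nat_ge ((d + 1) / (ε / 4))
  rw [div_le_iff₀ ha] at hd
  rw [div_le_iff₀ (by positivity)] at hm
  have hd1 : (1 : ℝ) ≤ d := by
    have : 0 < d := by
      by_contra h
      have h0 : d = 0 := by omega
      rw [h0] at hd
      simp at hd; linarith
    exact_mod_cast this
  set C₁ : ℝ := β + β * CE / a * 2 ^ a with hC₁
  have hC₁0 : 0 < C₁ := by positivity
  have htend : ∀ γ : ℝ, 0 < γ → Tendsto (fun n : ℕ => (n : ℝ) ^ (-γ)) atTop (𝓝 0) := fun γ hγ =>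
    (tendsto_rpow_neg_atTop hγ).comp tendsto_natCast_atTop_atTop
  have htop : ∀ γ : ℝ, 0 < γ → Tendsto (fun n : ℕ => (n : ℝ) ^ γ) atTop atTop := fun γ hγ =>
    (tendsto_rpow_atTop hγ).comp tendsto_natCast_atTop_atTop
  have ev1 : ∀ᶠ n : ℕ in atTop, C₁ * (n : ℝ) ^ (-(ε / 2)) ≤ 1 / 2 := by
    have := (htend (ε / 2) (by positivity)).const_mul C₁
    rw [mul_zero] at this
    exact (this.eventually (gt_mem_nhds (by norm_num : (0 : ℝ) < 1 / 2))).mono fun _ h => h.le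
  have ev2 : ∀ᶠ n : ℕ in atTop, m * (C₁ * (n : ℝ) ^ (-(ε / 2))) ≤ 1 / 2 := by
    have := ((htend (ε / 2) (by positivity)).const_mul C₁).const_mul (m : ℝ)
    rw [mul_zero, mul_zero] at this
    exact (this.eventually (gt_mem_nhds (by norm_num : (0 : ℝ) < 1 / 2))).mono fun _ h => h.le
  have ev3 : ∀ᶠ n : ℕ in atTop, (n : ℝ) ^ (-(ε / 4)) ≤ 1 / 2 :=
    ((htend (ε / 4) (by positivity)).eventually
      (gt_mem_nhds (by norm_num : (0 : ℝ) < 1 / 2))).mono fun _ h => h.le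
  have ev4 : ∀ᶠ n : ℕ in atTop, β * CE / a ≤ (n : ℝ) ^ (ε * (1 + a)) :=
    (htop _ (by positivity)).eventually_ge_atTop _
  have ev5 : ∀ᶠ n : ℕ in atTop, CE ≤ (n : ℝ) ^ (ε * (1 + a)) :=
    (htop _ (by positivity)).eventually_ge_atTop _
  obtain ⟨n₀, hn₀⟩ := eventually_atTop.1 (ev1.and (ev2.and (ev3.and (ev4.and
    (ev5.and (eventually_ge_atTop 1))))))
  refine ⟨9 ^ (m + 2), by positivity, n₀, fun n hn p eig μ hμ hL hE hG hnp => ?_⟩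
  obtain ⟨h1, h2, h3, h4, h5, h6⟩ := hn₀ n hn
  have hx1 : (1 : ℝ) ≤ n := by exact_mod_cast h6
  have hx0 : (0 : ℝ) < n := by linarith
  set x : ℝ := (n : ℝ) with hx
  have hk1 : 1 ≤ x ^ (1 - ε) := Real.one_le_rpow hx1 (by linarith)
  set k := ⌊x ^ (1 - ε)⌋₊ with hk
  have hkle : (k : ℝ) ≤ x ^ (1 - ε) := Nat.floor_le (by positivity)
  have hkge : x ^ (1 - ε) / 2 ≤ (k : ℝ) := half_le_floor hk1
  have hk0 : 1 ≤ k := Nat.le_floor (by simpa using hk1)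
  have hkn : k ≤ n := by
    have : (k : ℝ) ≤ n := hkle.trans (by
      conv_rhs => rw [← hx, ← Real.rpow_one x]
      exact Real.rpow_le_rpow_of_exponent_le hx1 (by linarith))
    exact_mod_cast this
  have hd0 : d ≠ 0 := fun h => by rw [h] at hd1; norm_num at hd1
  have hkN : k ≤ n ^ d := hkn.trans (Nat.le_self_pow hd0 n)
  have hka : (k : ℝ) ^ (-a) ≤ 2 ^ a * x ^ (-(a * (1 - ε))) := by
    calc (k : ℝ) ^ (-a) ≤ (x ^ (1 - ε) / 2) ^ (-a) :=
          Real.rpow_le_rpow_of_nonpos (by positivity) hkge (by linarith)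
      _ = _ := by
          rw [Real.div_rpow (by positivity) (by norm_num), ← Real.rpow_mul hx0.le,
            Real.rpow_neg (by norm_num : (0 : ℝ) ≤ 2), div_inv_eq_mul, mul_comm]
          congr 2; ring
  have hNd : (((n ^ d : ℕ) : ℝ)) = x ^ (d : ℝ) := by rw [Real.rpow_natCast]; push_cast; rfl
  have key := generic_transfer (n := n) (m := m) (N := n ^ d) (s := x ^ (1 - ε / 2))
    (ν := x ^ (-a + ε * (1 + a))) (t := x ^ (-1 + ε / 4)) (τ := C₁ * x ^ (-(ε / 2)))
    ha hCE hβ hL hE hG (by omega) hk0 (lt_of_le_of_lt (by exact_mod_cast hkn) hnp) hkN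
    (by positivity) (by positivity) (by positivity) ?_ h1 h2 ?_ ?_ ?_
  · refine key.trans (ENNReal.ofReal_le_ofReal ?_)
    rw [hNd, ← hx]
    have e1 : x * x ^ (-1 + ε / 4) = x ^ (ε / 4) := by
      nth_rewrite 1 [← Real.rpow_one x]
      rw [← Real.rpow_add hx0]; congr 1; ring
    rw [e1, div_pow, ← Real.rpow_natCast (x ^ (ε / 4)), ← Real.rpow_mul hx0.le, ← mul_div_assoc,
      mul_comm, mul_div_assoc, ← Real.rpow_sub hx0, div_eq_mul_inv _ x, ← Real.rpow_neg_one x]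
    refine mul_le_mul_of_nonneg_left (Real.rpow_le_rpow_of_exponent_le hx1 ?_) (by positivity)
    push_cast
    nlinarith
  · have e1 : β * k / x ^ (1 - ε / 2) ≤ β * x ^ (-(ε / 2)) := by
      rw [mul_div_assoc]
      refine mul_le_mul_of_nonneg_left ?_ hβ.le
      rw [div_le_iff₀ (by positivity), ← Real.rpow_add hx0]
      refine hkle.trans (le_of_eq ?_)
      congr 1; ring
    have e2 : β * (CE * ((k : ℝ) ^ (-a) / a)) / x ^ (-a + ε * (1 + a))
        ≤ β * CE / a * 2 ^ a * x ^ (-(ε / 2)) := by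
      rw [div_le_iff₀ (by positivity)]
      calc β * (CE * ((k : ℝ) ^ (-a) / a)) = β * CE / a * (k : ℝ) ^ (-a) := by ring
        _ ≤ β * CE / a * (2 ^ a * x ^ (-(a * (1 - ε)))) :=
            mul_le_mul_of_nonneg_left hka (by positivity)
        _ = β * CE / a * 2 ^ a * x ^ (-(a * (1 - ε))) := by ring
        _ ≤ β * CE / a * 2 ^ a * (x ^ (-(ε / 2)) * x ^ (-a + ε * (1 + a))) := by
            refine mul_le_mul_of_nonneg_left ?_ (by positivity)
            rw [← Real.rpow_add hx0]
            refine Real.rpow_le_rpow_of_exponent_le hx1 ?_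
            nlinarith
        _ = _ := by ring
    rw [hC₁, add_mul]
    exact add_le_add e1 e2
  · rw [← Real.rpow_add hx0]
    refine le_trans (le_of_eq ?_) h3
    congr 1; ring
  · rw [hNd, ← Real.rpow_add hx0]
    calc CE * (x ^ (d : ℝ) + 1) ^ (-1 - a) ≤ x ^ (ε * (1 + a)) * (x ^ (d : ℝ)) ^ (-1 - a) := by
          refine mul_le_mul h5 (Real.rpow_le_rpow_of_nonpos (by positivity) (by linarith)
            (by linarith)) (by positivity) (by positivity)
      _ = x ^ (ε * (1 + a) + d * (-1 - a)) := by
          rw [← Real.rpow_mul hx0.le, ← Real.rpow_add hx0]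
      _ ≤ _ := by
          refine Real.rpow_le_rpow_of_exponent_le hx1 ?_
          nlinarith
  · rw [hNd, ← hx, ← Real.rpow_mul hx0.le]
    calc x * (β * (CE * (x ^ ((d : ℝ) * -a) / a))) = β * CE / a * (x * x ^ ((d : ℝ) * -a)) := by
          ring
      _ ≤ x ^ (ε * (1 + a)) * (x * x ^ ((d : ℝ) * -a)) :=
          mul_le_mul_of_nonneg_right h4 (by positivity)
      _ = x ^ (ε * (1 + a) + 1 + (d : ℝ) * -a) := by
          rw [Real.rpow_add hx0, Real.rpow_add hx0, Real.rpow_one]; ring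
      _ ≤ _ := by
          refine Real.rpow_le_rpow_of_exponent_le hx1 ?_
          nlinarith

lemma le_tsum_eig_tail (hcE : 0 < cE) (ha : 0 < a) {p : ℕ∞} {eig : ℕ → ℝ} {μ : Measure (ℕ → ℝ)}
    (hL : IsFeatureLaw p eig μ) (hE : EigenDecay p a cE CE eig) (hs : Summable eig) {K : ℕ}
    (hK0 : 1 ≤ K) (hK : ((2 * K : ℕ) : ℕ∞) ≤ p) :
    cE * 2 ^ (-1 - a) * (K : ℝ) ^ (-a) ≤ ∑' l, eig (K + l) := by
  have hs' : Summable fun l => eig (K + l) := by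
    simpa only [add_comm K] using (summable_nat_add_iff K).2 hs
  have hK' : (0 : ℝ) < K := by exact_mod_cast hK0
  calc cE * 2 ^ (-1 - a) * (K : ℝ) ^ (-a) = ∑ l ∈ Finset.range K, cE * (2 * (K : ℝ)) ^ (-1 - a) := by
        rw [Finset.sum_const, Finset.card_range, nsmul_eq_mul,
          Real.mul_rpow (by norm_num) hK'.le, show -1 - a = -a - 1 by ring,
          Real.rpow_sub_one hK'.ne']
        field_simp
    _ ≤ ∑ l ∈ Finset.range K, eig (K + l) := by
        refine Finset.sum_le_sum fun l hl => ?_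
        have hl' := Finset.mem_range.1 hl
        refine le_trans ?_ (hE (K + l) (lt_of_lt_of_le (by exact_mod_cast (by omega)) hK)).1
        refine mul_le_mul_of_nonneg_left (Real.rpow_le_rpow_of_nonpos (by positivity) ?_
          (by linarith)) hcE.le
        have : (l : ℝ) + 1 ≤ K := by exact_mod_cast hl'
        push_cast; linarith
    _ ≤ _ := hs'.sum_le_tsum _ fun _ _ => hL.nonneg _

lemma sum_Ico_eig_sq_le (ha : 0 < a) (hCE : 0 < CE) {p : ℕ∞} {eig : ℕ → ℝ} {μ : Measure (ℕ → ℝ)}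
    (hL : IsFeatureLaw p eig μ) (hE : EigenDecay p a cE CE eig) {K : ℕ} (hK0 : 1 ≤ K) (N : ℕ) :
    ∑ l ∈ Finset.Ico K N, eig l ^ 2 ≤ CE ^ 2 * ((K : ℝ) ^ (-(2 * a + 1)) / (2 * a + 1)) := by
  calc _ ≤ ∑ l ∈ Finset.Ico K N, CE ^ 2 * ((l : ℝ) + 1) ^ (-1 - (2 * a + 1)) := by
        refine Finset.sum_le_sum fun l _ => ?_
        have h := pow_le_pow_left₀ (hL.nonneg l) (eig_le_of_decay hL hCE hE l) 2
        refine h.trans (le_of_eq ?_)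
        rw [mul_pow, ← Real.rpow_natCast (((l : ℝ) + 1) ^ (-1 - a)),
          ← Real.rpow_mul (by positivity)]
        congr 2; push_cast; ring
    _ ≤ _ := by
        rw [← Finset.mul_sum]
        exact mul_le_mul_of_nonneg_left (sum_Ico_rpow_le (by positivity) hK0 N) (by positivity)

/-- With at least `κ n² log n` features the smallest eigenvalue of the kernel matrix is at least
`c n^{-(2+ε)a}`, outside an event of probability `O(1 / log n)`. -/
lemma exists_generic_minEig (ha : 0 < a) (hcE : 0 < cE) (hCE : 0 < CE) (hα : 0 < α) (hβ : 0 < β)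
    (hκ : 0 < κ) {ε : ℝ} (hε : 0 < ε) :
    ∃ C c : ℝ, 0 < C ∧ 0 < c ∧ ∃ n₀ : ℕ, ∀ n ≥ n₀, ∀ (p : ℕ∞) (eig : ℕ → ℝ) (μ : Measure (ℕ → ℝ)),
      IsProbabilityMeasure μ → IsFeatureLaw p eig μ → EigenDecay p a cE CE eig →
      GenericFeatures p eig μ α β →
      ENNReal.ofReal (κ * (n : ℝ) ^ 2 * Real.log n) ≤ (p : ℝ≥0∞) →
      (n : ℕ∞) < p ∧ ∃ F : Finset ℕ,
        sampleLaw n μ {X | ¬ ∀ c' : Fin n → ℝ, c * (n : ℝ) ^ (-((2 + ε) * a)) * ∑ i, c' i ^ 2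
          ≤ ∑ l ∈ F, (∑ i, c' i * X i l) ^ 2} ≤ ENNReal.ofReal (C / Real.log n) := by
  have hlog : Tendsto (fun n : ℕ => Real.log n) atTop atTop :=
    Real.tendsto_log_atTop.comp tendsto_natCast_atTop_atTop
  have ev1 : ∀ᶠ n : ℕ in atTop, 4 / κ + 1 ≤ Real.log n := hlog.eventually_ge_atTop _
  have ev2 : ∀ᶠ n : ℕ in atTop, Real.log n ≤ (n : ℝ) ^ ε := by
    have h := (isLittleO_log_rpow_atTop hε).bound (by norm_num : (0 : ℝ) < 1)
    have h2 := tendsto_natCast_atTop_atTop (R := ℝ) |>.eventually h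
    filter_upwards [h2] with n hn
    rw [one_mul, Real.norm_of_nonneg (by positivity : (0 : ℝ) ≤ (n : ℝ) ^ ε)] at hn
    exact (le_abs_self _).trans hn
  obtain ⟨n₀, hn₀⟩ := eventually_atTop.1 (ev1.and (ev2.and (eventually_ge_atTop 2)))
  set c₀ : ℝ := α / 4 * (cE * 2 ^ (-1 - a)) with hc₀
  have hc₀0 : 0 < c₀ := by positivity
  refine ⟨CE ^ 2 / (2 * a + 1) / c₀ ^ 2 * (4 / κ), c₀ * (κ / 2) ^ (-a), by positivity,
    by positivity, n₀, fun n hn p eig μ hμ hL hE hG hp => ?_⟩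
  obtain ⟨h1, h2, h3⟩ := hn₀ n hn
  have hn2 : (2 : ℝ) ≤ n := by exact_mod_cast h3
  have hn0 : (0 : ℝ) < n := by linarith
  have hlog1 : 1 ≤ Real.log n := by
    have : 0 < 4 / κ := by positivity
    linarith
  have hlog0 : 0 < Real.log n := by linarith
  have hκl : 4 ≤ κ * Real.log n := by
    have := mul_le_mul_of_nonneg_left h1 hκ.le
    have e : κ * (4 / κ + 1) = 4 + κ := by field_simp
    linarith
  set y : ℝ := κ / 2 * n ^ 2 * Real.log n with hy
  have hy2 : 2 * (n : ℝ) ≤ y := by rw [hy]; nlinarith [mul_le_mul_of_nonneg_right hκl hn0.le]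
  have hy1 : 1 ≤ y := by linarith
  set K := ⌊y⌋₊ with hK
  have hKle : (K : ℝ) ≤ y := Nat.floor_le (by linarith)
  have hKge : y / 2 ≤ (K : ℝ) := half_le_floor hy1
  have hK0 : 1 ≤ K := Nat.le_floor (by simpa using hy1)
  have hK0' : (0 : ℝ) < K := by exact_mod_cast hK0
  have hKp : ((2 * K : ℕ) : ℕ∞) ≤ p := by
    rw [← ENat.toENNReal_le]
    refine le_trans ?_ hp
    rw [ENat.toENNReal_coe, ← ENNReal.ofReal_natCast]
    refine ENNReal.ofReal_le_ofReal ?_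
    push_cast
    rw [hy] at hKle
    linarith
  have hnK : n ≤ K := Nat.le_floor (by linarith)
  have hKp' : (K : ℕ∞) < p := lt_of_lt_of_le (by exact_mod_cast (by omega)) hKp
  refine ⟨lt_of_le_of_lt (by exact_mod_cast hnK) hKp', ?_⟩
  have hsum := summable_eig ha hL hCE hE
  set tr := ∑' l, eig (K + l) with htr
  have htr0 : 0 < tr := tsum_tail_pos hL hsum hKp'
  have htrge : cE * 2 ^ (-1 - a) * (K : ℝ) ^ (-a) ≤ tr := le_tsum_eig_tail hcE ha hL hE hsum hK0 hKp
  obtain ⟨N, hKN, hN⟩ : ∃ N, K ≤ N ∧ β * ∑' l, eig (N + l) ≤ α / 2 * tr := by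
    have ht := (tendsto_sum_nat_add eig).const_mul β
    rw [mul_zero] at ht
    obtain ⟨N, hN1, hN2⟩ := ((ht.eventually (gt_mem_nhds (by positivity : 0 < α / 2 * tr))).and
      (eventually_ge_atTop K)).exists
    refine ⟨N, hN2, ?_⟩
    simpa only [add_comm N] using hN1.le
  refine ⟨Finset.Ico K N, ?_⟩
  have htr' : c₀ * (K : ℝ) ^ (-a) ≤ α / 4 * tr := by
    rw [hc₀, mul_assoc]
    exact mul_le_mul_of_nonneg_left htrge (by positivity)
  refine (measure_mono ?_).trans ((generic_minEig (n := n) hα hβ hL hsum hG hKN hKp' hN).trans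
    (ENNReal.ofReal_le_ofReal ?_))
  · intro X hX hc
    refine hX fun c' => le_trans ?_ (hc c')
    refine mul_le_mul_of_nonneg_right (le_trans ?_ htr') (Finset.sum_nonneg fun _ _ => sq_nonneg _)
    rw [mul_assoc]
    refine mul_le_mul_of_nonneg_left ?_ hc₀0.le
    calc (κ / 2) ^ (-a) * (n : ℝ) ^ (-((2 + ε) * a)) = (κ / 2 * n ^ (2 + ε)) ^ (-a) := by
          rw [Real.mul_rpow (by positivity) (by positivity), ← Real.rpow_mul hn0.le, mul_neg]
      _ ≤ (K : ℝ) ^ (-a) := by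
          refine Real.rpow_le_rpow_of_nonpos hK0' (hKle.trans ?_) (by linarith)
          rw [hy, mul_assoc, Real.rpow_add hn0]
          refine mul_le_mul_of_nonneg_left ?_ (by positivity)
          norm_num
          exact mul_le_mul_of_nonneg_left h2 (by positivity)
  · have hsq := sum_Ico_eig_sq_le ha hCE hL hE hK0 N
    rw [div_le_iff₀ (by positivity)]
    have e1 : (c₀ * (K : ℝ) ^ (-a)) ^ 2 ≤ (α / 4 * tr) ^ 2 :=
      pow_le_pow_left₀ (by positivity) htr' 2
    have e2 : (n : ℝ) ^ 2 ≤ 4 / κ / Real.log n * K := by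
      rw [div_div, div_mul_eq_mul_div, le_div_iff₀ (by positivity)]
      rw [hy] at hKge
      nlinarith
    calc (n : ℝ) ^ 2 * ∑ l ∈ Finset.Ico K N, eig l ^ 2
        ≤ (4 / κ / Real.log n * K) * (CE ^ 2 * ((K : ℝ) ^ (-(2 * a + 1)) / (2 * a + 1))) :=
          mul_le_mul e2 hsq (Finset.sum_nonneg fun _ _ => sq_nonneg _) (by positivity)
      _ = CE ^ 2 / (2 * a + 1) / c₀ ^ 2 * (4 / κ) / Real.log n * (c₀ * (K : ℝ) ^ (-a)) ^ 2 := by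
          have e3 : (K : ℝ) * (K : ℝ) ^ (-(2 * a + 1)) = ((K : ℝ) ^ (-a)) ^ 2 := by
            rw [← Real.rpow_natCast ((K : ℝ) ^ (-a)), ← Real.rpow_mul hK0'.le]
            nth_rewrite 1 [← Real.rpow_one (K : ℝ)]
            rw [← Real.rpow_add hK0']
            congr 1; push_cast; ring
          rw [mul_pow c₀, ← e3]
          field_simp
      _ ≤ _ := mul_le_mul_of_nonneg_left e1 (by positivity)

end GenericAsymptotics

/-- The bias on the event given by the transfer inequality, a lower bound `ν₀` for the kernel
matrix, and a bound for the sample values of the tail of the target function. -/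
lemma bias_le_of_minEig {p : ℕ∞} {eig θ : ℕ → ℝ} {μ : Measure (ℕ → ℝ)} [IsProbabilityMeasure μ]
    (hL : IsFeatureLaw p eig μ) (hs : Summable eig) {f : (ℕ → ℝ) → ℝ} {n : ℕ} {lam : ℝ}
    (hlam : 0 ≤ lam) {X : Fin n → ℕ → ℝ} {t ν : ℝ} (ht : 0 ≤ t) (hν : 0 ≤ ν)
    (hT : Transfer eig X t ν) {J K : ℕ} (hJK : J ≤ K) (hJ : ∀ l < J, 0 < eig l) {E : ℝ}
    (hE0 : 0 ≤ E) (hE : ∫⁻ x : ℕ → ℝ, ENNReal.ofReal ((f x - ∑ k ∈ Finset.range K, x k * θ k) ^ 2) ∂μ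
      ≤ ENNReal.ofReal E) {ν₀ : ℝ} (hν₀ : 0 < ν₀) {F : Finset ℕ}
    (hF : ∀ c : Fin n → ℝ, ν₀ * ∑ i, c i ^ 2 ≤ ∑ l ∈ F, (∑ i, c i * X i l) ^ 2) {η : ℝ}
    (hη : ∑ i, (f (X i) - ∑ k ∈ Finset.range K, X i k * θ k) ^ 2 ≤ η) :
    bias μ f lam X ≤ ENNReal.ofReal (4 * (
      (t * (ν + n * lam)) ^ 2 * (∑ k ∈ Finset.range J, θ k ^ 2 / eig k)
      + t * (ν + n * lam) * (∑ k ∈ Finset.Ico J K, θ k ^ 2)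
      + t * (η + ν * (η / ν₀)) + E)) := by
  obtain ⟨x, rfl, hT⟩ := hT
  have hρ : 0 ≤ (n : ℝ) * lam := by positivity
  have hpos := le_gramRidge_of_sum_sq x hρ F hF
  have hA := isUnit_gramRidge_det x hν₀ hpos
  have hη0 : 0 ≤ η := le_trans (Finset.sum_nonneg fun _ _ => sq_nonneg _) hη
  have hQ := dotProduct_inv_mulVec_le hA hν₀ hpos
    (fun i => f (x i) - ∑ k ∈ Finset.range K, x i k * θ k)
  refine (bias_le_of_transfer hL hs hlam x hA ht hν hT hJK hJ hE0 (fun i => rfl)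
    (hQ.trans (div_le_div_of_nonneg_right hη hν₀.le)) (by positivity) hE).trans
    (ENNReal.ofReal_le_ofReal ?_)
  gcongr

section GenericBias

variable {a r cE CE cR CR CT α β κ : ℝ}

lemma aemeasurable_target_tail {μ : Measure (ℕ → ℝ)} {θ : ℕ → ℝ} {f : (ℕ → ℝ) → ℝ}
    (hf : IsTargetFunction μ θ f) (K : ℕ) :
    AEMeasurable (fun x : ℕ → ℝ => f x - ∑ k ∈ Finset.range K, x k * θ k) μ :=
  hf.1.aestronglyMeasurable.aemeasurable.sub
    (Finset.measurable_fun_sum _ fun k _ => by fun_prop).aemeasurable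

/-- The rate in terms of the exponents of the error terms; `ε` absorbs the losses of the transfer
inequality and of the eigenvalue bound. -/
lemma generic_rate_le (ha : 0 < a) (hr : 0 < r) (hCR : 0 < CR) {ε : ℝ} (hε : 0 < ε)
    (hεa : ε * (2 * a + 4) ≤ a) (hεr : ε * (2 * a + 4) ≤ r) {x lamn W CW L η E₀ D c : ℝ}
    (hx : 1 ≤ x) (hlam0 : 0 ≤ lamn) (hlam : lamn ≤ CR * x ^ (-a)) (hCW : 0 < CW) (hL : 1 ≤ L)
    (hW : W ≤ CW * L * x ^ max (2 + a - 2 * r) 0) (hc : 0 < c) (hE₀ : 0 < E₀) (hD : 0 < D)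
    (hη : η = D * x ^ (1 - (a + 2 * r))) :
    4 * ((8 * x ^ (-1 + ε / 4) * (x ^ (-a + ε * (1 + a)) + lamn)) ^ 2 * W
      + 8 * x ^ (-1 + ε / 4) * (η + x ^ (-a + ε * (1 + a)) * (η / (c * x ^ (-((2 + ε) * a)))))
      + E₀ * x ^ (-(a + 2 * r)))
    ≤ 4 * ((8 * (1 + CR)) ^ 2 * CW + 8 * D * (1 + 1 / c) + E₀) * L
      * x ^ (-max (min (2 * (r - a)) (2 - a)) 0) := by
  have hx0 : 0 < x := by linarith
  set e := max (min (2 * (r - a)) (2 - a)) 0 with he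
  have he1 : e ≤ 2 * r - ε * (2 * a + 4) := by
    refine max_le ((min_le_left _ _).trans (by linarith)) (by linarith)
  have he2 : e ≤ 2 + 2 * a - ε * (2 * a + 4) - max (2 + a - 2 * r) 0 := by
    rcases max_cases (2 + a - 2 * r) 0 with ⟨h, h'⟩ | ⟨h, h'⟩
    · rw [h]
      refine max_le ((min_le_left _ _).trans (by linarith)) (by linarith)
    · rw [h]
      refine max_le ((min_le_right _ _).trans (by linarith)) (by linarith)
  have hmono : ∀ γ γ' : ℝ, γ ≤ γ' → x ^ γ ≤ x ^ γ' := fun γ γ' h =>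
    Real.rpow_le_rpow_of_exponent_le hx h
  have t0 : 8 * x ^ (-1 + ε / 4) * (x ^ (-a + ε * (1 + a)) + lamn)
      ≤ 8 * (1 + CR) * x ^ (-1 - a + ε * (5 / 4 + a)) := by
    calc _ ≤ 8 * x ^ (-1 + ε / 4) * ((1 + CR) * x ^ (-a + ε * (1 + a))) := by
          refine mul_le_mul_of_nonneg_left ?_ (by positivity)
          have := mul_le_mul_of_nonneg_left
            (hmono (-a) (-a + ε * (1 + a)) (by nlinarith [mul_pos hε ha])) hCR.le
          linarith
      _ = 8 * (1 + CR) * (x ^ (-1 + ε / 4) * x ^ (-a + ε * (1 + a))) := by ring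
      _ = _ := by rw [← Real.rpow_add hx0]; congr 2; ring
  have t1 : (8 * x ^ (-1 + ε / 4) * (x ^ (-a + ε * (1 + a)) + lamn)) ^ 2 * W
      ≤ (8 * (1 + CR)) ^ 2 * CW * L * x ^ (-e) := by
    calc _ ≤ (8 * (1 + CR) * x ^ (-1 - a + ε * (5 / 4 + a))) ^ 2
          * (CW * L * x ^ max (2 + a - 2 * r) 0) := by
          refine (mul_le_mul_of_nonneg_left hW (sq_nonneg _)).trans ?_
          exact mul_le_mul_of_nonneg_right (pow_le_pow_left₀ (by positivity) t0 2) (by positivity)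
      _ = (8 * (1 + CR)) ^ 2 * CW * L
          * ((x ^ (-1 - a + ε * (5 / 4 + a))) ^ 2 * x ^ max (2 + a - 2 * r) 0) := by ring
      _ ≤ _ := by
          refine mul_le_mul_of_nonneg_left ?_ (by positivity)
          rw [← Real.rpow_natCast (x ^ _), ← Real.rpow_mul hx0.le, ← Real.rpow_add hx0]
          refine hmono _ _ ?_
          push_cast
          linarith
  have t2 : 8 * x ^ (-1 + ε / 4) * (η + x ^ (-a + ε * (1 + a)) * (η / (c * x ^ (-((2 + ε) * a)))))
      ≤ 8 * D * (1 + 1 / c) * L * x ^ (-e) := by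
    have e1 : η + x ^ (-a + ε * (1 + a)) * (η / (c * x ^ (-((2 + ε) * a))))
        = η * (1 + 1 / c * x ^ (a + ε * (1 + 2 * a))) := by
      rw [Real.rpow_neg hx0.le ((2 + ε) * a),
        show a + ε * (1 + 2 * a) = (-a + ε * (1 + a)) + (2 + ε) * a by ring,
        Real.rpow_add hx0 (-a + ε * (1 + a))]
      have : x ^ ((2 + ε) * a) ≠ 0 := by positivity
      field_simp
    have e2 : 1 + 1 / c * x ^ (a + ε * (1 + 2 * a)) ≤ (1 + 1 / c) * x ^ (a + ε * (1 + 2 * a)) := by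
      have : 1 ≤ x ^ (a + ε * (1 + 2 * a)) := Real.one_le_rpow hx (by positivity)
      linarith
    rw [e1, hη]
    calc _ ≤ 8 * x ^ (-1 + ε / 4) * (D * x ^ (1 - (a + 2 * r))
          * ((1 + 1 / c) * x ^ (a + ε * (1 + 2 * a)))) := by gcongr
      _ = 8 * D * (1 + 1 / c) * (x ^ (-1 + ε / 4) * (x ^ (1 - (a + 2 * r))
          * x ^ (a + ε * (1 + 2 * a)))) := by ring
      _ ≤ 8 * D * (1 + 1 / c) * (L * x ^ (-e)) := by
          refine mul_le_mul_of_nonneg_left ?_ (by positivity)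
          rw [← Real.rpow_add hx0, ← Real.rpow_add hx0]
          refine le_trans (hmono _ (-e) ?_) (le_mul_of_one_le_left (by positivity) hL)
          linarith
      _ = _ := by ring
  have t3 : E₀ * x ^ (-(a + 2 * r)) ≤ E₀ * L * x ^ (-e) := by
    rw [mul_assoc]
    refine mul_le_mul_of_nonneg_left ?_ hE₀.le
    refine le_trans (hmono _ (-e) ?_) (le_mul_of_one_le_left (by positivity) hL)
    have : 0 ≤ ε * (2 * a + 4) := by positivity
    linarith
  calc _ ≤ 4 * ((8 * (1 + CR)) ^ 2 * CW * L * x ^ (-e) + 8 * D * (1 + 1 / c) * L * x ^ (-e)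
        + E₀ * L * x ^ (-e)) := by linarith
    _ = _ := by ring

/-- The bias bound for generic features: the target is cut at `J = K = n`, without an intermediate
block. -/
theorem generic_bias_bound (ha : 0 < a) (hr : 0 < r) {b : EReal} (hb : ((1 + a : ℝ) : EReal) ≤ b)
    (hcE : 0 < cE) (hCE : 0 < CE) (hcR : 0 < cR) (hCR : 0 < CR) (hCT : 0 < CT)
    (hα : 0 < α) (hβ : 0 < β) (hκ : 0 < κ) :
    ∃ M : ℝ, 0 < M ∧ ∃ q : ℕ, ∀ δ : ℝ, 0 < δ → δ < 1 → ∃ K : ℝ, 0 < K ∧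
      ∀ (n : ℕ) (p : ℕ∞), 2 ≤ n →
        ENNReal.ofReal (κ * (n : ℝ) ^ 2 * Real.log n) ≤ (p : ℝ≥0∞) →
      ∀ (lam : ℝ) (eig θ : ℕ → ℝ) (μ : Measure (ℕ → ℝ)) (f : (ℕ → ℝ) → ℝ),
        IsProbabilityMeasure μ → IsFeatureLaw p eig μ → EigenDecay p a cE CE eig →
        TargetDecay p r CT θ → RidgeDecay b cR CR n lam → GenericFeatures p eig μ α β →
        IsTargetFunction μ θ f →
        1 - δ - M / Real.log n ≤ (sampleLaw n μ).real
          {X | bias μ f lam X ≤ ENNReal.ofReal (K * Real.log n ^ q *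
            (n : ℝ) ^ (-max (min (2 * (r - a)) (2 - a)) 0))} := by
  -- the exponents lose at most `ε (2 a + 4)`
  set ε : ℝ := min (min a r) 1 / (2 * a + 4) with hε
  have hm0 : 0 < min (min a r) 1 := lt_min (lt_min ha hr) one_pos
  have hε0 : 0 < ε := by positivity
  have hεm : ε * (2 * a + 4) = min (min a r) 1 := by rw [hε]; field_simp
  have hεa : ε * (2 * a + 4) ≤ a := hεm.le.trans ((min_le_left _ _).trans (min_le_left _ _))
  have hεr : ε * (2 * a + 4) ≤ r := hεm.le.trans ((min_le_left _ _).trans (min_le_right _ _))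
  have hε1 : ε < 1 := by
    have := hεm.le.trans (min_le_right _ _)
    nlinarith [mul_pos hε0 ha]
  obtain ⟨C₁, hC₁, n₁, H₁⟩ := exists_generic_transfer (cE := cE) (α := α) ha hCE hβ hε0 hε1
  obtain ⟨C₂, c, hC₂, hc, n₂, H₂⟩ := exists_generic_minEig ha hcE hCE hα hβ hκ hε0
  obtain ⟨CW, hCW, HW⟩ := exists_sum_range_rpow_le (2 + a - 2 * r)
  set N : ℕ := max (max n₁ n₂) 3 with hN
  have hlogN : 0 < Real.log N := Real.log_pos (by
    have : 3 ≤ N := le_max_right _ _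
    exact_mod_cast (by omega : 1 < N))
  set E₀ : ℝ := CE * CT ^ 2 / (a + 2 * r) with hE₀
  have hE₀0 : 0 < E₀ := by positivity
  refine ⟨C₁ + C₂ + Real.log N, by positivity, if 2 + a - 2 * r = 0 then 1 else 0,
    fun δ hδ hδ1 => ?_⟩
  refine ⟨4 * ((8 * (1 + CR)) ^ 2 * (CT ^ 2 / cE * CW) + 8 * (E₀ / δ) * (1 + 1 / c) + E₀),
    by positivity, ?_⟩
  intro n p hn hp lam eig θ μ f hμ hL hE hθ hR hG hf
  have hn0 : (0 : ℝ) < n := by positivity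
  have hn1 : (1 : ℝ) ≤ n := by exact_mod_cast (by omega : 1 ≤ n)
  have hlogn : 0 < Real.log n := Real.log_pos (by exact_mod_cast (by omega : 1 < n))
  rcases lt_or_ge n N with hnN | hnN
  · -- for small `n` the asserted lower bound is not positive
    have h1 : Real.log n ≤ C₁ + C₂ + Real.log N := by
      have := Real.log_le_log hn0 (by exact_mod_cast hnN.le : (n : ℝ) ≤ N)
      linarith
    have h2 : 1 ≤ (C₁ + C₂ + Real.log N) / Real.log n := (one_le_div hlogn).2 h1
    exact le_trans (by linarith) measureReal_nonneg
  have hn₁ : n₁ ≤ n := ((le_max_left _ _).trans (le_max_left _ _)).trans hnN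
  have hn₂ : n₂ ≤ n := ((le_max_right _ _).trans (le_max_left _ _)).trans hnN
  have hn3 : 3 ≤ n := (le_max_right _ _).trans hnN
  have hlog1 : 1 ≤ Real.log n := by
    rw [Real.le_log_iff_exp_le hn0]
    exact Real.exp_one_lt_three.le.trans (by exact_mod_cast hn3)
  obtain ⟨hnp, F, hF⟩ := H₂ n hn₂ p eig μ hμ hL hE hG hp
  have hT := H₁ n hn₁ p eig μ hμ hL hE hG hnp
  have hs := summable_eig ha hL hCE hE
  obtain ⟨hlam0, hlam⟩ := ridge_bounds hb hcR hCR (by omega) hR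
  set E : ℝ := E₀ * (n : ℝ) ^ (-(a + 2 * r)) with hEd
  have hE0 : 0 < E := by positivity
  have hEf := hL.lintegral_target_tail_le hf n (E := E) fun m =>
    sum_target_tail_le ha hr hL hCE hE hθ (by omega) m
  have hη := measure_sum_sq_ge_le (n := n) (aemeasurable_target_tail hf n) hE0 hδ (by omega) hEf
  have hfin : 1 - (C₁ / n + C₂ / Real.log n + δ) ≤ (sampleLaw n μ).real
          {X | bias μ f lam X ≤ ENNReal.ofReal (4 * ((8 * (1 + CR)) ^ 2 * (CT ^ 2 / cE * CW)
            + 8 * (E₀ / δ) * (1 + 1 / c) + E₀) * Real.log n ^ (if 2 + a - 2 * r = 0 then 1 else 0) *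
            (n : ℝ) ^ (-max (min (2 * (r - a)) (2 - a)) 0))} := by
    refine le_measureReal_of_compl_le (by positivity) (((measure_union_le _ _).trans
      (add_le_add ((measure_union_le _ _).trans (add_le_add hT hF)) hη)).trans (le_of_eq ?_))
      (ae_of_all _ fun X hX => ?_)
    · rw [← ENNReal.ofReal_add (by positivity) (by positivity),
        ← ENNReal.ofReal_add (by positivity) hδ.le]
    simp only [Set.mem_union, Set.mem_ofPred_eq, not_or, not_not, not_le] at hX
    obtain ⟨⟨hX1, hX2⟩, hX3⟩ := hX
    refine (bias_le_of_minEig hL hs hlam0 (by positivity) (by positivity) hX1 le_rfl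
      (fun l hl => hL.pos l (lt_trans (by exact_mod_cast hl) hnp)) hE0.le hEf (by positivity) hX2
      hX3.le).trans (ENNReal.ofReal_le_ofReal ?_)
    rw [Finset.Ico_self, Finset.sum_empty, mul_zero, add_zero]
    refine generic_rate_le ha hr hCR hε0 hεa hεr hn1 (by positivity) hlam (by positivity) ?_ ?_ hc
      hE₀0 (by positivity) ?_
    · split_ifs <;> simp [hlog1]
    · refine (sum_sq_div_eig_le hcE hE hθ hnp.le).trans ?_
      rw [mul_assoc, mul_assoc, ← mul_assoc CW]
      exact mul_le_mul_of_nonneg_left (HW n hn) (by positivity)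
    · rw [hEd, sub_eq_add_neg, Real.rpow_add hn0, Real.rpow_one]
      ring
  refine le_trans ?_ hfin
  have h1 : C₁ / n ≤ C₁ / Real.log n :=
    div_le_div_of_nonneg_left hC₁.le hlogn ((Real.log_le_sub_one_of_pos hn0).trans (by linarith))
  have h2 : 0 ≤ Real.log N / Real.log n := by positivity
  rw [add_div, add_div]
  linarith

end GenericBias

/-! ### Sub-Gaussian random variables -/

section SubGaussian

variable {Ω : Type*} [MeasurableSpace Ω] {P : Measure Ω} {Y : Ω → ℝ} {L : ℝ}

/-- The bound `‖Y‖_{ψ₂} ≤ L`, in the form `𝔼 exp(Y²/L²) ≤ 2`. -/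
structure ExpSqBound (Y : Ω → ℝ) (L : ℝ) (P : Measure Ω) : Prop where
  measurable : Measurable Y
  pos : 0 < L
  integrable : Integrable (fun ω => Real.exp (Y ω ^ 2 / L ^ 2)) P
  integral_le : ∫ ω, Real.exp (Y ω ^ 2 / L ^ 2) ∂P ≤ 2

lemma expSqBound_of_lintegral (hY : Measurable Y) (hL : 0 < L)
    (h : ∫⁻ ω, ENNReal.ofReal (Real.exp (Y ω ^ 2 / L ^ 2)) ∂P ≤ 2) : ExpSqBound Y L P := by
  have hm : AEStronglyMeasurable (fun ω => Real.exp (Y ω ^ 2 / L ^ 2)) P := by fun_prop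
  have hnn : 0 ≤ᵐ[P] fun ω => Real.exp (Y ω ^ 2 / L ^ 2) := ae_of_all _ fun _ => (Real.exp_pos _).le
  refine ⟨hY, hL, ⟨hm, ?_⟩, ?_⟩
  · rw [hasFiniteIntegral_iff_ofReal hnn]
    exact lt_of_le_of_lt h (by norm_num)
  · rw [integral_eq_lintegral_of_nonneg_ae hnn hm]
    exact ENNReal.toReal_le_of_le_ofReal (by norm_num) (by simpa using h)

lemma expSqBound_of_psiTwoNorm_le {G : ℝ} (hG : 0 < G) (hY : Measurable Y)
    (h : psiTwoNorm Y P ≤ ENNReal.ofReal G) : ExpSqBound Y (2 * G) P := by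
  have h1 : psiTwoNorm Y P < ENNReal.ofReal (2 * G) :=
    lt_of_le_of_lt h ((ENNReal.ofReal_lt_ofReal_iff (by positivity)).2 (by linarith))
  obtain ⟨_, ⟨t, ht, rfl, hle⟩, hlt⟩ := sInf_lt_iff.1 h1
  have htG : t < 2 * G := (ENNReal.ofReal_lt_ofReal_iff (by positivity)).1 hlt
  refine expSqBound_of_lintegral hY (by positivity) (le_trans (lintegral_mono fun ω => ?_) hle)
  refine ENNReal.ofReal_le_ofReal (Real.exp_le_exp.2 ?_)
  exact div_le_div_of_nonneg_left (sq_nonneg _) (by positivity)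
    (pow_le_pow_left₀ ht.le htG.le 2)

lemma ExpSqBound.mono [IsFiniteMeasure P] (h : ExpSqBound Y L P) {L' : ℝ} (hL : L ≤ L') :
    ExpSqBound Y L' P := by
  have hL0 := h.pos
  have hle : ∀ ω, Real.exp (Y ω ^ 2 / L' ^ 2) ≤ Real.exp (Y ω ^ 2 / L ^ 2) := fun ω =>
    Real.exp_le_exp.2 (div_le_div_of_nonneg_left (sq_nonneg _) (by positivity)
      (pow_le_pow_left₀ hL0.le hL 2))
  have hY := h.measurable
  have hi : Integrable (fun ω => Real.exp (Y ω ^ 2 / L' ^ 2)) P := by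
    refine h.integrable.mono' (by fun_prop) (ae_of_all _ fun ω => ?_)
    rw [Real.norm_of_nonneg (Real.exp_pos _).le]
    exact hle ω
  exact ⟨h.measurable, hL0.trans_le hL, hi, (integral_mono hi h.integrable hle).trans h.integral_le⟩

lemma exp_mul_le_of_le_one {s v : ℝ} (hs : 0 ≤ s) (hs1 : s ≤ 1) :
    Real.exp (s * v) ≤ (1 - s) + s * Real.exp v := by
  have h := convexOn_exp.2 (Set.mem_univ 0) (Set.mem_univ v) (sub_nonneg.2 hs1) hs (by ring)
  simpa using h

/-- By convexity, `𝔼 exp(s Y²/L²) ≤ 1 + s` for `s ∈ [0, 1]`. -/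
lemma ExpSqBound.exp_mul [IsProbabilityMeasure P] (h : ExpSqBound Y L P) {s : ℝ} (hs : 0 ≤ s)
    (hs1 : s ≤ 1) : Integrable (fun ω => Real.exp (s * (Y ω ^ 2 / L ^ 2))) P ∧
      ∫ ω, Real.exp (s * (Y ω ^ 2 / L ^ 2)) ∂P ≤ 1 + s := by
  have hY := h.measurable
  have hi2 : Integrable (fun ω => (1 - s) + s * Real.exp (Y ω ^ 2 / L ^ 2)) P :=
    (integrable_const _).add (h.integrable.const_mul s)
  have hi : Integrable (fun ω => Real.exp (s * (Y ω ^ 2 / L ^ 2))) P := by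
    refine hi2.mono' (by fun_prop) (ae_of_all _ fun ω => ?_)
    rw [Real.norm_of_nonneg (Real.exp_pos _).le]
    exact exp_mul_le_of_le_one hs hs1
  refine ⟨hi, (integral_mono hi hi2 fun ω => exp_mul_le_of_le_one hs hs1).trans ?_⟩
  rw [integral_add (integrable_const _) (h.integrable.const_mul s), integral_const_mul]
  have := mul_le_mul_of_nonneg_left h.integral_le hs
  simp only [integral_const, probReal_univ, smul_eq_mul, one_mul]
  linarith

lemma ExpSqBound.fourth_moment_le [IsFiniteMeasure P] (h : ExpSqBound Y L P) :
    Integrable (fun ω => Y ω ^ 4) P ∧ ∫ ω, Y ω ^ 4 ∂P ≤ 4 * L ^ 4 := by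
  have hL := h.pos
  have hY := h.measurable
  have hle : ∀ ω, Y ω ^ 4 ≤ 2 * L ^ 4 * Real.exp (Y ω ^ 2 / L ^ 2) := fun ω => by
    have := Real.quadratic_le_exp_of_nonneg (x := Y ω ^ 2 / L ^ 2) (by positivity)
    have h1 : (Y ω ^ 2 / L ^ 2) ^ 2 / 2 ≤ Real.exp (Y ω ^ 2 / L ^ 2) := by
      have : 0 ≤ Y ω ^ 2 / L ^ 2 := by positivity
      linarith
    calc Y ω ^ 4 = 2 * L ^ 4 * ((Y ω ^ 2 / L ^ 2) ^ 2 / 2) := by field_simp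
      _ ≤ _ := mul_le_mul_of_nonneg_left h1 (by positivity)
  have hi : Integrable (fun ω => Y ω ^ 4) P := by
    refine (h.integrable.const_mul (2 * L ^ 4)).mono' (by fun_prop) (ae_of_all _ fun ω => ?_)
    rw [Real.norm_of_nonneg (by positivity)]
    exact hle ω
  refine ⟨hi, (integral_mono hi (h.integrable.const_mul _) hle).trans ?_⟩
  rw [integral_const_mul]
  have := mul_le_mul_of_nonneg_left h.integral_le (by positivity : 0 ≤ 2 * L ^ 4)
  linarith

lemma ExpSqBound.memLp [IsProbabilityMeasure P] (h : ExpSqBound Y L P) : MemLp Y 2 P := by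
  rw [memLp_two_iff_integrable_sq h.measurable.aestronglyMeasurable]
  have hY := h.measurable
  refine (h.fourth_moment_le.1.add (integrable_const 1)).mono' (by fun_prop) (ae_of_all _ fun ω => ?_)
  rw [Real.norm_of_nonneg (by positivity)]
  simp only [Pi.add_apply]
  nlinarith [sq_nonneg (Y ω ^ 2 - 1)]

lemma ExpSqBound.integrable_sq [IsProbabilityMeasure P] (h : ExpSqBound Y L P) :
    Integrable (fun ω => Y ω ^ 2) P := h.memLp.integrable_sq

lemma ExpSqBound.integrable_self [IsProbabilityMeasure P] (h : ExpSqBound Y L P) :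
    Integrable Y P := h.memLp.integrable (by norm_num)

lemma exp_le_self_add_exp_sq (x : ℝ) : Real.exp x ≤ x + Real.exp (x ^ 2) := by
  have h2 := Real.add_one_le_exp (x ^ 2)
  rcases le_or_gt |x| 1 with h | h
  · have := (abs_le.1 (Real.abs_exp_sub_one_sub_id_le h)).2
    linarith
  · rcases lt_abs.1 h with h | h
    · have : Real.exp x ≤ Real.exp (x ^ 2) := Real.exp_le_exp.2 (by nlinarith)
      linarith
    · have : Real.exp x ≤ 1 := Real.exp_le_one_iff.2 (by linarith)
      nlinarith

/-- A centered random variable with `𝔼 exp(Y²/L²) ≤ 2` has a sub-Gaussian moment generating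
function. -/
lemma ExpSqBound.hasSubgaussianMGF [IsProbabilityMeasure P] (h : ExpSqBound Y L P)
    (h0 : ∫ ω, Y ω ∂P = 0) : HasSubgaussianMGF Y (2 * ⟨L ^ 2, sq_nonneg L⟩) P := by
  have hL := h.pos
  have hY := h.measurable
  obtain ⟨hi2, hle2⟩ := h.exp_mul (s := 1 / 2) (by norm_num) (by norm_num)
  -- by Young's inequality
  have hyoung : ∀ t ω, Real.exp (t * Y ω)
      ≤ Real.exp (t ^ 2 * L ^ 2 / 2) * Real.exp (1 / 2 * (Y ω ^ 2 / L ^ 2)) := by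
    intro t ω
    rw [← Real.exp_add]
    refine Real.exp_le_exp.2 ?_
    have : 0 ≤ (t * L - Y ω / L) ^ 2 / 2 := by positivity
    have e : (t * L - Y ω / L) ^ 2 / 2
        = t ^ 2 * L ^ 2 / 2 + 1 / 2 * (Y ω ^ 2 / L ^ 2) - t * Y ω := by field_simp; ring
    linarith
  have hint : ∀ t, Integrable (fun ω => Real.exp (t * Y ω)) P := fun t => by
    refine (hi2.const_mul (Real.exp (t ^ 2 * L ^ 2 / 2))).mono' (by fun_prop)
      (ae_of_all _ fun ω => ?_)
    rw [Real.norm_of_nonneg (Real.exp_pos _).le]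
    exact hyoung t ω
  refine ⟨hint, fun t => ?_⟩
  have hc : ((2 * ⟨L ^ 2, sq_nonneg L⟩ : NNReal) : ℝ) * t ^ 2 / 2 = t ^ 2 * L ^ 2 := by
    change 2 * L ^ 2 * t ^ 2 / 2 = _
    ring
  rw [hc, mgf]
  rcases le_or_gt (t ^ 2 * L ^ 2) 1 with ht | ht
  · obtain ⟨hi3, hle3⟩ := h.exp_mul (s := t ^ 2 * L ^ 2) (by positivity) ht
    have e : ∀ ω, t ^ 2 * L ^ 2 * (Y ω ^ 2 / L ^ 2) = (t * Y ω) ^ 2 := fun ω => by field_simp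
    simp only [e] at hi3 hle3
    have hiY : Integrable (fun ω => t * Y ω) P := h.integrable_self.const_mul t
    calc _ ≤ ∫ ω, (t * Y ω + Real.exp ((t * Y ω) ^ 2)) ∂P :=
          integral_mono (hint t) (hiY.add hi3) fun ω => exp_le_self_add_exp_sq _
      _ = ∫ ω, Real.exp ((t * Y ω) ^ 2) ∂P := by
          rw [integral_add hiY hi3, integral_const_mul, h0, mul_zero, zero_add]
      _ ≤ 1 + t ^ 2 * L ^ 2 := hle3
      _ ≤ _ := by linarith [Real.add_one_le_exp (t ^ 2 * L ^ 2)]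
  · calc _ ≤ ∫ ω, Real.exp (t ^ 2 * L ^ 2 / 2) * Real.exp (1 / 2 * (Y ω ^ 2 / L ^ 2)) ∂P :=
          integral_mono (hint t) (hi2.const_mul _) fun ω => hyoung t ω
      _ ≤ Real.exp (t ^ 2 * L ^ 2 / 2) * Real.exp (t ^ 2 * L ^ 2 / 2) := by
          rw [integral_const_mul]
          refine mul_le_mul_of_nonneg_left (hle2.trans ?_) (Real.exp_pos _).le
          have := Real.add_one_le_exp (t ^ 2 * L ^ 2 / 2)
          linarith
      _ = _ := by rw [← Real.exp_add]; congr 1; ring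

lemma lintegral_exp_sq_gaussian :
    ∫⁻ g, ENNReal.ofReal (Real.exp (g ^ 2 / 4)) ∂(gaussianReal 0 1) ≤ 2 := by
  rw [gaussianReal_of_var_ne_zero _ one_ne_zero,
    lintegral_withDensity_eq_lintegral_mul _ (measurable_gaussianPDF 0 1) (by fun_prop)]
  have e : ∀ g : ℝ, (gaussianPDF 0 1 * fun g => ENNReal.ofReal (Real.exp (g ^ 2 / 4))) g
      = ENNReal.ofReal ((√(2 * Real.pi))⁻¹ * Real.exp (-(1 / 4) * g ^ 2)) := by
    intro g
    rw [Pi.mul_apply, gaussianPDF, gaussianPDFReal, ← ENNReal.ofReal_mul (by positivity), mul_assoc,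
      ← Real.exp_add]
    simp only [NNReal.coe_one, mul_one, sub_zero]
    congr 3
    ring
  simp only [e]
  rw [← ofReal_integral_eq_lintegral_ofReal ((integrable_exp_neg_mul_sq (by norm_num)).const_mul _)
    (ae_of_all _ fun g => by positivity), integral_const_mul, integral_gaussian]
  have : (√(2 * Real.pi))⁻¹ * √(Real.pi / (1 / 4)) ≤ 2 := by
    rw [inv_mul_le_iff₀ (by positivity)]
    have h2 : √(Real.pi / (1 / 4)) = √2 * √(2 * Real.pi) := by
      rw [← Real.sqrt_mul (by norm_num)]; congr 1; ring
    rw [h2, mul_comm]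
    refine mul_le_mul_of_nonneg_left ?_ (by positivity)
    exact Real.sqrt_le_iff.2 ⟨by norm_num, by norm_num⟩
  calc _ ≤ ENNReal.ofReal 2 := ENNReal.ofReal_le_ofReal this
    _ = 2 := by simp

/-- From the moment generating function back to `𝔼 exp(Y²/L²) ≤ 2`: the square in the exponent is
linearized by an independent Gaussian variable. -/
lemma expSqBound_of_hasSubgaussianMGF [IsProbabilityMeasure P] {c : NNReal} (hY : Measurable Y)
    (h : HasSubgaussianMGF Y c P) (hL : 0 < L) (hc : 4 * c ≤ L ^ 2) : ExpSqBound Y L P := by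
  refine expSqBound_of_lintegral hY hL ?_
  set s : ℝ := √2 / L with hs
  have hs2 : s ^ 2 = 2 / L ^ 2 := by rw [hs, div_pow, Real.sq_sqrt (by norm_num)]
  have hgauss : ∀ y : ℝ, ENNReal.ofReal (Real.exp (y ^ 2 / L ^ 2))
      = ∫⁻ g, ENNReal.ofReal (Real.exp (s * y * g)) ∂(gaussianReal 0 1) := by
    intro y
    rw [← ofReal_integral_eq_lintegral_ofReal
      (integrable_exp_mul_gaussianReal (s * y)) (ae_of_all _ fun g => (Real.exp_pos _).le)]
    have := congrFun (mgf_fun_id_gaussianReal (μ := 0) (v := 1)) (s * y)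
    rw [mgf] at this
    rw [this]
    congr 2
    rw [mul_pow, hs2]
    simp only [NNReal.coe_one]
    ring
  simp only [hgauss]
  rw [lintegral_lintegral_swap (by fun_prop)]
  refine le_trans (lintegral_mono fun g => ?_) lintegral_exp_sq_gaussian
  have e : ∀ ω, s * Y ω * g = (s * g) * Y ω := fun ω => by ring
  simp only [e]
  rw [← ofReal_integral_eq_lintegral_ofReal (h.integrable_exp_mul (s * g))
    (ae_of_all _ fun g => (Real.exp_pos _).le)]
  refine ENNReal.ofReal_le_ofReal ((h.mgf_le (s * g)).trans (Real.exp_le_exp.2 ?_))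
  rw [mul_pow, hs2]
  calc (c : ℝ) * (2 / L ^ 2 * g ^ 2) / 2 = (4 * c / L ^ 2) * (g ^ 2 / 4) := by ring
    _ ≤ 1 * (g ^ 2 / 4) :=
        mul_le_mul_of_nonneg_right ((div_le_one (by positivity)).2 hc) (by positivity)
    _ = _ := one_mul _

/-- A combination with square-summable weights of independent centered sub-Gaussian variables. -/
lemma expSqBound_sum [IsProbabilityMeasure P] {ι : Type*} {Z : ι → Ω → ℝ} {G : ℝ}
    (hG : 0 < G) (hind : iIndepFun Z P) (s : Finset ι) (hZ : ∀ i ∈ s, ExpSqBound (Z i) G P)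
    (h0 : ∀ i ∈ s, ∫ ω, Z i ω ∂P = 0) (w : ι → ℝ) (hw : ∑ i ∈ s, w i ^ 2 ≤ 1) {L : ℝ}
    (hL : 3 * G ≤ L) : ExpSqBound (fun ω => ∑ i ∈ s, w i * Z i ω) L P := by
  have hind' : iIndepFun (fun i ω => w i * Z i ω) P :=
    hind.comp (fun i y => w i * y) fun i => by fun_prop
  have hsub := HasSubgaussianMGF.sum_of_iIndepFun hind' (s := s)
    (c := fun i => ⟨w i ^ 2, sq_nonneg _⟩ * (2 * ⟨G ^ 2, sq_nonneg G⟩))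
    fun i hi => ((hZ i hi).hasSubgaussianMGF (h0 i hi)).const_mul (w i)
  refine expSqBound_of_hasSubgaussianMGF
    (Finset.measurable_fun_sum _ fun i hi => ((hZ i hi).measurable.const_mul _)) hsub
    (by linarith) ?_
  push_cast
  change 4 * ∑ i ∈ s, w i ^ 2 * (2 * G ^ 2) ≤ L ^ 2
  rw [← Finset.sum_mul]
  nlinarith [mul_le_mul_of_nonneg_right hw (sq_nonneg G), sq_nonneg G]

/-- The sum of two (possibly dependent) sub-Gaussian variables. -/
lemma ExpSqBound.add [IsProbabilityMeasure P] {Y' : Ω → ℝ} (h : ExpSqBound Y L P)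
    (h' : ExpSqBound Y' L P) : ExpSqBound (fun ω => Y ω + Y' ω) (2 * L) P := by
  have hL := h.pos
  have hY := h.measurable
  have hY' := h'.measurable
  have hle : ∀ ω, Real.exp ((Y ω + Y' ω) ^ 2 / (2 * L) ^ 2)
      ≤ 1 / 2 * Real.exp (Y ω ^ 2 / L ^ 2) + 1 / 2 * Real.exp (Y' ω ^ 2 / L ^ 2) := by
    intro ω
    have h1 := convexOn_exp.2 (Set.mem_univ (Y ω ^ 2 / L ^ 2)) (Set.mem_univ (Y' ω ^ 2 / L ^ 2))
      (by norm_num : (0 : ℝ) ≤ 1 / 2) (by norm_num : (0 : ℝ) ≤ 1 / 2) (by norm_num)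
    simp only [smul_eq_mul] at h1
    refine le_trans (Real.exp_le_exp.2 ?_) h1
    have : 0 ≤ ((Y ω - Y' ω) / (2 * L)) ^ 2 := sq_nonneg _
    have e : 1 / 2 * (Y ω ^ 2 / L ^ 2) + 1 / 2 * (Y' ω ^ 2 / L ^ 2) - (Y ω + Y' ω) ^ 2 / (2 * L) ^ 2
        = ((Y ω - Y' ω) / (2 * L)) ^ 2 := by field_simp; ring
    linarith
  have hi2 := (h.integrable.const_mul (1 / 2)).add (h'.integrable.const_mul (1 / 2))
  have hi : Integrable (fun ω => Real.exp ((Y ω + Y' ω) ^ 2 / (2 * L) ^ 2)) P := by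
    refine hi2.mono' (by fun_prop) (ae_of_all _ fun ω => ?_)
    rw [Real.norm_of_nonneg (Real.exp_pos _).le]
    exact hle ω
  refine ⟨by fun_prop, by positivity, hi, (integral_mono hi hi2 hle).trans ?_⟩
  rw [integral_add' (h.integrable.const_mul _) (h'.integrable.const_mul _), integral_const_mul,
    integral_const_mul]
  have := h.integral_le
  have := h'.integral_le
  linarith

lemma ExpSqBound.const_mul [IsProbabilityMeasure P] (h : ExpSqBound Y L P) {w : ℝ}
    (hw : w ^ 2 ≤ 1) : ExpSqBound (fun ω => w * Y ω) L P := by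
  have hY := h.measurable
  have hL := h.pos
  have hle : ∀ ω, Real.exp ((w * Y ω) ^ 2 / L ^ 2) ≤ Real.exp (Y ω ^ 2 / L ^ 2) := fun ω => by
    refine Real.exp_le_exp.2 (div_le_div_of_nonneg_right ?_ (by positivity))
    rw [mul_pow]
    exact mul_le_of_le_one_left (sq_nonneg _) hw
  have hi : Integrable (fun ω => Real.exp ((w * Y ω) ^ 2 / L ^ 2)) P := by
    refine h.integrable.mono' (by fun_prop) (ae_of_all _ fun ω => ?_)
    rw [Real.norm_of_nonneg (Real.exp_pos _).le]
    exact hle ω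
  exact ⟨by fun_prop, h.pos, hi, (integral_mono hi h.integrable hle).trans h.integral_le⟩

/-- A combination with square-summable weights of independent sub-Gaussian variables, at most one
of which is not centered. -/
lemma expSqBound_sum_of_subsingleton [IsProbabilityMeasure P] {ι : Type*} {Z : ι → Ω → ℝ} {G : ℝ}
    (hG : 0 < G) (hind : iIndepFun Z P) (s : Finset ι) (hZ : ∀ i ∈ s, ExpSqBound (Z i) G P)
    (h0 : ∀ i ∈ s, ∀ j ∈ s, i ≠ j → ∫ ω, Z i ω ∂P = 0 ∨ ∫ ω, Z j ω ∂P = 0) (w : ι → ℝ)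
    (hw : ∑ i ∈ s, w i ^ 2 ≤ 1) : ExpSqBound (fun ω => ∑ i ∈ s, w i * Z i ω) (6 * G) P := by
  classical
  by_cases hall : ∀ i ∈ s, ∫ ω, Z i ω ∂P = 0
  · exact expSqBound_sum hG hind s hZ hall w hw (by linarith)
  push Not at hall
  obtain ⟨i₀, hi₀, hne⟩ := hall
  have hw' : w i₀ ^ 2 + ∑ i ∈ s.erase i₀, w i ^ 2 ≤ 1 := by
    rwa [Finset.add_sum_erase s (fun i => w i ^ 2) hi₀]
  have hs0 : 0 ≤ ∑ i ∈ s.erase i₀, w i ^ 2 := Finset.sum_nonneg fun _ _ => sq_nonneg _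
  have h1 := expSqBound_sum hG hind (s.erase i₀) (fun i hi => hZ i (Finset.mem_of_mem_erase hi))
    (fun i hi => (h0 i (Finset.mem_of_mem_erase hi) i₀ hi₀
      (Finset.ne_of_mem_erase hi)).resolve_right hne) w (by nlinarith [sq_nonneg (w i₀)])
      (le_refl (3 * G))
  have h2 := (((hZ i₀ hi₀).const_mul (w := w i₀) (by linarith)).mono
    (by linarith : G ≤ 3 * G)).add h1
  have e : (fun ω => ∑ i ∈ s, w i * Z i ω)
      = fun ω => w i₀ * Z i₀ ω + ∑ i ∈ s.erase i₀, w i * Z i ω := by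
    funext ω
    rw [Finset.add_sum_erase s (fun i => w i * Z i ω) hi₀]
  rw [e, show 6 * G = 2 * (3 * G) by ring]
  exact h2

/-- The Laplace transform of the square of a normalized variable with bounded fourth moment. -/
lemma ExpSqBound.integral_exp_neg_sq_le [IsProbabilityMeasure P] (h : ExpSqBound Y L P)
    (h1 : ∫ ω, Y ω ^ 2 ∂P = 1) {s : ℝ} (hs : 0 ≤ s) (hsL : s * (4 * L ^ 4) ≤ 1) :
    ∫ ω, Real.exp (-s * Y ω ^ 2) ∂P ≤ Real.exp (-(s / 2)) := by
  have hY := h.measurable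
  obtain ⟨h4, h4'⟩ := h.fourth_moment_le
  have h2 := h.integrable_sq
  have hle : ∀ ω, Real.exp (-s * Y ω ^ 2) ≤ 1 - s * Y ω ^ 2 + s ^ 2 / 2 * Y ω ^ 4 := by
    intro ω
    have hu : 0 ≤ s * Y ω ^ 2 := by positivity
    have := Real.quadratic_le_exp_of_nonneg hu
    have h3 : Real.exp (-s * Y ω ^ 2) * Real.exp (s * Y ω ^ 2) = 1 := by
      rw [← Real.exp_add]; simp
    have hpos := Real.exp_pos (-s * Y ω ^ 2)
    have e : s ^ 2 / 2 * Y ω ^ 4 = (s * Y ω ^ 2) ^ 2 / 2 := by ring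
    rw [e]
    set u := s * Y ω ^ 2
    -- `(1 - u + u²/2) (1 + u + u²/2) = 1 + u⁴/4`
    by_contra hcon
    push Not at hcon
    have h5 : 0 < 1 + u + u ^ 2 / 2 := by positivity
    have h6 := mul_lt_mul_of_pos_right hcon h5
    have h7 := mul_le_mul_of_nonneg_left this hpos.le
    have h8 : 0 ≤ u ^ 4 := by positivity
    nlinarith
  have hi3 : Integrable (fun ω => 1 - s * Y ω ^ 2) P := (integrable_const 1).sub (h2.const_mul s)
  have hi2 : Integrable (fun ω => 1 - s * Y ω ^ 2 + s ^ 2 / 2 * Y ω ^ 4) P :=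
    hi3.add (h4.const_mul _)
  have hi : Integrable (fun ω => Real.exp (-s * Y ω ^ 2)) P := by
    refine (integrable_const (1 : ℝ)).mono' (by fun_prop) (ae_of_all _ fun ω => ?_)
    rw [Real.norm_of_nonneg (Real.exp_pos _).le]
    refine Real.exp_le_one_iff.2 ?_
    have : 0 ≤ s * Y ω ^ 2 := by positivity
    linarith
  calc _ ≤ ∫ ω, (1 - s * Y ω ^ 2 + s ^ 2 / 2 * Y ω ^ 4) ∂P := integral_mono hi hi2 hle
    _ = 1 - s + s ^ 2 / 2 * ∫ ω, Y ω ^ 4 ∂P := by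
        rw [integral_add hi3 (h4.const_mul _),
          integral_sub (integrable_const 1) (h2.const_mul s), integral_const_mul,
          integral_const_mul, h1]
        simp
    _ ≤ 1 - s / 2 := by
        have := mul_le_mul_of_nonneg_left h4' (by positivity : 0 ≤ s ^ 2 / 2)
        nlinarith
    _ ≤ _ := by linarith [Real.add_one_le_exp (-(s / 2))]

/-- The lower tail of a sum of squares of independent normalized variables. -/
lemma measure_sum_sq_le_le [IsProbabilityMeasure P] {ι : Type*} {Y : ι → Ω → ℝ}
    (hind : iIndepFun Y P) (s : Finset ι) (hY : ∀ i, Measurable (Y i))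
    (hs : ∀ i ∈ s, ExpSqBound (Y i) L P) (h1 : ∀ i ∈ s, ∫ ω, Y i ω ^ 2 ∂P = 1) (hL : 0 < L) :
    P {ω | ∑ i ∈ s, Y i ω ^ 2 ≤ s.card / 4}
      ≤ ENNReal.ofReal (Real.exp (-(s.card / (16 * L ^ 4)))) := by
  set u : ℝ := 1 / (4 * L ^ 4) with hu
  have hind' : iIndepFun (fun i ω => Y i ω ^ 2) P :=
    hind.comp (fun _ y => y ^ 2) fun _ => by fun_prop
  have hmgf := hind'.mgf_sum (t := -u) (fun i => by have := hY i; fun_prop) s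
  have hm : ∀ i ∈ s, mgf (fun ω => Y i ω ^ 2) P (-u) ≤ Real.exp (-(u / 2)) := fun i hi =>
    (hs i hi).integral_exp_neg_sq_le (h1 i hi) (by positivity) (by rw [hu]; field_simp; rfl)
  have hu0 : 0 < u := by positivity
  have hint : Integrable (fun ω => Real.exp (-u * (∑ i ∈ s, fun ω => Y i ω ^ 2) ω)) P := by
    refine (integrable_const (1 : ℝ)).mono' ?_ (ae_of_all _ fun ω => ?_)
    · simp only [Finset.sum_apply]
      exact (by fun_prop : Measurable _).aestronglyMeasurable
    · rw [Real.norm_of_nonneg (Real.exp_pos _).le]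
      refine Real.exp_le_one_iff.2 ?_
      rw [Finset.sum_apply]
      have : 0 ≤ ∑ i ∈ s, Y i ω ^ 2 := Finset.sum_nonneg fun _ _ => sq_nonneg _
      nlinarith
  have h := measure_le_le_exp_mul_mgf (s.card / 4 : ℝ) (by linarith : -u ≤ 0) hint
  rw [← ofReal_measureReal]
  refine ENNReal.ofReal_le_ofReal ?_
  simp only [Finset.sum_apply] at h
  refine h.trans ?_
  rw [hmgf]
  calc _ ≤ Real.exp (- -u * (s.card / 4)) * ∏ _i ∈ s, Real.exp (-(u / 2)) :=
        mul_le_mul_of_nonneg_left (Finset.prod_le_prod (fun i _ => mgf_nonneg) hm)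
          (Real.exp_pos _).le
    _ = _ := by
        rw [Finset.prod_const, ← Real.exp_nat_mul, ← Real.exp_add, hu]
        congr 1
        field_simp
        ring

/-- The upper tail of a weighted sum of squares of independent sub-Gaussian variables. -/
lemma measure_le_sum_sq_le [IsProbabilityMeasure P] {ι : Type*} {Y : ι → Ω → ℝ}
    (hind : iIndepFun Y P) (s : Finset ι) (hY : ∀ i, Measurable (Y i))
    (hs : ∀ i ∈ s, ExpSqBound (Y i) L P) {lam : ι → ℝ} {Λ : ℝ} (hΛ : 0 < Λ)
    (hlam : ∀ i ∈ s, 0 ≤ lam i ∧ lam i ≤ Λ) (hL : 0 < L) (T : ℝ) :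
    P {ω | T ≤ ∑ i ∈ s, lam i * Y i ω ^ 2}
      ≤ ENNReal.ofReal (Real.exp (-(T / (Λ * L ^ 2)) + (∑ i ∈ s, lam i) / Λ)) := by
  set u : ℝ := 1 / (Λ * L ^ 2) with hu
  have hu0 : 0 < u := by positivity
  have hind' : iIndepFun (fun i ω => lam i * Y i ω ^ 2) P :=
    hind.comp (fun i y => lam i * y ^ 2) fun _ => by fun_prop
  have e : ∀ i ω, u * (lam i * Y i ω ^ 2) = (lam i / Λ) * (Y i ω ^ 2 / L ^ 2) := fun i ω => by
    rw [hu]; field_simp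
  have hexp : ∀ i ∈ s, Integrable (fun ω => Real.exp (u * (lam i * Y i ω ^ 2))) P ∧
      mgf (fun ω => lam i * Y i ω ^ 2) P u ≤ Real.exp (lam i / Λ) := by
    intro i hi
    obtain ⟨ha, hb⟩ := (hs i hi).exp_mul (s := lam i / Λ) (div_nonneg (hlam i hi).1 hΛ.le)
      ((div_le_one hΛ).2 (hlam i hi).2)
    rw [mgf]
    simp only [e]
    exact ⟨ha, hb.trans (by linarith [Real.add_one_le_exp (lam i / Λ)])⟩
  have hm : ∀ i, Measurable fun ω => lam i * Y i ω ^ 2 := fun i => by have := hY i; fun_prop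
  have hmgf := hind'.mgf_sum (t := u) hm s
  have hint := hind'.integrable_exp_mul_sum (t := u) hm (s := s) fun i hi => (hexp i hi).1
  have h := measure_ge_le_exp_mul_mgf T hu0.le hint
  rw [← ofReal_measureReal]
  refine ENNReal.ofReal_le_ofReal ?_
  simp only [Finset.sum_apply] at h
  refine h.trans ?_
  rw [hmgf]
  calc _ ≤ Real.exp (-u * T) * ∏ i ∈ s, Real.exp (lam i / Λ) :=
        mul_le_mul_of_nonneg_left (Finset.prod_le_prod (fun i _ => mgf_nonneg)
          fun i hi => (hexp i hi).2) (Real.exp_pos _).le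
    _ = _ := by
        rw [← Real.exp_sum, ← Real.exp_add, hu, Finset.sum_div]
        congr 2
        ring

end SubGaussian

/-! ### Nets, and extreme singular values of random matrices -/

section Nets

variable {E : Type*} [NormedAddCommGroup E] [NormedSpace ℝ E] [FiniteDimensional ℝ E]

lemma exists_half_net : ∃ T : Finset E, T.card ≤ 5 ^ Module.finrank ℝ E ∧ (∀ t ∈ T, ‖t‖ ≤ 1) ∧
    ∀ x : E, ‖x‖ ≤ 1 → ∃ t ∈ T, ‖x - t‖ ≤ 1 / 2 := by
  classical
  -- a `1 / 2`-separated subset of the unit ball of maximal cardinality is a net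
  set S : Set ℕ := {m | ∃ T : Finset E, T.card = m ∧ (∀ t ∈ T, ‖t‖ ≤ 1) ∧
    ∀ t ∈ T, ∀ u ∈ T, t ≠ u → 1 / 2 ≤ ‖t - u‖} with hS
  have hcard : ∀ T : Finset E, (∀ t ∈ T, ‖t‖ ≤ 1) → (∀ t ∈ T, ∀ u ∈ T, t ≠ u → 1 / 2 ≤ ‖t - u‖) →
      T.card ≤ 5 ^ Module.finrank ℝ E := by
    intro T h1 h2
    have hinj : Function.Injective fun t : E => (2 : ℝ) • t := smul_right_injective E two_ne_zero
    rw [← Finset.card_image_of_injective T hinj]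
    refine Besicovitch.card_le_of_separated _ (fun c hc => ?_) fun c hc d hd hcd => ?_
    · obtain ⟨t, ht, rfl⟩ := Finset.mem_image.1 hc
      rw [norm_smul, Real.norm_ofNat]
      linarith [h1 t ht]
    · obtain ⟨t, ht, rfl⟩ := Finset.mem_image.1 hc
      obtain ⟨u, hu, rfl⟩ := Finset.mem_image.1 hd
      have := h2 t ht u hu fun h => hcd (by rw [h])
      rw [← smul_sub, norm_smul, Real.norm_ofNat]
      linarith
  have hbdd : BddAbove S := ⟨5 ^ Module.finrank ℝ E, by rintro m ⟨T, rfl, h1, h2⟩; exact hcard T h1 h2⟩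
  obtain ⟨T, hTc, h1, h2⟩ := Nat.sSup_mem (⟨0, ∅, by simp⟩ : S.Nonempty) hbdd
  refine ⟨T, hcard T h1 h2, h1, fun x hx => ?_⟩
  by_contra hcon
  push Not at hcon
  have hxT : x ∉ T := fun h => by have := hcon x h; rw [sub_self, norm_zero] at this; linarith
  have hmem : T.card + 1 ∈ S := by
    refine ⟨insert x T, Finset.card_insert_of_notMem hxT, fun t ht => ?_, fun t ht u hu htu => ?_⟩
    · rcases Finset.mem_insert.1 ht with rfl | ht
      · exact hx
      · exact h1 t ht
    · rcases Finset.mem_insert.1 ht with ht | ht <;> rcases Finset.mem_insert.1 hu with hu | hu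
      · exact absurd (ht.trans hu.symm) htu
      · rw [ht]; exact (hcon u hu).le
      · rw [hu, norm_sub_rev]; exact (hcon t ht).le
      · exact h2 t ht u hu htu
  have := le_csSup hbdd hmem
  omega

/-- A `2⁻ʲ`-net of the unit ball, by iterating the case `j = 1`. -/
lemma exists_net (j : ℕ) : ∃ T : Finset E, T.card ≤ 5 ^ (j * Module.finrank ℝ E) ∧
    ∀ x : E, ‖x‖ ≤ 1 → ∃ t ∈ T, ‖x - t‖ ≤ (1 / 2) ^ j := by
  classical
  obtain ⟨T₁, hc₁, -, h₁⟩ := exists_half_net (E := E)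
  induction j with
  | zero => exact ⟨{0}, by simp, fun x hx => ⟨0, by simp, by simpa using hx⟩⟩
  | succ j ih =>
    obtain ⟨T, hc, hT⟩ := ih
    refine ⟨Finset.image₂ (fun t u => t + ((1 : ℝ) / 2) ^ j • u) T T₁,
      (Finset.card_image₂_le _ _ _).trans ?_, fun x hx => ?_⟩
    · rw [Nat.succ_mul, pow_add]
      exact Nat.mul_le_mul hc hc₁
    · obtain ⟨t, ht, htx⟩ := hT x hx
      have hp : (0 : ℝ) < (1 / 2) ^ j := by positivity
      obtain ⟨u, hu, hux⟩ := h₁ ((((1 : ℝ) / 2) ^ j)⁻¹ • (x - t)) (by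
        rw [norm_smul, Real.norm_of_nonneg (by positivity), inv_mul_le_iff₀ hp]
        linarith)
      refine ⟨_, Finset.mem_image₂_of_mem ht hu, ?_⟩
      have e : x - (t + ((1 : ℝ) / 2) ^ j • u)
          = ((1 : ℝ) / 2) ^ j • ((((1 : ℝ) / 2) ^ j)⁻¹ • (x - t) - u) := by
        rw [smul_sub, smul_inv_smul₀ hp.ne']; abel
      rw [e, norm_smul, Real.norm_of_nonneg hp.le, pow_succ]
      exact mul_le_mul_of_nonneg_left hux hp.le

variable {F : Type*} [NormedAddCommGroup F] [NormedSpace ℝ F]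

/-- A half-net controls the operator norm up to a factor of `2`. -/
lemma opNorm_le_of_half_net (A : E →L[ℝ] F) {T : Finset E}
    (hT : ∀ x : E, ‖x‖ ≤ 1 → ∃ t ∈ T, ‖x - t‖ ≤ 1 / 2) {B : ℝ} (hB : ∀ t ∈ T, ‖A t‖ ≤ B) :
    ‖A‖ ≤ 2 * B := by
  have hB0 : 0 ≤ B := by
    obtain ⟨t, ht, -⟩ := hT 0 (by simp)
    exact (norm_nonneg _).trans (hB t ht)
  have h : ‖A‖ ≤ B + ‖A‖ / 2 := by
    refine A.opNorm_le_of_unit_norm (by positivity) fun x hx => ?_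
    obtain ⟨t, ht, htx⟩ := hT x hx.le
    calc ‖A x‖ = ‖A t + A (x - t)‖ := by rw [← map_add]; congr 2; abel
      _ ≤ B + ‖A‖ * (1 / 2) := (norm_add_le _ _).trans
          (add_le_add (hB t ht) ((A.le_opNorm _).trans
            (mul_le_mul_of_nonneg_left htx (norm_nonneg _))))
      _ = _ := by ring
  linarith

/-- A net which is fine relative to the operator norm controls the lower bound of an operator. -/
lemma le_norm_of_net (A : E →L[ℝ] F) {T : Finset E} {j : ℕ} (hj : 1 ≤ j)
    (hT : ∀ x : E, ‖x‖ ≤ 1 → ∃ t ∈ T, ‖x - t‖ ≤ (1 / 2) ^ j) {b : ℝ} (hb : 0 ≤ b)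
    (hup : ‖A‖ * (1 / 2) ^ j ≤ b / 4) (hlow : ∀ t ∈ T, b * ‖t‖ ≤ ‖A t‖) (x : E) :
    b / 4 * ‖x‖ ≤ ‖A x‖ := by
  have key : ∀ x : E, ‖x‖ = 1 → b / 4 ≤ ‖A x‖ := by
    intro x hx
    obtain ⟨t, ht, htx⟩ := hT x hx.le
    have hhalf : ((1 : ℝ) / 2) ^ j ≤ 1 / 2 := by
      simpa using pow_le_pow_of_le_one (by norm_num : (0 : ℝ) ≤ 1 / 2) (by norm_num) hj
    have h1 : ‖x‖ - ‖t‖ ≤ ‖x - t‖ := norm_sub_norm_le _ _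
    have h2 : b * (1 / 2) ≤ b * ‖t‖ := mul_le_mul_of_nonneg_left (by linarith) hb
    have h3 : ‖A t‖ ≤ ‖A x‖ + ‖A (x - t)‖ := by
      have e : A t = A x - A (x - t) := by rw [← map_sub]; congr 1; abel
      rw [e]; exact norm_sub_le _ _
    have h4 : ‖A (x - t)‖ ≤ b / 4 :=
      (A.le_opNorm _).trans ((mul_le_mul_of_nonneg_left htx (norm_nonneg _)).trans hup)
    linarith [hlow t ht]
  rcases eq_or_ne x 0 with rfl | hx
  · simp
  have hx0 : 0 < ‖x‖ := norm_pos_iff.2 hx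
  have h := key (‖x‖⁻¹ • x) (by rw [norm_smul, norm_inv, norm_norm, inv_mul_cancel₀ hx0.ne'])
  rw [map_smul, norm_smul, norm_inv, norm_norm, inv_mul_eq_div, le_div_iff₀ hx0] at h
  exact h

end Nets

section RandomMatrix

variable {Ω : Type} [MeasurableSpace Ω] {P : Measure Ω} [IsProbabilityMeasure P]
  {ι κ : Type} [Fintype κ] {ξ : ι → κ → Ω → ℝ} {L : ℝ}

/-- The operator with rows `√(lam l) ξ l`, `l ∈ s`. -/
def rowOperator (s : Finset ι) (lam : ι → ℝ) (ξ : ι → κ → ℝ) :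
    EuclideanSpace ℝ κ →L[ℝ] EuclideanSpace ℝ s :=
  LinearMap.toContinuousLinearMap
    { toFun := fun v => WithLp.toLp 2 fun l : s => √(lam l) * ∑ k, v k * ξ l k
      map_add' := fun v w => by
        ext l
        simp only [PiLp.add_apply, add_mul, Finset.sum_add_distrib, mul_add]
      map_smul' := fun a v => by
        ext l
        simp only [PiLp.smul_apply, smul_eq_mul, RingHom.id_apply, mul_assoc]
        rw [← Finset.mul_sum]; ring }

lemma norm_rowOperator_sq (s : Finset ι) {lam : ι → ℝ} (hlam : ∀ l ∈ s, 0 ≤ lam l)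
    (ξ : ι → κ → ℝ) (v : EuclideanSpace ℝ κ) :
    ‖rowOperator s lam ξ v‖ ^ 2 = ∑ l ∈ s, lam l * (∑ k, v k * ξ l k) ^ 2 := by
  rw [EuclideanSpace.real_norm_sq_eq, ← Finset.sum_coe_sort s]
  refine Finset.sum_congr rfl fun l _ => ?_
  have : (rowOperator s lam ξ v) l = √(lam l) * ∑ k, v k * ξ l k := rfl
  rw [this, mul_pow, Real.sq_sqrt (hlam l l.2)]

/-- The largest singular value of a weighted random matrix with independent sub-Gaussian rows. -/
lemma measure_not_sum_sq_le (hm : ∀ l k, Measurable (ξ l k))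
    (hind : ∀ v : κ → ℝ, iIndepFun (fun l ω => ∑ k, v k * ξ l k ω) P) (s : Finset ι)
    (hexp : ∀ l ∈ s, ∀ v : κ → ℝ, ∑ k, v k ^ 2 ≤ 1 → ExpSqBound (fun ω => ∑ k, v k * ξ l k ω) L P)
    (hL : 0 < L) {lam : ι → ℝ} {Λ : ℝ} (hΛ : 0 < Λ) (hlam : ∀ l ∈ s, 0 ≤ lam l ∧ lam l ≤ Λ)
    (T : ℝ) :
    P {ω | ¬ ∀ v : κ → ℝ, ∑ l ∈ s, lam l * (∑ k, v k * ξ l k ω) ^ 2 ≤ 4 * T * ∑ k, v k ^ 2}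
      ≤ ENNReal.ofReal (5 ^ Fintype.card κ
        * Real.exp (-(T / (Λ * L ^ 2)) + (∑ l ∈ s, lam l) / Λ)) := by
  obtain ⟨net, hc, hb, hnet⟩ := exists_half_net (E := EuclideanSpace ℝ κ)
  rw [finrank_euclideanSpace] at hc
  set bad : EuclideanSpace ℝ κ → Set Ω := fun v =>
    {ω | T ≤ ∑ l ∈ s, lam l * (∑ k, v k * ξ l k ω) ^ 2} with hbad
  have hsub : {ω | ¬ ∀ v : κ → ℝ, ∑ l ∈ s, lam l * (∑ k, v k * ξ l k ω) ^ 2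
      ≤ 4 * T * ∑ k, v k ^ 2} ⊆ ⋃ v ∈ net, bad v := by
    intro ω hω
    by_contra hcon
    refine hω fun v => ?_
    simp only [Set.mem_iUnion, not_exists, hbad, Set.mem_ofPred_eq, not_le] at hcon
    have hn := norm_rowOperator_sq s (fun l hl => (hlam l hl).1) (fun l k => ξ l k ω)
    have hT0 : 0 ≤ T := by
      obtain ⟨t, ht, -⟩ := hnet 0 (by simp)
      have := hcon t ht
      rw [← hn t] at this
      exact (sq_nonneg _).trans this.le
    have hop := opNorm_le_of_half_net (rowOperator s lam fun l k => ξ l k ω) hnet (B := √T)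
      fun t ht => by
        rw [← Real.sqrt_sq (norm_nonneg (rowOperator s lam _ t)), hn]
        exact Real.sqrt_le_sqrt (hcon t ht).le
    have h1 := ((rowOperator s lam fun l k => ξ l k ω).le_opNorm (WithLp.toLp 2 v)).trans
      (mul_le_mul_of_nonneg_right hop (norm_nonneg _))
    have h2 := pow_le_pow_left₀ (norm_nonneg _) h1 2
    rw [hn, mul_pow, mul_pow, Real.sq_sqrt hT0, EuclideanSpace.real_norm_sq_eq] at h2
    norm_num at h2
    exact h2
  refine (measure_mono hsub).trans ((measure_biUnion_finset_le _ _).trans ?_)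
  have hone : ∀ v ∈ net, P (bad v)
      ≤ ENNReal.ofReal (Real.exp (-(T / (Λ * L ^ 2)) + (∑ l ∈ s, lam l) / Λ)) := by
    intro v hv
    refine measure_le_sum_sq_le (hind v) s (fun l => by
      have := hm l; fun_prop) (fun l hl => hexp l hl v ?_) hΛ hlam hL T
    rw [← EuclideanSpace.real_norm_sq_eq]
    exact pow_le_one₀ (norm_nonneg _) (hb v hv)
  refine (Finset.sum_le_card_nsmul _ _ _ hone).trans ?_
  rw [nsmul_eq_mul, ENNReal.ofReal_mul (by positivity), ← ENNReal.ofReal_natCast net.card]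
  gcongr
  exact_mod_cast hc

/-- The smallest singular value of a tall random matrix with independent isotropic sub-Gaussian
rows. -/
lemma exists_measure_not_le_sum_sq (hL : 0 < L) :
    ∃ C c : ℝ, 0 < C ∧ 0 < c ∧ ∀ {Ω : Type} [MeasurableSpace Ω] {P : Measure Ω}
      [IsProbabilityMeasure P] {ι κ : Type} [Fintype κ] {ξ : ι → κ → Ω → ℝ},
      (∀ l k, Measurable (ξ l k)) →
      (∀ v : κ → ℝ, iIndepFun (fun l ω => ∑ k, v k * ξ l k ω) P) → ∀ s : Finset ι,
      (∀ l ∈ s, ∀ v : κ → ℝ, ∑ k, v k ^ 2 ≤ 1 → ExpSqBound (fun ω => ∑ k, v k * ξ l k ω) L P) →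
      (∀ l ∈ s, ∀ v : κ → ℝ, ∑ k, v k ^ 2 = 1 → ∫ ω, (∑ k, v k * ξ l k ω) ^ 2 ∂P = 1) →
      C * Fintype.card κ ≤ (s.card : ℝ) →
      P {ω | ¬ ∀ v : κ → ℝ, (s.card : ℝ) / 64 * ∑ k, v k ^ 2 ≤ ∑ l ∈ s, (∑ k, v k * ξ l k ω) ^ 2}
        ≤ ENNReal.ofReal (2 * Real.exp (-(c * s.card))) := by
  -- a net of mesh `2 ^ (-(j + 1))` is fine relative to the bound `√(12 L² N)` for the operator norm
  obtain ⟨j, hj⟩ := pow_unbounded_of_one_lt (768 * L ^ 2) (by norm_num : (1 : ℝ) < 4)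
  set c : ℝ := min 1 (1 / (32 * L ^ 4)) with hc
  have hc0 : 0 < c := by positivity
  set j' := j + 1 with hj'
  have hlog5 : 0 < Real.log 5 := Real.log_pos (by norm_num)
  refine ⟨j' * Real.log 5 / c, c, by positivity, hc0, ?_⟩
  intro Ω _ P _ ι κ _ ξ hm hind s hexp hsq hCs
  set N : ℝ := (s.card : ℝ) with hN
  have hN0 : 0 ≤ N := Nat.cast_nonneg _
  set d := Fintype.card κ with hd
  have hpow : ∀ i : ℕ, i ≤ j' → (5 : ℝ) ^ (i * d) ≤ Real.exp (c * N) := by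
    intro i hi
    rw [← Real.log_le_iff_le_exp (by positivity), Real.log_pow]
    have h1 : (i : ℝ) ≤ j' := by exact_mod_cast hi
    have h2 : j' * Real.log 5 * d ≤ c * N := by
      have := mul_le_mul_of_nonneg_left hCs hc0.le
      have e : c * (j' * Real.log 5 / c * d) = j' * Real.log 5 * d := by field_simp
      linarith
    refine le_trans ?_ h2
    push_cast
    have h3 : 0 ≤ Real.log 5 * d := by positivity
    nlinarith [mul_le_mul_of_nonneg_right h1 h3]
  obtain ⟨net, hcard, hnet⟩ := exists_net (E := EuclideanSpace ℝ κ) j'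
  rw [finrank_euclideanSpace] at hcard
  set bad : EuclideanSpace ℝ κ → Set Ω := fun t =>
    {ω | ∑ l ∈ s, (∑ k, (‖t‖⁻¹ * t k) * ξ l k ω) ^ 2 ≤ N / 4} with hbad
  classical
  have hup := measure_not_sum_sq_le hm hind s hexp hL (lam := fun _ => 1) one_pos
    (fun _ _ => ⟨zero_le_one, le_rfl⟩) (3 * L ^ 2 * N)
  simp only [one_mul] at hup
  have hsub : {ω | ¬ ∀ v : κ → ℝ, N / 64 * ∑ k, v k ^ 2 ≤ ∑ l ∈ s, (∑ k, v k * ξ l k ω) ^ 2} ⊆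
      {ω | ¬ ∀ v : κ → ℝ, ∑ l ∈ s, (∑ k, v k * ξ l k ω) ^ 2
        ≤ 4 * (3 * L ^ 2 * N) * ∑ k, v k ^ 2} ∪ ⋃ t ∈ net.filter (· ≠ 0), bad t := by
    intro ω hω
    by_contra hcon
    rw [Set.mem_union, not_or] at hcon
    obtain ⟨hc1, hc2⟩ := hcon
    refine hω fun v => ?_
    simp only [Set.mem_ofPred_eq, not_not] at hc1
    simp only [Set.mem_iUnion, not_exists, hbad, Set.mem_ofPred_eq, not_le, Finset.mem_filter,
      and_imp] at hc2
    have hn := norm_rowOperator_sq s (lam := fun _ => 1) (fun l hl => zero_le_one)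
      (fun l k => ξ l k ω)
    simp only [one_mul] at hn
    set A := rowOperator s (fun _ => 1) fun l k => ξ l k ω with hA
    have hAn : ‖A‖ ≤ √(12 * L ^ 2 * N) := by
      refine A.opNorm_le_bound (Real.sqrt_nonneg _) fun v => ?_
      refine abs_le_of_sq_le_sq' ?_ (by positivity) |>.2
      rw [hn, mul_pow, Real.sq_sqrt (by positivity), EuclideanSpace.real_norm_sq_eq]
      have := hc1 v
      linarith
    have key := le_norm_of_net A (j := j') (by omega) hnet (b := √(N / 4)) (Real.sqrt_nonneg _)
      ?_ ?_ (WithLp.toLp 2 v)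
    · have h2 := pow_le_pow_left₀ (by positivity) key 2
      rw [hn, mul_pow, div_pow, Real.sq_sqrt (by positivity), EuclideanSpace.real_norm_sq_eq] at h2
      have e : N / 4 / 4 ^ 2 = N / 64 := by ring
      rw [e] at h2
      exact h2
    · refine (mul_le_mul_of_nonneg_right hAn (by positivity)).trans ?_
      refine abs_le_of_sq_le_sq' ?_ (by positivity) |>.2
      rw [mul_pow, div_pow (√(N / 4)), Real.sq_sqrt (by positivity), Real.sq_sqrt (by positivity),
        ← pow_mul, mul_comm j' 2, pow_mul, hj', pow_succ _ j]
      have e : (((1 : ℝ) / 2) ^ 2) ^ j = 1 / 4 ^ j := by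
        rw [← one_div_pow]; norm_num
      rw [e]
      have h4 : (0 : ℝ) < 4 ^ j := by positivity
      have h5 : L ^ 2 * (1 / 4 ^ j) ≤ 1 / 768 := by
        rw [mul_one_div, div_le_iff₀ h4]; linarith
      have h6 := mul_le_mul_of_nonneg_right h5 hN0
      nlinarith
    · intro t ht
      rcases eq_or_ne t 0 with rfl | ht0
      · simp
      have htn : 0 < ‖t‖ := norm_pos_iff.2 ht0
      have h1 := hc2 t ht ht0
      have e : ∀ l, ∑ k, (‖t‖⁻¹ * t k) * ξ l k ω = ‖t‖⁻¹ * ∑ k, t k * ξ l k ω := fun l => by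
        rw [Finset.mul_sum]; exact Finset.sum_congr rfl fun _ _ => by ring
      simp only [e, mul_pow] at h1
      rw [← Finset.mul_sum, ← hn, inv_pow, inv_mul_eq_div, lt_div_iff₀ (by positivity)] at h1
      refine abs_le_of_sq_le_sq' ?_ (norm_nonneg _) |>.2
      rw [mul_pow, Real.sq_sqrt (by positivity)]
      exact h1.le
  have hone : ∀ t ∈ net.filter (· ≠ 0), P (bad t)
      ≤ ENNReal.ofReal (Real.exp (-(N / (16 * L ^ 4)))) := by
    intro t ht
    have ht0 : t ≠ 0 := (Finset.mem_filter.1 ht).2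
    have hunit : ∑ k, (‖t‖⁻¹ * t k) ^ 2 = 1 := by
      simp only [mul_pow]
      rw [← Finset.mul_sum, ← EuclideanSpace.real_norm_sq_eq, ← mul_pow,
        inv_mul_cancel₀ (norm_ne_zero_iff.2 ht0), one_pow]
    exact measure_sum_sq_le_le (hind _) s (fun l => by have := hm l; fun_prop)
      (fun l hl => hexp l hl _ hunit.le) (fun l hl => hsq l hl _ hunit) hL
  refine (measure_mono hsub).trans ((measure_union_le _ _).trans ?_)
  have h2 : P (⋃ t ∈ net.filter (· ≠ 0), bad t) ≤ ENNReal.ofReal (Real.exp (-(c * N))) := by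
    refine (measure_biUnion_finset_le _ _).trans ((Finset.sum_le_card_nsmul _ _ _ hone).trans ?_)
    rw [nsmul_eq_mul, ← ENNReal.ofReal_natCast, ← ENNReal.ofReal_mul (by positivity)]
    refine ENNReal.ofReal_le_ofReal ?_
    have h3 : ((net.filter (· ≠ 0)).card : ℝ) ≤ Real.exp (c * N) := by
      refine le_trans ?_ (hpow j' le_rfl)
      exact_mod_cast (Finset.card_filter_le _ _).trans hcard
    refine (mul_le_mul_of_nonneg_right h3 (Real.exp_pos _).le).trans ?_
    rw [← Real.exp_add]
    refine Real.exp_le_exp.2 ?_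
    have h4 : c * N ≤ 1 / (32 * L ^ 4) * N := mul_le_mul_of_nonneg_right (min_le_right _ _) hN0
    have e : N / (16 * L ^ 4) = 2 * (1 / (32 * L ^ 4) * N) := by field_simp; ring
    rw [e]
    linarith
  have h1 : (5 : ℝ) ^ d * Real.exp (-(3 * L ^ 2 * N / L ^ 2) + (∑ _l ∈ s, 1) / 1)
      ≤ Real.exp (-(c * N)) := by
    have h5 := hpow 1 (by omega)
    rw [one_mul] at h5
    refine (mul_le_mul_of_nonneg_right h5 (Real.exp_pos _).le).trans ?_
    rw [← Real.exp_add]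
    refine Real.exp_le_exp.2 ?_
    have e : 3 * L ^ 2 * N / L ^ 2 = 3 * N := by field_simp
    rw [e, Finset.sum_const, nsmul_eq_mul, mul_one, div_one, ← hN]
    have h6 : c * N ≤ 1 * N := mul_le_mul_of_nonneg_right (min_le_left _ _) hN0
    linarith
  refine (add_le_add (hup.trans (ENNReal.ofReal_le_ofReal h1)) h2).trans ?_
  rw [← ENNReal.ofReal_add (Real.exp_pos _).le (Real.exp_pos _).le]
  exact ENNReal.ofReal_le_ofReal (by linarith)

end RandomMatrix

/-! ### Linear independence of random rows -/

section Rank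

lemma pi_succ_apply {n : ℕ} {E : Type*} [MeasurableSpace E] (ν : Fin (n + 1) → Measure E)
    [∀ k, IsProbabilityMeasure (ν k)] {S : Set (Fin (n + 1) → E)} (hS : MeasurableSet S) :
    Measure.pi ν S = ∫⁻ w, ν 0 {x | (Fin.cons x w : Fin (n + 1) → E) ∈ S}
      ∂(Measure.pi fun k : Fin n => ν k.succ) := by
  have hmp := (measurePreserving_piFinSuccAbove ν 0).symm
  rw [← hmp.measure_preimage hS.nullMeasurableSet,
    Measure.prod_apply_symm ((MeasurableEquiv.measurable _) hS)]
  simp only [Fin.zero_succAbove]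
  refine lintegral_congr fun w => ?_
  congr 1
  ext x
  simp [MeasurableEquiv.piFinSuccAbove, Fin.insertNthEquiv, Fin.insertNth_zero']

/-- Odlyzko's bound: a vector with independent coordinates, of which the `k`-th has all its atoms
of mass at most `Q k`, lies in a subspace `V` with probability at most `(∏ Q k) q^{-dim V}`, where
`q ≤ Q k` for all `k`. -/
lemma measure_submodule_mul_pow_le {q : ℝ≥0∞} (hq : q ≤ 1) : ∀ {p : ℕ} (ν : Fin p → Measure ℝ)
    [∀ k, IsProbabilityMeasure (ν k)] (Q : Fin p → ℝ≥0∞), (∀ k y, ν k {y} ≤ Q k) →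
    (∀ k, q ≤ Q k) → ∀ V : Submodule ℝ (Fin p → ℝ),
      Measure.pi ν V * q ^ Module.finrank ℝ V ≤ ∏ k, Q k := by
  intro p
  induction p with
  | zero =>
    intro ν _ Q _ _ V
    have : Module.finrank ℝ V = 0 := Module.finrank_zero_of_subsingleton
    rw [this]
    simpa using prob_le_one
  | succ p ih =>
    intro ν _ Q hQ hqQ V
    set tail : (Fin (p + 1) → ℝ) →ₗ[ℝ] (Fin p → ℝ) := LinearMap.funLeft ℝ ℝ Fin.succ with htail
    have htail' : ∀ x w, tail (Fin.cons x w) = w := fun x w => by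
      ext i; simp [htail, LinearMap.funLeft]
    set W := V.map tail with hW
    have hWm : MeasurableSet (W : Set (Fin p → ℝ)) := W.closed_of_finiteDimensional.measurableSet
    have hVm : MeasurableSet (V : Set (Fin (p + 1) → ℝ)) :=
      V.closed_of_finiteDimensional.measurableSet
    have hIH := ih (fun k => ν k.succ) (fun k => Q k.succ) (fun k => hQ k.succ)
      (fun k => hqQ k.succ) W
    set π' := Measure.pi fun k : Fin p => ν k.succ with hπ'
    have hmemW : ∀ x w, (Fin.cons x w : Fin (p + 1) → ℝ) ∈ V → w ∈ W := fun x w h =>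
      ⟨_, h, htail' x w⟩
    have hsec : ∀ c : ℝ≥0∞, (∀ w, ν 0 {x | (Fin.cons x w : Fin (p + 1) → ℝ) ∈ V} ≤ c) →
        Measure.pi ν V ≤ c * π' W := by
      intro c hc
      rw [pi_succ_apply ν hVm, ← lintegral_indicator_const hWm]
      refine lintegral_mono fun w => ?_
      by_cases hw : w ∈ (W : Set (Fin p → ℝ))
      · rw [Set.indicator_of_mem hw]; exact hc w
      · rw [Set.indicator_of_notMem hw]
        have : {x | (Fin.cons x w : Fin (p + 1) → ℝ) ∈ (V : Set _)} = ∅ := by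
          ext x
          simp only [Set.mem_ofPred_eq, Set.mem_empty_iff_false, iff_false]
          exact fun h => hw (hmemW x w h)
        rw [this, measure_empty]
    rw [Fin.prod_univ_succ]
    -- either `V` contains the first basis vector, and its projection has smaller dimension, or the
    -- sections of `V` in the direction of the first coordinate have at most one point
    by_cases he : (Fin.cons 1 0 : Fin (p + 1) → ℝ) ∈ V
    · have hrank : Module.finrank ℝ W + 1 ≤ Module.finrank ℝ V := by
        have h1 := LinearMap.finrank_range_add_finrank_ker (tail.domRestrict V)
        have h2 : LinearMap.range (tail.domRestrict V) = W := by
          rw [LinearMap.range_domRestrict]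
        rw [h2] at h1
        have h3 : Nontrivial (LinearMap.ker (tail.domRestrict V)) := by
          refine ⟨⟨⟨_, he⟩, ?_⟩, 0, fun h => ?_⟩
          · rw [LinearMap.mem_ker, LinearMap.domRestrict_apply, htail']
          · have h4 := congrArg
              (fun u : LinearMap.ker (tail.domRestrict V) => (u : V).1 0) h
            simp at h4
        have h4 := Module.finrank_pos (R := ℝ) (M := LinearMap.ker (tail.domRestrict V))
        omega
      calc Measure.pi ν V * q ^ Module.finrank ℝ V
          ≤ (1 * π' W) * q ^ (Module.finrank ℝ W + 1) :=
            mul_le_mul' (hsec 1 fun w => prob_le_one) (pow_le_pow_right_of_le_one' hq hrank)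
        _ = q * (π' W * q ^ Module.finrank ℝ W) := by ring
        _ ≤ _ := mul_le_mul' (hqQ 0) hIH
    · have hsub : ∀ w, ν 0 {x | (Fin.cons x w : Fin (p + 1) → ℝ) ∈ V} ≤ Q 0 := by
        intro w
        rcases Set.eq_empty_or_nonempty {x | (Fin.cons x w : Fin (p + 1) → ℝ) ∈ V} with h | ⟨y, hy⟩
        · rw [h, measure_empty]; exact zero_le
        refine (measure_mono fun x hx => ?_).trans (hQ 0 y)
        by_contra hne
        have hxy : x - y ≠ 0 := sub_ne_zero.2 hne
        have h1 := V.smul_mem (x - y)⁻¹ (V.sub_mem hx hy)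
        refine he ?_
        convert! h1 using 1
        ext i
        refine Fin.cases ?_ (fun i => ?_) i
        · simp [hxy]
        · simp
      calc Measure.pi ν V * q ^ Module.finrank ℝ V
          ≤ (Q 0 * π' W) * q ^ Module.finrank ℝ W :=
            mul_le_mul' (hsec _ hsub) (pow_le_pow_right_of_le_one' hq (Submodule.finrank_map_le _ _))
        _ = Q 0 * (π' W * q ^ Module.finrank ℝ W) := by ring
        _ ≤ _ := by gcongr

/-- If proper subspaces of dimension less than `n` have probability at most `ε`, then `n`
independent rows are linearly independent up to an event of probability `n ε`. -/
lemma measure_not_linearIndependent_le {p : ℕ} (π : Measure (Fin p → ℝ)) [IsProbabilityMeasure π]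
    {ε : ℝ≥0∞} : ∀ n : ℕ, (∀ V : Submodule ℝ (Fin p → ℝ), Module.finrank ℝ V + 1 ≤ n → π V ≤ ε) →
      Measure.pi (fun _ : Fin n => π) {v | ¬ LinearIndependent ℝ v} ≤ n * ε := by
  intro n
  induction n with
  | zero =>
    intro _
    have : {v : Fin 0 → Fin p → ℝ | ¬ LinearIndependent ℝ v} = ∅ := by
      ext v; simp
    rw [this, measure_empty]; exact zero_le
  | succ n ih =>
    intro h
    have hmeas : ∀ m, MeasurableSet {v : Fin m → Fin p → ℝ | ¬ LinearIndependent ℝ v} := fun m =>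
      (isOpen_setOfPred_linearIndependent (𝕜 := ℝ)).measurableSet.compl
    rw [pi_succ_apply _ (hmeas _)]
    calc _ ≤ ∫⁻ w, ({v : Fin n → Fin p → ℝ | ¬ LinearIndependent ℝ v}.indicator (fun _ => 1) w + ε)
          ∂(Measure.pi fun _ : Fin n => π) := by
          refine lintegral_mono fun w => ?_
          by_cases hw : LinearIndependent ℝ w
          · refine le_trans ?_ le_add_self
            refine le_trans (measure_mono fun x hx => ?_)
              (h (Submodule.span ℝ (Set.range w)) ?_)
            · simp only [Set.mem_ofPred_eq, linearIndependent_finCons, not_and, not_not] at hx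
              exact hx hw
            · have := finrank_range_le_card (R := ℝ) w
              rw [Fintype.card_fin, Set.finrank] at this
              omega
          · rw [Set.indicator_of_mem (by exact hw)]
            exact prob_le_one.trans le_self_add
      _ = Measure.pi (fun _ : Fin n => π) {v | ¬ LinearIndependent ℝ v} + ε := by
          rw [lintegral_add_right _ measurable_const, lintegral_indicator_const (hmeas n), one_mul]
          simp
      _ ≤ n * ε + ε := by
          gcongr
          exact ih fun V hV => h V (by omega)
      _ = _ := by push_cast; ring

/-- A centered normalized variable with bounded fourth moment is not concentrated on a point, by the
Paley–Zygmund inequality. -/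
lemma measure_eq_le_of_fourth_moment {Ω : Type*} [MeasurableSpace Ω] {P : Measure Ω}
    [IsProbabilityMeasure P] {Y : Ω → ℝ} (hY : Measurable Y) (h4 : Integrable (fun ω => Y ω ^ 4) P)
    (h2 : Integrable (fun ω => Y ω ^ 2) P) (h1 : Integrable Y P) (hm : ∫ ω, Y ω ∂P = 0)
    (hv : ∫ ω, Y ω ^ 2 ∂P = 1) {M : ℝ} (hM : 1 ≤ M) (h4M : ∫ ω, Y ω ^ 4 ∂P ≤ M) (y : ℝ) :
    P {ω | Y ω = y} ≤ ENNReal.ofReal (1 - 1 / (8 * M)) := by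
  set S : Set Ω := {ω | Y ω = y} with hS
  have hSm : MeasurableSet S := hY (measurableSet_singleton y)
  set s : ℝ := 1 / (8 * M * (1 + y ^ 2)) with hs
  have hs0 : 0 < s := by positivity
  -- off the event `Y = y`, by the inequality of arithmetic and geometric means
  have hpt : ∀ ω, (Y ω - y) ^ 2
      ≤ s / 2 * (8 * Y ω ^ 4 + 8 * y ^ 4) + 1 / (2 * s) * (Sᶜ.indicator (fun _ => (1 : ℝ)) ω) := by
    intro ω
    by_cases hω : ω ∈ S
    · rw [show Y ω = y from hω, sub_self]
      rw [Set.indicator_of_notMem (by simpa using hω), zero_pow two_ne_zero]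
      positivity
    · rw [Set.indicator_of_mem (by simpa using hω), mul_one]
      have h5 : (Y ω - y) ^ 4 ≤ 8 * Y ω ^ 4 + 8 * y ^ 4 := by
        nlinarith [sq_nonneg (Y ω ^ 2 - y ^ 2), sq_nonneg ((Y ω + y) ^ 2), sq_nonneg (Y ω + y),
          mul_nonneg (sq_nonneg (Y ω - y)) (sq_nonneg (Y ω + y)), sq_nonneg (Y ω ^ 2 + y ^ 2)]
      have h6 : (Y ω - y) ^ 2 ≤ s / 2 * (Y ω - y) ^ 4 + 1 / (2 * s) := by
        have h7 : 0 ≤ (s * (Y ω - y) ^ 2 - 1) ^ 2 / (2 * s) := by positivity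
        have e : (s * (Y ω - y) ^ 2 - 1) ^ 2 / (2 * s)
            = s / 2 * (Y ω - y) ^ 4 + 1 / (2 * s) - (Y ω - y) ^ 2 := by field_simp; ring
        linarith
      exact h6.trans (add_le_add (mul_le_mul_of_nonneg_left h5 (by positivity)) le_rfl)
  have hi1 : Integrable (fun ω => (Y ω - y) ^ 2) P := by
    have e : (fun ω => (Y ω - y) ^ 2) = fun ω => Y ω ^ 2 - 2 * y * Y ω + y ^ 2 := by
      funext ω; ring
    rw [e]
    exact (h2.sub (h1.const_mul _)).add (integrable_const _)
  have hv1 : ∫ ω, (Y ω - y) ^ 2 ∂P = 1 + y ^ 2 := by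
    have e : (fun ω => (Y ω - y) ^ 2) = fun ω => (Y ω ^ 2 - 2 * y * Y ω) + y ^ 2 := by
      funext ω; ring
    have h3 : Integrable (fun ω => Y ω ^ 2 - 2 * y * Y ω) P := h2.sub (h1.const_mul _)
    rw [e, integral_add h3 (integrable_const _),
      integral_sub h2 (h1.const_mul _), integral_const_mul, hm, hv]
    simp
  have hi2 : Integrable (fun ω => s / 2 * (8 * Y ω ^ 4 + 8 * y ^ 4)) P :=
    ((h4.const_mul 8).add (integrable_const _)).const_mul _
  have hi3 : Integrable (fun ω => 1 / (2 * s) * (Sᶜ.indicator (fun _ => (1 : ℝ)) ω)) P :=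
    ((integrable_const (1 : ℝ)).indicator hSm.compl).const_mul _
  have h := integral_mono hi1 (hi2.add hi3) hpt
  have e1 : ∫ ω, s / 2 * (8 * Y ω ^ 4 + 8 * y ^ 4) ∂P = s / 2 * (8 * ∫ ω, Y ω ^ 4 ∂P + 8 * y ^ 4) := by
    rw [integral_const_mul, integral_add (h4.const_mul 8) (integrable_const _), integral_const_mul]
    simp
  have e2 : ∫ ω, 1 / (2 * s) * (Sᶜ.indicator (fun _ => (1 : ℝ)) ω) ∂P
      = 1 / (2 * s) * (1 - P.real S) := by
    rw [integral_const_mul, integral_indicator_const _ hSm.compl, probReal_compl_eq_one_sub hSm]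
    simp
  rw [hv1, integral_add' hi2 hi3, e1, e2] at h
  have h8 : s / 2 * (8 * ∫ ω, Y ω ^ 4 ∂P + 8 * y ^ 4) ≤ (1 + y ^ 2) / 2 := by
    have h9 : 8 * ∫ ω, Y ω ^ 4 ∂P + 8 * y ^ 4 ≤ 8 * M * (1 + y ^ 2) ^ 2 := by
      have := mul_nonneg (by linarith : 0 ≤ M) (sq_nonneg y)
      have : y ^ 4 ≤ M * y ^ 4 := le_mul_of_one_le_left (by positivity) hM
      nlinarith
    calc _ ≤ s / 2 * (8 * M * (1 + y ^ 2) ^ 2) := mul_le_mul_of_nonneg_left h9 (by positivity)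
      _ = _ := by rw [hs]; field_simp
  have h10 : (1 + y ^ 2) / 2 ≤ 1 / (2 * s) * (1 - P.real S) := by linarith
  have h11 : 1 / (8 * M) ≤ 1 - P.real S := by
    rw [hs] at h10
    have hy : 0 < 1 + y ^ 2 := by positivity
    have e : 1 / (2 * (1 / (8 * M * (1 + y ^ 2)))) = 4 * M * (1 + y ^ 2) := by
      field_simp; norm_num
    rw [e] at h10
    rw [div_le_iff₀ (by positivity)]
    nlinarith
  rw [← ofReal_measureReal]
  exact ENNReal.ofReal_le_ofReal (by linarith)

end Rank

/-! ### Independent features -/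

section Abstract

variable {Ω : Type*} [MeasurableSpace Ω] {P : Measure Ω} [IsProbabilityMeasure P]

/-- The slices of an independent family indexed by pairs are independent. -/
lemma iIndepFun_slice {ι κ : Type*} {Z : ι × κ → Ω → ℝ} (hZ : ∀ q, Measurable (Z q))
    (h : iIndepFun Z P) : iIndepFun (fun (l : ι) ω (i : κ) => Z (l, i) ω) P := by
  have : ∀ q, IsProbabilityMeasure (P.map (Z q)) := fun q =>
    Measure.isProbabilityMeasure_map (hZ q).aemeasurable
  rw [iIndepFun_iff_map_fun_eq_infinitePi_map (by fun_prop)]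
  have h1 : ∀ l, P.map (fun ω (i : κ) => Z (l, i) ω)
      = Measure.infinitePi fun i => P.map (Z (l, i)) := fun l =>
    (h.precomp (Prod.mk_right_injective l)).map_fun_eq_infinitePi_map (fun i => hZ (l, i))
  have h2 : P.map (fun ω (s : (_ : ι) × κ) => Z (s.1, s.2) ω)
      = Measure.infinitePi fun s : (_ : ι) × κ => P.map (Z (s.1, s.2)) :=
    (h.precomp (Equiv.sigmaEquivProd ι κ).injective).map_fun_eq_infinitePi_map
      (fun s => hZ (s.1, s.2))
  simp only [h1]
  rw [← Measure.infinitePi_map_piCurry (fun (l : ι) (i : κ) => P.map (Z (l, i))), ← h2,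
    Measure.map_map (by fun_prop) (by fun_prop)]
  rfl

lemma ExpSqBound.comp_measurePreserving {Ω' : Type*} [MeasurableSpace Ω'] {P' : Measure Ω'}
    {Y : Ω' → ℝ} {L : ℝ} (h : ExpSqBound Y L P') {g : Ω → Ω'} (hg : MeasurePreserving g P P') :
    ExpSqBound (fun ω => Y (g ω)) L P := by
  have h1 := h.measurable
  have h2 := integral_map (μ := P) hg.measurable.aemeasurable
    (f := fun y => Real.exp (Y y ^ 2 / L ^ 2)) (by fun_prop)
  rw [hg.map_eq] at h2
  exact ⟨h1.comp hg.measurable, h.pos, hg.integrable_comp_of_integrable h.integrable,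
    h2.symm.le.trans h.integral_le⟩

lemma integral_sum_sq_of_orthonormal {ι : Type*} [Fintype ι] [DecidableEq ι] {Z : ι → Ω → ℝ}
    (hi : ∀ i j, Integrable (fun ω => Z i ω * Z j ω) P)
    (ho : ∀ i j, ∫ ω, Z i ω * Z j ω ∂P = if i = j then 1 else 0) (v : ι → ℝ) :
    ∫ ω, (∑ i, v i * Z i ω) ^ 2 ∂P = ∑ i, v i ^ 2 := by
  have e : ∀ ω, (∑ i, v i * Z i ω) ^ 2 = ∑ i, ∑ j, v i * v j * (Z i ω * Z j ω) := fun ω => by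
    rw [sq, Finset.sum_mul_sum]
    exact Finset.sum_congr rfl fun _ _ => Finset.sum_congr rfl fun _ _ => by ring
  simp only [e]
  rw [integral_finsetSum _ fun i _ => integrable_finsetSum _ fun j _ => (hi i j).const_mul _]
  refine Finset.sum_congr rfl fun i _ => ?_
  rw [integral_finsetSum _ fun j _ => (hi i j).const_mul _]
  simp only [integral_const_mul, ho, mul_ite, mul_one, mul_zero]
  rw [Finset.sum_ite_eq, if_pos (Finset.mem_univ _), sq]

end Abstract

section Independent

variable {p : ℕ} {eig : ℕ → ℝ} {μ : Measure (ℕ → ℝ)} [IsProbabilityMeasure μ] {G : ℝ} {n : ℕ}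

@[fun_prop]
lemma measurable_whiten (l : ℕ) : Measurable fun x : ℕ → ℝ => whiten eig x l := by
  unfold whiten; fun_prop

lemma eig_pos_of_lt (hL : IsFeatureLaw (p : ℕ∞) eig μ) {l : ℕ} (hl : l < p) : 0 < eig l :=
  hL.pos l (by exact_mod_cast hl)

lemma sqrt_mul_whiten (hL : IsFeatureLaw (p : ℕ∞) eig μ) {l : ℕ} (hl : l < p) (x : ℕ → ℝ) :
    √(eig l) * whiten eig x l = x l := by
  have := (Real.sqrt_pos.2 (eig_pos_of_lt hL hl)).ne'
  rw [whiten]; field_simp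

lemma integral_whiten_mul (hL : IsFeatureLaw (p : ℕ∞) eig μ) {i j : ℕ} (hi : i < p) :
    Integrable (fun x => whiten eig x i * whiten eig x j) μ ∧
      ∫ x, whiten eig x i * whiten eig x j ∂μ = if i = j then 1 else 0 := by
  have e : (fun x : ℕ → ℝ => whiten eig x i * whiten eig x j)
      = fun x => (√(eig i) * √(eig j))⁻¹ * (x i * x j) := by
    funext x
    rw [whiten, whiten, div_mul_div_comm, div_eq_inv_mul]
  rw [e]
  refine ⟨(hL.integrable i j).const_mul _, ?_⟩
  rw [integral_const_mul, hL.secondMoment]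
  split_ifs with h
  · subst h
    rw [Real.mul_self_sqrt (hL.nonneg i), inv_mul_cancel₀ (eig_pos_of_lt hL hi).ne']
  · rw [mul_zero]

lemma IndependentFeatures.expSqBound (hI : IndependentFeatures p eig μ G) (hG : 0 < G) {l : ℕ}
    (hl : l < p) : ExpSqBound (fun x => whiten eig x l) (2 * G) μ :=
  expSqBound_of_psiTwoNorm_le hG (by fun_prop) (hI.2 l hl)

/-- Uncorrelated independent coordinates: at most one of them is not centered. -/
lemma IndependentFeatures.integral_eq_zero_or (hI : IndependentFeatures p eig μ G)
    (hL : IsFeatureLaw (p : ℕ∞) eig μ) {i j : ℕ} (hi : i < p) (hij : i ≠ j) :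
    ∫ x, whiten eig x i ∂μ = 0 ∨ ∫ x, whiten eig x j ∂μ = 0 := by
  have h := (hI.1.indepFun hij).integral_fun_mul_eq_mul_integral
    (by fun_prop : Measurable _).aestronglyMeasurable (by fun_prop : Measurable _).aestronglyMeasurable
  rw [(integral_whiten_mul hL hi).2, if_neg hij] at h
  exact mul_eq_zero.1 h.symm

lemma measurePreserving_sample (i : Fin n) :
    MeasurePreserving (fun X : Fin n → ℕ → ℝ => X i) (sampleLaw n μ) μ :=
  measurePreserving_eval (fun _ : Fin n => μ) i

/-- The columns of the whitened sample matrix are independent. -/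
lemma IndependentFeatures.iIndepFun_columns (hI : IndependentFeatures p eig μ G) :
    iIndepFun (fun (l : ℕ) (X : Fin n → ℕ → ℝ) (i : Fin n) => whiten eig (X i) l)
      (sampleLaw n μ) := by
  have h1 : iIndepFun (fun (i : Fin n) (X : Fin n → ℕ → ℝ) (l : ℕ) => whiten eig (X i) l)
      (sampleLaw n μ) :=
    iIndepFun_pi (X := fun (_ : Fin n) (x : ℕ → ℝ) (l : ℕ) => whiten eig x l)
      fun _ => (by fun_prop : Measurable _).aemeasurable
  have h2 : ∀ i : Fin n, iIndepFun (fun (l : ℕ) (X : Fin n → ℕ → ℝ) => whiten eig (X i) l)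
      (sampleLaw n μ) := by
    intro i
    have hmp := measurePreserving_sample (μ := μ) i
    have h3 := hI.1.map_fun_eq_infinitePi_map (fun l => by fun_prop)
    rw [iIndepFun_iff_map_fun_eq_infinitePi_map (fun l => by fun_prop)]
    have e : ∀ {β : Type} [MeasurableSpace β] (g : (ℕ → ℝ) → β), Measurable g →
        (sampleLaw n μ).map (fun X => g (X i)) = μ.map g := by
      intro β _ g hg
      nth_rewrite 2 [← hmp.map_eq]
      rw [Measure.map_map hg hmp.measurable]
      rfl
    rw [e (fun x l => whiten eig x l) (by fun_prop), h3]
    congr 1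
    funext l
    rw [e (fun x => whiten eig x l) (by fun_prop)]
  have h3 := iIndepFun_uncurry' (X := fun (i : Fin n) (l : ℕ) (X : Fin n → ℕ → ℝ) =>
    whiten eig (X i) l) (fun i l => by fun_prop) h1 h2
  exact iIndepFun_slice (Z := fun (q : ℕ × Fin n) (X : Fin n → ℕ → ℝ) => whiten eig (X q.2) q.1)
    (fun q => by fun_prop) (h3.precomp Prod.swap_injective)

/-- The quadratic form of the first `k` whitened coordinates of the sample is bounded below. -/
lemma exists_head_lower (hG : 0 < G) : ∃ C c : ℝ, 0 < C ∧ 0 < c ∧ ∀ {p : ℕ} {eig : ℕ → ℝ}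
    {μ : Measure (ℕ → ℝ)} [IsProbabilityMeasure μ], IsFeatureLaw (p : ℕ∞) eig μ →
    IndependentFeatures p eig μ G → ∀ {n k : ℕ}, k ≤ p → C * k ≤ n →
    sampleLaw n μ {X | ¬ ∀ v : Fin k → ℝ, (n : ℝ) / 64 * ∑ l, v l ^ 2
      ≤ ∑ i, (∑ l, v l * whiten eig (X i) l) ^ 2} ≤ ENNReal.ofReal (2 * Real.exp (-(c * n))) := by
  obtain ⟨C, c, hC, hc, h⟩ := exists_measure_not_le_sum_sq (L := 6 * (2 * G)) (by positivity)
  refine ⟨C, c, hC, hc, fun {p eig μ} _ hL hI {n k} hk hn => ?_⟩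
  have hrow : ∀ v : Fin k → ℝ, ∑ l, v l ^ 2 ≤ 1 →
      ExpSqBound (fun x : ℕ → ℝ => ∑ l : Fin k, v l * whiten eig x l) (6 * (2 * G)) μ := fun v hv =>
    expSqBound_sum_of_subsingleton (Z := fun (l : Fin k) (x : ℕ → ℝ) => whiten eig x l)
      (by positivity) (hI.1.precomp Fin.val_injective) Finset.univ
      (fun l _ => hI.expSqBound hG (l.2.trans_le hk))
      (fun i _ j _ hij => hI.integral_eq_zero_or hL (i.2.trans_le hk) fun h => hij (Fin.ext h)) v hv
  have := h (P := sampleLaw n μ) (ι := Fin n) (κ := Fin k)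
    (ξ := fun i l X => whiten eig (X i) l) (fun i l => by fun_prop)
    (fun v => iIndepFun_pi (X := fun (_ : Fin n) (x : ℕ → ℝ) => ∑ l, v l * whiten eig x l)
      fun _ => (by fun_prop : Measurable _).aemeasurable) Finset.univ
    (fun i _ v hv => (hrow v hv).comp_measurePreserving (measurePreserving_sample i))
    (fun i _ v hv => by
      have hmp := measurePreserving_sample (μ := μ) i
      have h2 := integral_map (μ := sampleLaw n μ) hmp.measurable.aemeasurable
        (f := fun x : ℕ → ℝ => (∑ l, v l * whiten eig x l) ^ 2)
        (by fun_prop : Measurable _).aestronglyMeasurable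
      rw [hmp.map_eq] at h2
      rw [← h2, integral_sum_sq_of_orthonormal
        (Z := fun (l : Fin k) (x : ℕ → ℝ) => whiten eig x l)
        (fun i j => (integral_whiten_mul hL (i.2.trans_le hk)).1)
        (fun i j => by
          rw [(integral_whiten_mul hL (i.2.trans_le hk)).2]
          simp only [Fin.ext_iff])]
      exact hv)
    (by simpa using hn)
  simpa using this

/-- Combinations of a centered column of the whitened sample matrix. -/
lemma IndependentFeatures.column (hI : IndependentFeatures p eig μ G)
    (hL : IsFeatureLaw (p : ℕ∞) eig μ) (hG : 0 < G) {l : ℕ} (hl : l < p)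
    (h0 : ∫ x, whiten eig x l ∂μ = 0) (v : Fin n → ℝ) :
    (∑ i, v i ^ 2 ≤ 1 → ExpSqBound (fun X : Fin n → ℕ → ℝ => ∑ i, v i * whiten eig (X i) l)
      (6 * (2 * G)) (sampleLaw n μ)) ∧
    (∑ i, v i ^ 2 = 1 →
      ∫ X : Fin n → ℕ → ℝ, (∑ i, v i * whiten eig (X i) l) ^ 2 ∂(sampleLaw n μ) = 1) := by
  have hind : iIndepFun (fun (i : Fin n) (X : Fin n → ℕ → ℝ) => whiten eig (X i) l)
      (sampleLaw n μ) := iIndepFun_pi (X := fun (_ : Fin n) (x : ℕ → ℝ) => whiten eig x l)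
      fun _ => (by fun_prop : Measurable _).aemeasurable
  have hval : ∀ (i : Fin n) (g : (ℕ → ℝ) → ℝ), Measurable g →
      ∫ X, g (X i) ∂(sampleLaw n μ) = ∫ x, g x ∂μ := by
    intro i g hg
    have hmp := measurePreserving_sample (μ := μ) i
    have h2 := integral_map (μ := sampleLaw n μ) hmp.measurable.aemeasurable
      (f := g) hg.aestronglyMeasurable
    rw [hmp.map_eq] at h2
    exact h2.symm
  have h1 : ∀ i : Fin n, ExpSqBound (fun X : Fin n → ℕ → ℝ => whiten eig (X i) l) (2 * G)
      (sampleLaw n μ) := fun i =>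
    (hI.expSqBound hG hl).comp_measurePreserving (measurePreserving_sample i)
  have hm0 : ∀ i : Fin n, ∫ X : Fin n → ℕ → ℝ, whiten eig (X i) l ∂(sampleLaw n μ) = 0 := fun i =>
    (hval i (fun x => whiten eig x l) (by fun_prop)).trans h0
  refine ⟨fun hv => ?_, fun hv => ?_⟩
  · exact expSqBound_sum (by positivity) hind Finset.univ (fun i _ => h1 i) (fun i _ => hm0 i) v hv
      (by linarith)
  · rw [integral_sum_sq_of_orthonormal (Z := fun (i : Fin n) (X : Fin n → ℕ → ℝ) =>
      whiten eig (X i) l) (fun i j => (h1 i).memLp.integrable_mul (h1 j).memLp) (fun i j => ?_) v]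
    · exact hv
    · split_ifs with hij
      · subst hij
        rw [hval i (fun x => whiten eig x l * whiten eig x l) (by fun_prop),
          (integral_whiten_mul hL hl).2, if_pos rfl]
      · rw [(hind.indepFun hij).integral_fun_mul_eq_mul_integral
          (by fun_prop : Measurable _).aestronglyMeasurable
          (by fun_prop : Measurable _).aestronglyMeasurable, hm0, zero_mul]

lemma IndependentFeatures.iIndepFun_column_comb (hI : IndependentFeatures p eig μ G)
    (v : Fin n → ℝ) : iIndepFun (fun (l : ℕ) (X : Fin n → ℕ → ℝ) =>
      ∑ i, v i * whiten eig (X i) l) (sampleLaw n μ) :=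
  hI.iIndepFun_columns.comp (fun _ y => ∑ i, v i * y i) fun _ => by fun_prop

/-- The quadratic form of sufficiently many centered columns is bounded below. -/
lemma exists_columns_lower (hG : 0 < G) : ∃ C c : ℝ, 0 < C ∧ 0 < c ∧ ∀ {p : ℕ} {eig : ℕ → ℝ}
    {μ : Measure (ℕ → ℝ)} [IsProbabilityMeasure μ], IsFeatureLaw (p : ℕ∞) eig μ →
    IndependentFeatures p eig μ G → ∀ {n : ℕ} (s : Finset ℕ),
    (∀ l ∈ s, l < p ∧ ∫ x, whiten eig x l ∂μ = 0) → C * n ≤ (s.card : ℝ) →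
    sampleLaw n μ {X | ¬ ∀ v : Fin n → ℝ, (s.card : ℝ) / 64 * ∑ i, v i ^ 2
      ≤ ∑ l ∈ s, (∑ i, v i * whiten eig (X i) l) ^ 2}
      ≤ ENNReal.ofReal (2 * Real.exp (-(c * s.card))) := by
  obtain ⟨C, c, hC, hc, h⟩ := exists_measure_not_le_sum_sq (L := 6 * (2 * G)) (by positivity)
  refine ⟨C, c, hC, hc, fun {p eig μ} _ hL hI {n} s hs hn => ?_⟩
  exact h (P := sampleLaw n μ) (ι := ℕ) (κ := Fin n) (ξ := fun l i X => whiten eig (X i) l)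
    (fun i l => by fun_prop) hI.iIndepFun_column_comb s
    (fun l hl v hv => (hI.column hL hG (hs l hl).1 (hs l hl).2 v).1 hv)
    (fun l hl v hv => (hI.column hL hG (hs l hl).1 (hs l hl).2 v).2 hv) (by simpa using hn)

end Independent

/-! ### Events for independent features -/

section IndependentEvents

variable {p : ℕ} {eig : ℕ → ℝ} {μ : Measure (ℕ → ℝ)} [IsProbabilityMeasure μ] {G a cE CE : ℝ}
  {n : ℕ}

lemma IndependentFeatures.exists_forall_ne_centered (hI : IndependentFeatures p eig μ G)
    (hL : IsFeatureLaw (p : ℕ∞) eig μ) (hp : 0 < p) :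
    ∃ l₀ < p, ∀ l < p, l ≠ l₀ → ∫ x, whiten eig x l ∂μ = 0 := by
  by_cases h : ∃ l₀ < p, ∫ x, whiten eig x l₀ ∂μ ≠ 0
  · obtain ⟨l₀, hl₀, hne⟩ := h
    exact ⟨l₀, hl₀, fun l hl hll => (hI.integral_eq_zero_or hL hl hll).resolve_right hne⟩
  · push Not at h
    exact ⟨0, hp, fun l hl _ => h l hl⟩

/-- A column of the whitened sample matrix, which need not be centered. -/
lemma measure_column_norm_ge_le (hI : IndependentFeatures p eig μ G) (hG : 0 < G) {l : ℕ}
    (hl : l < p) : sampleLaw n μ {X | 8 * G ^ 2 * n ≤ ∑ i, whiten eig (X i) l ^ 2}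
      ≤ ENNReal.ofReal (Real.exp (-n)) := by
  have h := measure_le_sum_sq_le (P := sampleLaw n μ)
    (Y := fun (i : Fin n) (X : Fin n → ℕ → ℝ) => whiten eig (X i) l)
    (iIndepFun_pi (X := fun (_ : Fin n) (x : ℕ → ℝ) => whiten eig x l)
      fun _ => (by fun_prop : Measurable _).aemeasurable) Finset.univ (fun i => by fun_prop)
    (fun i _ => (hI.expSqBound hG hl).comp_measurePreserving (measurePreserving_sample i))
    (lam := fun _ => 1) one_pos (fun _ _ => ⟨zero_le_one, le_rfl⟩) (by positivity) (8 * G ^ 2 * n)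
  simp only [one_mul] at h
  refine h.trans (ENNReal.ofReal_le_ofReal (Real.exp_le_exp.2 (le_of_eq ?_)))
  have : 8 * G ^ 2 * n / (2 * G) ^ 2 = 2 * n := by field_simp; ring
  rw [this]
  simp
  ring

/-- The constant in `measure_not_tail_upper`. -/
def tailConst (G a : ℝ) : ℝ := 4 * ((12 * G) ^ 2 * (Real.log 5 + 1 + 1 / a)) + 8 * G ^ 2

/-- The kernel matrix of the coordinates from `k` on is bounded above by a multiple of
`n k^{-1-a}`. -/
lemma measure_not_tail_upper (ha : 0 < a) (hCE : 0 < CE) (hL : IsFeatureLaw (p : ℕ∞) eig μ)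
    (hE : EigenDecay (p : ℕ∞) a cE CE eig) (hI : IndependentFeatures p eig μ G) (hG : 0 < G)
    (hp : 0 < p) {k : ℕ} (hk : 1 ≤ k) (hkn : k ≤ n) :
    sampleLaw n μ {X | ¬ ∀ v : Fin n → ℝ,
      ∑ l ∈ Finset.Ico k p, eig l * (∑ i, v i * whiten eig (X i) l) ^ 2
        ≤ tailConst G a * n * (CE * (k : ℝ) ^ (-1 - a)) * ∑ i, v i ^ 2}
      ≤ ENNReal.ofReal (2 * Real.exp (-n)) := by
  obtain ⟨l₀, hl₀, hcent⟩ := hI.exists_forall_ne_centered hL hp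
  have hk0 : (0 : ℝ) < k := by exact_mod_cast hk
  have hkn' : (k : ℝ) ≤ n := by exact_mod_cast hkn
  set Λ : ℝ := CE * (k : ℝ) ^ (-1 - a) with hΛ
  have hΛ0 : 0 < Λ := by positivity
  set s := (Finset.Ico k p).erase l₀ with hs
  have hmem : ∀ l ∈ s, l ≠ l₀ ∧ k ≤ l ∧ l < p := fun l hl => by
    have := Finset.mem_erase.1 hl
    exact ⟨this.1, Finset.mem_Ico.1 this.2⟩
  have heig : ∀ l, k ≤ l → eig l ≤ Λ := fun l hl => by
    refine (eig_le_of_decay hL hCE hE l).trans (mul_le_mul_of_nonneg_left ?_ hCE.le)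
    exact Real.rpow_le_rpow_of_nonpos hk0 (by have : (k : ℝ) ≤ l := by exact_mod_cast hl
                                              linarith) (by linarith)
  set T : ℝ := (12 * G) ^ 2 * (Real.log 5 + 1 + 1 / a) * n * Λ with hT
  have h1 := measure_not_sum_sq_le (P := sampleLaw n μ) (ι := ℕ) (κ := Fin n) (L := 6 * (2 * G))
    (ξ := fun l i X => whiten eig (X i) l) (fun i l => by fun_prop) hI.iIndepFun_column_comb s
    (fun l hl v hv =>
      (hI.column hL hG (hmem l hl).2.2 (hcent l (hmem l hl).2.2 (hmem l hl).1) v).1 hv)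
    (by positivity) hΛ0 (lam := eig) (fun l hl => ⟨hL.nonneg l, heig l (hmem l hl).2.1⟩) T
  have h2 := measure_column_norm_ge_le (n := n) hI hG hl₀
  have hsum : ∑ l ∈ s, eig l ≤ Λ * (n / a) := by
    calc ∑ l ∈ s, eig l ≤ ∑ l ∈ Finset.Ico k p, eig l :=
          Finset.sum_le_sum_of_subset_of_nonneg (Finset.erase_subset _ _) fun l _ _ => hL.nonneg l
      _ ≤ ∑ l ∈ Finset.Ico k p, CE * ((l : ℝ) + 1) ^ (-1 - a) :=
          Finset.sum_le_sum fun l _ => eig_le_of_decay hL hCE hE l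
      _ ≤ CE * ((k : ℝ) ^ (-a) / a) := by
          rw [← Finset.mul_sum]
          exact mul_le_mul_of_nonneg_left (sum_Ico_rpow_le ha hk p) hCE.le
      _ = Λ * (k / a) := by
          rw [hΛ, show -1 - a = -a - 1 by ring, Real.rpow_sub_one hk0.ne']
          field_simp
      _ ≤ _ := by gcongr
  have h1' : (5 : ℝ) ^ Fintype.card (Fin n)
      * Real.exp (-(T / (Λ * (6 * (2 * G)) ^ 2)) + (∑ l ∈ s, eig l) / Λ) ≤ Real.exp (-n) := by
    have e : (5 : ℝ) ^ Fintype.card (Fin n) = Real.exp (Real.log 5 * n) := by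
      rw [Fintype.card_fin, Real.exp_mul, Real.exp_log (by norm_num), Real.rpow_natCast]
    rw [e, ← Real.exp_add]
    refine Real.exp_le_exp.2 ?_
    have e2 : T / (Λ * (6 * (2 * G)) ^ 2) = (Real.log 5 + 1 + 1 / a) * n := by
      rw [hT]; field_simp; ring
    have e3 : (∑ l ∈ s, eig l) / Λ ≤ n / a := by
      rw [div_le_iff₀ hΛ0]; linarith
    rw [e2]
    have e4 : (Real.log 5 + 1 + 1 / a) * n = Real.log 5 * n + n + n / a := by ring
    linarith
  refine (measure_mono ?_).trans (((measure_union_le _ _).trans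
    (add_le_add (h1.trans (ENNReal.ofReal_le_ofReal h1')) h2)).trans ?_)
  · intro X hX
    by_contra hcon
    simp only [Set.mem_union, Set.mem_ofPred_eq, not_or, not_not, not_le] at hcon
    obtain ⟨hc1, hc2⟩ := hcon
    refine hX fun v => ?_
    have hv0 : 0 ≤ ∑ i, v i ^ 2 := Finset.sum_nonneg fun _ _ => sq_nonneg _
    have hex : ∑ l ∈ Finset.Ico k p, eig l * (∑ i, v i * whiten eig (X i) l) ^ 2
        ≤ ∑ l ∈ s, eig l * (∑ i, v i * whiten eig (X i) l) ^ 2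
          + Λ * ((∑ i, v i ^ 2) * (8 * G ^ 2 * n)) := by
      by_cases hmem₀ : l₀ ∈ Finset.Ico k p
      · rw [← Finset.sum_erase_add _ _ hmem₀]
        refine add_le_add le_rfl (mul_le_mul (heig l₀ (Finset.mem_Ico.1 hmem₀).1) ?_ (sq_nonneg _)
          hΛ0.le)
        exact (Finset.sum_mul_sq_le_sq_mul_sq _ _ _).trans
          (mul_le_mul_of_nonneg_left hc2.le hv0)
      · rw [hs, Finset.erase_eq_of_notMem hmem₀]
        have : 0 ≤ Λ * ((∑ i, v i ^ 2) * (8 * G ^ 2 * n)) := by positivity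
        linarith
    have h3 := hc1 v
    refine hex.trans ((add_le_add h3 le_rfl).trans (le_of_eq ?_))
    rw [hT, tailConst]
    ring
  · rw [← ENNReal.ofReal_add (Real.exp_pos _).le (Real.exp_pos _).le]
    exact ENNReal.ofReal_le_ofReal (by linarith)

/-- The transfer inequality from a lower bound for the whitened coordinates below `k` and an upper bound
for the kernel matrix of the others. -/
lemma transfer_of_head_tail (hL : IsFeatureLaw (p : ℕ∞) eig μ) {k : ℕ} (hk : k ≤ p) (hn : 0 < n)
    {x : Fin n → SeqL2} (hx0 : ∀ i l, p ≤ l → x i l = 0) {B Λ : ℝ} (hΛ : ∀ l, k ≤ l → eig l ≤ Λ)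
    (hΛ0 : 0 ≤ Λ) (hB : 0 ≤ B)
    (h1 : ∀ v : Fin k → ℝ, (n : ℝ) / 64 * ∑ l, v l ^ 2
      ≤ ∑ i, (∑ l, v l * whiten eig (x i) l) ^ 2)
    (h2 : ∀ v : Fin n → ℝ, ∑ l ∈ Finset.Ico k p, eig l * (∑ i, v i * whiten eig (x i) l) ^ 2
        ≤ B * n * Λ * ∑ i, v i ^ 2) (u : SeqL2) :
    popNormSq eig u ≤ 128 / n * (∑ i, inner ℝ (x i) u ^ 2 + (B + 1) * n * Λ * ‖u‖ ^ 2) := by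
  have hn0 : (0 : ℝ) < n := by exact_mod_cast hn
  have hu2 := seqL2_summable_sq u
  set A : Fin n → ℝ := fun i => ∑ l ∈ Finset.range k, x i l * u l with hA
  set b : Fin n → ℝ := fun i => ∑ l ∈ Finset.Ico k p, x i l * u l with hb
  have hsplit : ∀ i, inner ℝ (x i) u = A i + b i := by
    intro i
    rw [seqL2_inner, tsum_eq_sum (s := Finset.range p) fun l hl => by
      rw [hx0 i l (by simpa using hl), zero_mul]]
    exact (Finset.sum_range_add_sum_Ico _ hk).symm
  -- the head
  have hhead : (n : ℝ) / 64 * ∑ l ∈ Finset.range k, eig l * u l ^ 2 ≤ ∑ i, A i ^ 2 := by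
    have h := h1 fun l => √(eig l) * u l
    have e1 : ∑ l : Fin k, (√(eig l) * u l) ^ 2 = ∑ l ∈ Finset.range k, eig l * u l ^ 2 := by
      rw [← Fin.sum_univ_eq_sum_range (fun l => eig l * u l ^ 2)]
      refine Finset.sum_congr rfl fun l _ => ?_
      rw [mul_pow, Real.sq_sqrt (hL.nonneg _)]
    have e2 : ∀ i, ∑ l : Fin k, √(eig l) * u l * whiten eig (x i) l = A i := by
      intro i
      simp only [hA]
      rw [← Fin.sum_univ_eq_sum_range (fun l => x i l * u l)]
      refine Finset.sum_congr rfl fun l _ => ?_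
      rw [← sqrt_mul_whiten hL (l.2.trans_le hk) (x i)]
      ring
    rw [e1] at h
    simpa only [e2] using h
  -- the tail, by duality
  have htail : ∑ i, b i ^ 2 ≤ B * n * Λ * ‖u‖ ^ 2 := by
    set S := ∑ i, b i ^ 2 with hS
    have hS0 : 0 ≤ S := Finset.sum_nonneg fun _ _ => sq_nonneg _
    have e : S = ∑ l ∈ Finset.Ico k p, u l * ∑ i, b i * x i l := by
      calc S = ∑ i, ∑ l ∈ Finset.Ico k p, b i * (x i l * u l) := by
            refine Finset.sum_congr rfl fun i _ => ?_
            rw [sq]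
            nth_rewrite 2 [hb]
            rw [Finset.mul_sum]
        _ = _ := by
            rw [Finset.sum_comm]
            refine Finset.sum_congr rfl fun l _ => ?_
            rw [Finset.mul_sum]
            exact Finset.sum_congr rfl fun i _ => by ring
    have hcs : S ^ 2 ≤ ‖u‖ ^ 2 * (B * n * Λ * S) := by
      nth_rewrite 1 [e]
      refine (Finset.sum_mul_sq_le_sq_mul_sq _ _ _).trans (mul_le_mul ?_ ?_
        (Finset.sum_nonneg fun _ _ => sq_nonneg _) (sq_nonneg _))
      · rw [seqL2_norm_sq]
        exact hu2.sum_le_tsum _ fun _ _ => sq_nonneg _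
      · refine le_trans (le_of_eq ?_) (h2 b)
        refine Finset.sum_congr rfl fun l hl => ?_
        have hl' := (Finset.mem_Ico.1 hl).2
        rw [← Real.sq_sqrt (hL.nonneg l), ← mul_pow, Finset.mul_sum]
        congr 1
        refine Finset.sum_congr rfl fun i _ => ?_
        rw [← sqrt_mul_whiten hL hl' (x i)]
        ring
    rcases hS0.eq_or_lt with h | h
    · rw [← h]; positivity
    · nlinarith
  have hpop : popNormSq eig u ≤ ∑ l ∈ Finset.range k, eig l * u l ^ 2 + Λ * ‖u‖ ^ 2 := by
    rw [popNormSq, ← (hL.summable_popNorm u).sum_add_tsum_nat_add k]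
    refine add_le_add le_rfl ?_
    have htailu : ∑' l, u (l + k) ^ 2 ≤ ‖u‖ ^ 2 := by
      rw [seqL2_norm_sq, ← hu2.sum_add_tsum_nat_add k]
      have h0 : 0 ≤ ∑ l ∈ Finset.range k, u l ^ 2 := Finset.sum_nonneg fun _ _ => sq_nonneg _
      linarith
    calc ∑' l, eig (l + k) * u (l + k) ^ 2 ≤ ∑' l, Λ * u (l + k) ^ 2 := by
          refine Summable.tsum_le_tsum (fun l => ?_)
            ((summable_nat_add_iff k).2 (hL.summable_popNorm u))
            (((summable_nat_add_iff k).2 hu2).mul_left _)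
          exact mul_le_mul_of_nonneg_right (hΛ _ (by omega)) (sq_nonneg _)
      _ = Λ * ∑' l, u (l + k) ^ 2 := tsum_mul_left
      _ ≤ _ := mul_le_mul_of_nonneg_left htailu hΛ0
  have hA2 : ∑ i, A i ^ 2 ≤ 2 * ∑ i, inner ℝ (x i) u ^ 2 + 2 * ∑ i, b i ^ 2 := by
    rw [Finset.mul_sum, Finset.mul_sum, ← Finset.sum_add_distrib]
    refine Finset.sum_le_sum fun i _ => ?_
    rw [hsplit i]
    nlinarith [sq_nonneg (A i + 2 * b i)]
  set D := ∑ l ∈ Finset.range k, eig l * u l ^ 2 with hD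
  have h5 : D ≤ 128 / n * (∑ i, inner ℝ (x i) u ^ 2 + B * n * Λ * ‖u‖ ^ 2) := by
    rw [div_mul_eq_mul_div, le_div_iff₀ hn0]
    nlinarith
  have h6 : Λ * ‖u‖ ^ 2 ≤ 128 / n * (n * Λ * ‖u‖ ^ 2) := by
    have e : 128 / (n : ℝ) * (n * Λ * ‖u‖ ^ 2) = 128 * (Λ * ‖u‖ ^ 2) := by field_simp
    have : 0 ≤ Λ * ‖u‖ ^ 2 := by positivity
    rw [e]; linarith
  calc _ ≤ 128 / n * (∑ i, inner ℝ (x i) u ^ 2 + B * n * Λ * ‖u‖ ^ 2)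
        + 128 / n * (n * Λ * ‖u‖ ^ 2) := hpop.trans (add_le_add h5 h6)
    _ = _ := by ring

/-- The base of the exponential bound for the probability that the samples are linearly
dependent. -/
def atomConst (G : ℝ) : ℝ := 1 - 1 / (8 * max 1 (4 * (2 * G) ^ 4))

lemma atomConst_pos_lt (G : ℝ) : 0 < atomConst G ∧ atomConst G < 1 := by
  have h : (1 : ℝ) ≤ max 1 (4 * (2 * G) ^ 4) := le_max_left _ _
  have h1 : 1 / (8 * max 1 (4 * (2 * G) ^ 4)) ≤ 1 / 8 :=
    one_div_le_one_div_of_le (by norm_num) (by linarith)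
  have h2 : 0 < 1 / (8 * max 1 (4 * (2 * G) ^ 4)) := by positivity
  unfold atomConst
  constructor <;> linarith

/-- The samples are linearly independent up to an event that is exponentially small in `p - n`. One
coordinate may have an atom of mass close to `1`, as it need not be centered. -/
lemma measure_not_linearIndependent_sample_le (hL : IsFeatureLaw (p : ℕ∞) eig μ)
    (hI : IndependentFeatures p eig μ G) (hG : 0 < G) (hp : 0 < p) (hn : n ≤ p) :
    sampleLaw n μ {X | ¬ LinearIndependent ℝ (fun (i : Fin n) (l : Fin p) => whiten eig (X i) l)}
      ≤ ENNReal.ofReal (n * atomConst G ^ (p - n)) := by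
  obtain ⟨l₀, hl₀, hcent⟩ := hI.exists_forall_ne_centered hL hp
  obtain ⟨hq0, hq1⟩ := atomConst_pos_lt G
  set q : ℝ≥0∞ := ENNReal.ofReal (atomConst G) with hq
  have hqpos : q ≠ 0 := by simpa [hq] using hq0
  have hqle : q ≤ 1 := by simpa [hq] using hq1.le
  set w : (ℕ → ℝ) → Fin p → ℝ := fun x l => whiten eig x l with hw
  have hwm : Measurable w := by fun_prop
  set ν : Fin p → Measure ℝ := fun l => μ.map fun x => whiten eig x l with hν
  have hνp : ∀ l, IsProbabilityMeasure (ν l) := fun l =>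
    Measure.isProbabilityMeasure_map (by fun_prop : Measurable _).aemeasurable
  have hπp : IsProbabilityMeasure (μ.map w) := Measure.isProbabilityMeasure_map hwm.aemeasurable
  have hπ : μ.map w = Measure.pi ν :=
    (hI.1.precomp (Fin.val_injective (n := p))).map_fun_eq_pi_map
      fun l => (by fun_prop : Measurable _).aemeasurable
  set Q : Fin p → ℝ≥0∞ := fun l => if (l : ℕ) = l₀ then 1 else q with hQ
  have hprod : ∏ l, Q l = q ^ (p - 1) := by
    rw [← Finset.mul_prod_erase _ _ (Finset.mem_univ ⟨l₀, hl₀⟩)]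
    have e : ∀ l ∈ Finset.univ.erase (⟨l₀, hl₀⟩ : Fin p), Q l = q := fun l hl => by
      simp only [hQ]
      rw [if_neg fun h => (Finset.mem_erase.1 hl).1 (Fin.ext h)]
    rw [Finset.prod_congr rfl e, Finset.prod_const, Finset.card_erase_of_mem (Finset.mem_univ _)]
    simp [hQ]
  have hatom : ∀ l y, ν l {y} ≤ Q l := by
    intro l y
    simp only [hQ]
    split_ifs with h
    · exact prob_le_one
    · have hb := hI.expSqBound hG l.2
      obtain ⟨h4, h4'⟩ := hb.fourth_moment_le
      have hv : ∫ x, whiten eig x l ^ 2 ∂μ = 1 := by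
        have := (integral_whiten_mul hL l.2 (j := l)).2
        rw [if_pos rfl] at this
        simpa only [sq] using this
      simp only [hν]
      rw [Measure.map_apply (by fun_prop) (measurableSet_singleton y)]
      exact measure_eq_le_of_fourth_moment (by fun_prop) h4 hb.integrable_sq hb.integrable_self
        (hcent l l.2 h) hv (le_max_left _ _) (h4'.trans (le_max_right _ _)) y
  have hqQ : ∀ l, q ≤ Q l := fun l => by
    simp only [hQ]; split_ifs
    · exact hqle
    · exact le_rfl
  have hV : ∀ V : Submodule ℝ (Fin p → ℝ), Module.finrank ℝ V + 1 ≤ n →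
      μ.map w V ≤ q ^ (p - n) := by
    intro V hV
    have h := measure_submodule_mul_pow_le hqle ν Q hatom hqQ V
    rw [hprod, ← hπ, show p - 1 = (p - 1 - Module.finrank ℝ V) + Module.finrank ℝ V by omega,
      pow_add] at h
    have h2 := (ENNReal.mul_le_mul_iff_left (pow_ne_zero _ hqpos)
      (ENNReal.pow_ne_top ENNReal.ofReal_ne_top)).1 h
    exact h2.trans (pow_le_pow_right_of_le_one' hqle (by omega))
  have hmain := measure_not_linearIndependent_le (μ.map w) n hV
  have hmap : (sampleLaw n μ).map (fun X i => w (X i)) = Measure.pi fun _ : Fin n => μ.map w :=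
    Measure.pi_map_pi fun _ => hwm.aemeasurable
  have hms : MeasurableSet {v : Fin n → Fin p → ℝ | ¬ LinearIndependent ℝ v} :=
    (isOpen_setOfPred_linearIndependent (𝕜 := ℝ)).measurableSet.compl
  rw [← hmap, Measure.map_apply (by fun_prop) hms] at hmain
  refine (le_of_eq rfl).trans (hmain.trans (le_of_eq ?_))
  rw [ENNReal.ofReal_mul (Nat.cast_nonneg n), ENNReal.ofReal_natCast, ENNReal.ofReal_pow hq0.le]

/-- Linearly independent samples have an invertible kernel matrix, also without a ridge. -/
lemma isUnit_gramRidge_det_of_linearIndependent (x : Fin n → SeqL2) {ρ : ℝ} (hρ : 0 ≤ ρ)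
    (h : LinearIndependent ℝ (fun (i : Fin n) (l : Fin p) => whiten eig (x i) l)) :
    IsUnit (gramRidge x ρ).det := by
  refine isUnit_det_of_pos fun c hc => ?_
  rw [← norm_comb_sq]
  have h2 : 0 ≤ ρ * ∑ i, c i ^ 2 := mul_nonneg hρ (Finset.sum_nonneg fun _ _ => sq_nonneg _)
  have h1 : comb x c ≠ 0 := by
    intro h0
    refine hc (funext (Fintype.linearIndependent_iff.1 h c ?_))
    ext l
    have h3 : comb x c l = 0 := by rw [h0]; rfl
    rw [comb_apply] at h3
    rw [Finset.sum_apply]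
    simp only [Pi.smul_apply, smul_eq_mul, whiten]
    have e : ∀ i, c i * (x i l / √(eig l)) = (x i l * c i) / √(eig l) := fun i => by ring
    simp only [e, ← Finset.sum_div, h3, zero_div, Pi.zero_apply]
  have : 0 < ‖comb x c‖ ^ 2 := by have := norm_pos_iff.2 h1; positivity
  linarith

end IndependentEvents

/-! ### The bias for independent features -/

section IndependentBias

variable {a r cE CE cR CR CT G η : ℝ}

/-- With `k ≈ n`, the transfer inequality for independent features holds with `t ≈ 1 / n` and
`ν ≈ n^{-a}`, outside an exponentially small event. -/
lemma exists_independent_transfer (ha : 0 < a) (hCE : 0 < CE) (hG : 0 < G) :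
    ∃ D c : ℝ, 0 < D ∧ 0 < c ∧ ∃ n₀ : ℕ, ∀ n ≥ n₀, ∀ (p : ℕ) (eig : ℕ → ℝ)
      (μ : Measure (ℕ → ℝ)), IsProbabilityMeasure μ → IsFeatureLaw (p : ℕ∞) eig μ →
      EigenDecay (p : ℕ∞) a cE CE eig → IndependentFeatures p eig μ G → n ≤ p →
      sampleLaw n μ {X | ¬ Transfer eig X (128 / n) (D * (n : ℝ) ^ (-a))}
        ≤ ENNReal.ofReal (4 * Real.exp (-(c * n))) := by
  obtain ⟨C₀, c, hC₀, hc, H⟩ := exists_head_lower hG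
  set C : ℝ := max C₀ 1 with hC
  have hC1 : 1 ≤ C := le_max_right _ _
  have hC0 : 0 < C := by linarith
  obtain ⟨n₀, hn₀⟩ := exists_nat_ge C
  have hB : 0 < tailConst G a := by
    have : 0 < Real.log 5 := Real.log_pos (by norm_num)
    unfold tailConst
    positivity
  refine ⟨(tailConst G a + 1) * (CE * (2 * C) ^ (1 + a)), min c 1, by positivity,
    lt_min hc one_pos, n₀, fun n hn p eig μ hμ hL hE hI hnp => ?_⟩
  have hCn : C ≤ n := hn₀.trans (by exact_mod_cast hn)
  have hn0 : (0 : ℝ) < n := by linarith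
  have hn0' : 0 < n := by exact_mod_cast hn0
  have hx1 : 1 ≤ (n : ℝ) / C := (one_le_div hC0).2 hCn
  set k := ⌊(n : ℝ) / C⌋₊ with hk
  have hkle : (k : ℝ) ≤ n / C := Nat.floor_le (by positivity)
  have hkge : (n : ℝ) / C / 2 ≤ k := half_le_floor hx1
  have hk1 : 1 ≤ k := Nat.le_floor (by simpa using hx1)
  have hCk : C * k ≤ n := by rw [le_div_iff₀ hC0] at hkle; linarith
  have hkn : k ≤ n := by
    have : (k : ℝ) ≤ n := (le_mul_of_one_le_left (Nat.cast_nonneg k) hC1).trans hCk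
    exact_mod_cast this
  have hk0 : (0 : ℝ) < k := by exact_mod_cast hk1
  have h1 := H hL hI (hkn.trans hnp)
    ((mul_le_mul_of_nonneg_right (le_max_left C₀ 1) hk0.le).trans hCk)
  have h2 := measure_not_tail_upper ha hCE hL hE hI hG (hn0'.trans_le hnp) hk1 hkn
  set Λ : ℝ := CE * (k : ℝ) ^ (-1 - a) with hΛ
  have hs := summable_eig ha hL hCE hE
  have hΛn : n * Λ ≤ CE * (2 * C) ^ (1 + a) * (n : ℝ) ^ (-a) := by
    calc n * Λ ≤ n * (CE * ((n : ℝ) / (2 * C)) ^ (-1 - a)) := by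
          refine mul_le_mul_of_nonneg_left (mul_le_mul_of_nonneg_left ?_ hCE.le) hn0.le
          refine Real.rpow_le_rpow_of_nonpos (by positivity) (le_trans (le_of_eq ?_) hkge)
            (by linarith)
          field_simp
      _ = _ := by
          rw [show -1 - a = -(1 + a) by ring, Real.div_rpow hn0.le (by positivity),
            Real.rpow_neg (by positivity : 0 ≤ 2 * C), div_inv_eq_mul,
            show -(1 + a) = -a - 1 by ring, Real.rpow_sub_one hn0.ne']
          field_simp
  refine le_trans (measure_mono_ae ?_) (((measure_union_le _ _).trans (add_le_add h1 h2)).trans ?_)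
  · have hx0 : ∀ᵐ x ∂μ, ∀ l, p ≤ l → x l = 0 := by
      filter_upwards [ae_eq_zero_of_eig_eq_zero hL] with x hx l hl
      exact hx l (hL.zero l (by exact_mod_cast hl))
    filter_upwards [ae_sample (n := n) (hL.ae_memℓp hs), ae_sample (n := n) hx0] with X hX2 hX0 hX
    by_contra hcon
    change X ∉ (_ ∪ _ : Set (Fin n → ℕ → ℝ)) at hcon
    simp only [Set.mem_union, Set.mem_ofPred_eq, not_or, not_not] at hcon
    obtain ⟨hc1, hc2⟩ := hcon
    refine hX ⟨fun i => ⟨X i, hX2 i⟩, rfl, fun u => ?_⟩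
    refine (transfer_of_head_tail (x := fun i => ⟨X i, hX2 i⟩) (Λ := Λ) hL (hkn.trans hnp) hn0'
      (fun i l hl => hX0 i l hl) (fun l hl => ?_) (by positivity) hB.le hc1 hc2 u).trans ?_
    · refine (eig_le_of_decay hL hCE hE l).trans (mul_le_mul_of_nonneg_left ?_ hCE.le)
      exact Real.rpow_le_rpow_of_nonpos hk0 (by have : (k : ℝ) ≤ l := by exact_mod_cast hl
                                                linarith) (by linarith)
    · refine mul_le_mul_of_nonneg_left (add_le_add le_rfl
        (mul_le_mul_of_nonneg_right ?_ (sq_nonneg _))) (by positivity)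
      rw [mul_assoc, mul_assoc]
      exact mul_le_mul_of_nonneg_left hΛn (by positivity)
  · rw [← ENNReal.ofReal_add (by positivity) (by positivity)]
    refine ENNReal.ofReal_le_ofReal ?_
    have e1 : Real.exp (-(c * n)) ≤ Real.exp (-(min c 1 * n)) := Real.exp_le_exp.2
      (neg_le_neg (mul_le_mul_of_nonneg_right (min_le_left _ _) hn0.le))
    have e2 : Real.exp (-n) ≤ Real.exp (-(min c 1 * n)) := Real.exp_le_exp.2
      (neg_le_neg (mul_le_of_le_one_left hn0.le (min_le_right _ _)))
    linarith

/-- With at least `A n` features, the smallest eigenvalue of the kernel matrix is at least of order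
`n^{-a}`, outside an exponentially small event. -/
lemma exists_independent_minEig (ha : 0 < a) (hcE : 0 < cE) (hG : 0 < G) :
    ∃ (A : ℕ) (c₀ c : ℝ), 1 ≤ A ∧ 0 < c₀ ∧ 0 < c ∧ ∀ n : ℕ, 1 ≤ n → ∀ (p : ℕ) (eig : ℕ → ℝ)
      (μ : Measure (ℕ → ℝ)), IsProbabilityMeasure μ → IsFeatureLaw (p : ℕ∞) eig μ →
      EigenDecay (p : ℕ∞) a cE CE eig → IndependentFeatures p eig μ G → A * n ≤ p →
      ∃ F : Finset ℕ, sampleLaw n μ {X | ¬ ∀ v : Fin n → ℝ,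
          c₀ * (n : ℝ) ^ (-a) * ∑ i, v i ^ 2 ≤ ∑ l ∈ F, (∑ i, v i * X i l) ^ 2}
        ≤ ENNReal.ofReal (2 * Real.exp (-(c * n))) := by
  obtain ⟨C, c, hC, hc, H⟩ := exists_columns_lower hG
  obtain ⟨B, hB⟩ := exists_nat_ge (max C 1)
  have hB1 : 1 ≤ B := by exact_mod_cast (le_max_right C 1).trans hB
  refine ⟨B + 1, cE * ((B : ℝ) + 1) ^ (-1 - a) / 64, c, by omega, by positivity, hc,
    fun n hn p eig μ hμ hL hE hI hp => ?_⟩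
  have hn0 : (0 : ℝ) < n := by exact_mod_cast hn
  have hN0 : 0 < (B + 1) * n := Nat.mul_pos (by omega) hn
  obtain ⟨l₀, hl₀, hcent⟩ := hI.exists_forall_ne_centered hL (hN0.trans_le hp)
  set s := (Finset.range ((B + 1) * n)).erase l₀ with hs
  have hmem : ∀ l ∈ s, l ≠ l₀ ∧ l < (B + 1) * n := fun l hl => by
    have := Finset.mem_erase.1 hl
    exact ⟨this.1, Finset.mem_range.1 this.2⟩
  have hcard : B * n ≤ s.card := by
    have h := Finset.pred_card_le_card_erase (s := Finset.range ((B + 1) * n)) (a := l₀)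
    rw [Finset.card_range, ← hs] at h
    have : (B + 1) * n = B * n + n := by ring
    omega
  have hcard' : (B : ℝ) * n ≤ s.card := by exact_mod_cast hcard
  have hcn : (n : ℝ) ≤ s.card := by
    have : n ≤ s.card := (Nat.le_mul_of_pos_left n hB1).trans hcard
    exact_mod_cast this
  refine ⟨s, (measure_mono ?_).trans ((H hL hI (n := n) s (fun l hl =>
    ⟨(hmem l hl).2.trans_le hp, hcent l ((hmem l hl).2.trans_le hp) (hmem l hl).1⟩)
    ((mul_le_mul_of_nonneg_right ((le_max_left C 1).trans hB) hn0.le).trans hcard')).trans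
    (ENNReal.ofReal_le_ofReal ?_))⟩
  · intro X hX hc'
    refine hX fun v => ?_
    set Λ : ℝ := cE * (((B : ℝ) + 1) * n) ^ (-1 - a) with hΛ
    have hv0 : 0 ≤ ∑ i, v i ^ 2 := Finset.sum_nonneg fun _ _ => sq_nonneg _
    calc _ = Λ * (n / 64 * ∑ i, v i ^ 2) := by
          rw [hΛ, Real.mul_rpow (by positivity) hn0.le, show (n : ℝ) ^ (-1 - a) = n ^ (-a) / n by
            rw [← Real.rpow_sub_one hn0.ne']; congr 1; ring]
          field_simp
      _ ≤ Λ * (s.card / 64 * ∑ i, v i ^ 2) := by gcongr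
      _ ≤ Λ * ∑ l ∈ s, (∑ i, v i * whiten eig (X i) l) ^ 2 :=
          mul_le_mul_of_nonneg_left (hc' v) (by positivity)
      _ ≤ _ := by
          rw [Finset.mul_sum]
          refine Finset.sum_le_sum fun l hl => ?_
          have hlp := (hmem l hl).2.trans_le hp
          have e : ∑ i, v i * X i l = √(eig l) * ∑ i, v i * whiten eig (X i) l := by
            rw [Finset.mul_sum]
            refine Finset.sum_congr rfl fun i _ => ?_
            rw [← sqrt_mul_whiten hL hlp (X i)]
            ring
          rw [e, mul_pow, Real.sq_sqrt (hL.nonneg l)]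
          refine mul_le_mul_of_nonneg_right (le_trans ?_ (hE l (by exact_mod_cast hlp)).1)
            (sq_nonneg _)
          refine mul_le_mul_of_nonneg_left (Real.rpow_le_rpow_of_nonpos (by positivity) ?_
            (by linarith)) hcE.le
          exact_mod_cast Nat.succ_le_of_lt (hmem l hl).2
  · have : Real.exp (-(c * s.card)) ≤ Real.exp (-(c * n)) := Real.exp_le_exp.2
      (neg_le_neg (mul_le_mul_of_nonneg_left hcn hc.le))
    linarith

/-- The coefficients of the target with indices between `n` and `A n`. -/
lemma sum_Ico_sq_le (hr : 0 < r) {p : ℕ∞} {θ : ℕ → ℝ} (hθ : TargetDecay p r CT θ) {n K A : ℕ}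
    (hn : 1 ≤ n) (hK : (K : ℕ∞) ≤ p) (hKA : K ≤ A * n) :
    ∑ l ∈ Finset.Ico n K, θ l ^ 2 ≤ CT ^ 2 * A * (n : ℝ) ^ (1 - 2 * r) := by
  have hn0 : (0 : ℝ) < n := by exact_mod_cast hn
  calc ∑ l ∈ Finset.Ico n K, θ l ^ 2 ≤ ∑ _l ∈ Finset.Ico n K, CT ^ 2 * (n : ℝ) ^ (-(2 * r)) := by
        refine Finset.sum_le_sum fun l hl => ?_
        obtain ⟨hl1, hl2⟩ := Finset.mem_Ico.1 hl
        have hl0 : (0 : ℝ) < l + 1 := by positivity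
        have := pow_le_pow_left₀ (abs_nonneg _)
          (hθ l (lt_of_lt_of_le (by exact_mod_cast hl2) hK)) 2
        rw [sq_abs, mul_pow, ← Real.rpow_natCast (_ ^ (-r)), ← Real.rpow_mul hl0.le] at this
        refine this.trans (mul_le_mul_of_nonneg_left ?_ (sq_nonneg _))
        rw [show -r * (2 : ℕ) = -(2 * r) by push_cast; ring]
        refine Real.rpow_le_rpow_of_nonpos hn0 ?_ (by linarith)
        have : (n : ℝ) ≤ l := by exact_mod_cast hl1
        linarith
    _ ≤ (A * n : ℝ) * (CT ^ 2 * (n : ℝ) ^ (-(2 * r))) := by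
        rw [Finset.sum_const, Nat.card_Ico, nsmul_eq_mul]
        refine mul_le_mul_of_nonneg_right ?_ (by positivity)
        exact_mod_cast (Nat.sub_le _ _).trans hKA
    _ = _ := by
        rw [sub_eq_add_neg, Real.rpow_add hn0, Real.rpow_one]
        ring

/-- Each of the four error terms is of the claimed order. -/
lemma independent_rate_le (hCR : 0 < CR) {x lamn W CW V CV L H E₀ D c : ℝ}
    (hx : 1 ≤ x) (hlam0 : 0 ≤ lamn) (hlam : lamn ≤ CR * x ^ (-a)) (hCW : 0 < CW) (hL : 1 ≤ L)
    (hW : W ≤ CW * L * x ^ max (2 + a - 2 * r) 0) (hCV : 0 < CV) (hV : V ≤ CV * x ^ (1 - 2 * r))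
    (hc : 0 < c) (hE₀ : 0 < E₀) (hD : 0 < D) (hH : 0 < H) :
    4 * ((128 / x * (D * x ^ (-a) + lamn)) ^ 2 * W + 128 / x * (D * x ^ (-a) + lamn) * V
      + 128 / x * (H * x ^ (1 - (a + 2 * r))
        + D * x ^ (-a) * (H * x ^ (1 - (a + 2 * r)) / (c * x ^ (-a))))
      + E₀ * x ^ (-(a + 2 * r)))
    ≤ 4 * ((128 * (D + CR)) ^ 2 * CW + 128 * (D + CR) * CV + 128 * H * (1 + D / c) + E₀) * L
      * x ^ (-min (2 * r + a) (2 * (1 + a))) := by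
  have hx0 : 0 < x := by linarith
  set e := min (2 * r + a) (2 * (1 + a)) with he
  have he1 : e ≤ a + 2 * r := (min_le_left _ _).trans (by linarith)
  have he2 : e = 2 + 2 * a - max (2 + a - 2 * r) 0 := by
    rcases max_cases (2 + a - 2 * r) 0 with ⟨h, h'⟩ | ⟨h, h'⟩
    · rw [h, he, min_eq_left (by linarith)]; ring
    · rw [h, he, min_eq_right (by linarith)]; ring
  have hmono : x ^ (-(a + 2 * r)) ≤ L * x ^ (-e) :=
    (Real.rpow_le_rpow_of_exponent_le hx (by linarith)).trans
      (le_mul_of_one_le_left (by positivity) hL)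
  have t0 : 128 / x * (D * x ^ (-a) + lamn) ≤ 128 * (D + CR) * x ^ (-1 - a) := by
    calc _ ≤ 128 / x * ((D + CR) * x ^ (-a)) := by
          refine mul_le_mul_of_nonneg_left (by linarith) (by positivity)
      _ = _ := by
          rw [show -1 - a = -a - 1 by ring, Real.rpow_sub_one hx0.ne']
          ring
  have t00 : 0 ≤ 128 / x * (D * x ^ (-a) + lamn) := by positivity
  have t1 : (128 / x * (D * x ^ (-a) + lamn)) ^ 2 * W
      ≤ (128 * (D + CR)) ^ 2 * CW * (L * x ^ (-e)) := by
    calc _ ≤ (128 * (D + CR) * x ^ (-1 - a)) ^ 2 * (CW * L * x ^ max (2 + a - 2 * r) 0) := by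
          refine (mul_le_mul_of_nonneg_left hW (sq_nonneg _)).trans ?_
          exact mul_le_mul_of_nonneg_right (pow_le_pow_left₀ t00 t0 2) (by positivity)
      _ = (128 * (D + CR)) ^ 2 * CW * (L * ((x ^ (-1 - a)) ^ 2 * x ^ max (2 + a - 2 * r) 0)) := by
          ring
      _ = _ := by
          rw [← Real.rpow_natCast (x ^ _), ← Real.rpow_mul hx0.le, ← Real.rpow_add hx0]
          congr 3
          rw [he2]
          push_cast
          ring
  have t2 : 128 / x * (D * x ^ (-a) + lamn) * V ≤ 128 * (D + CR) * CV * (L * x ^ (-e)) := by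
    calc _ ≤ 128 * (D + CR) * x ^ (-1 - a) * (CV * x ^ (1 - 2 * r)) := by
          refine (mul_le_mul_of_nonneg_left hV t00).trans ?_
          exact mul_le_mul_of_nonneg_right t0 (by positivity)
      _ = 128 * (D + CR) * CV * (x ^ (-1 - a) * x ^ (1 - 2 * r)) := by ring
      _ ≤ _ := by
          refine mul_le_mul_of_nonneg_left (le_trans (le_of_eq ?_) hmono) (by positivity)
          rw [← Real.rpow_add hx0]
          congr 1; ring
  have t3 : 128 / x * (H * x ^ (1 - (a + 2 * r))
        + D * x ^ (-a) * (H * x ^ (1 - (a + 2 * r)) / (c * x ^ (-a))))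
      ≤ 128 * H * (1 + D / c) * (L * x ^ (-e)) := by
    have e1 : x ^ (1 - (a + 2 * r)) = x * x ^ (-(a + 2 * r)) := by
      rw [sub_eq_add_neg, Real.rpow_add hx0, Real.rpow_one]
    calc _ = 128 * H * (1 + D / c) * x ^ (-(a + 2 * r)) := by
          have : x ^ (-a) ≠ 0 := by positivity
          rw [e1]
          field_simp
      _ ≤ _ := mul_le_mul_of_nonneg_left hmono (by positivity)
  have t4 := mul_le_mul_of_nonneg_left hmono hE₀.le
  calc _ ≤ 4 * ((128 * (D + CR)) ^ 2 * CW * (L * x ^ (-e))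
        + 128 * (D + CR) * CV * (L * x ^ (-e)) + 128 * H * (1 + D / c) * (L * x ^ (-e))
        + E₀ * (L * x ^ (-e))) := by linarith
    _ = _ := by ring

/-- In finite dimension the target function is a finite sum. -/
lemma ae_target_eq_sum {p : ℕ} {eig θ : ℕ → ℝ} {μ : Measure (ℕ → ℝ)} [IsProbabilityMeasure μ]
    {f : (ℕ → ℝ) → ℝ} (hL : IsFeatureLaw (p : ℕ∞) eig μ) (hf : IsTargetFunction μ θ f) :
    (∫⁻ x : ℕ → ℝ, ENNReal.ofReal ((f x - ∑ k ∈ Finset.range p, x k * θ k) ^ 2) ∂μ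
      ≤ ENNReal.ofReal 0) ∧ ∀ᵐ x ∂μ, f x = ∑ k ∈ Finset.range p, x k * θ k := by
  have h := hL.lintegral_target_tail_le hf p (E := 0) fun m => by
    refine le_of_eq (Finset.sum_eq_zero fun l hl => ?_)
    rw [hL.zero l (by exact_mod_cast (Finset.mem_Ico.1 hl).1), zero_mul]
  refine ⟨h, ?_⟩
  rw [ENNReal.ofReal_zero, nonpos_iff_eq_zero,
    lintegral_eq_zero_iff' ((aemeasurable_target_tail hf p).pow_const 2).ennreal_ofReal] at h
  filter_upwards [h] with x hx
  simp only [Pi.zero_apply, ENNReal.ofReal_eq_zero] at hx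
  exact sub_eq_zero.1 (pow_eq_zero_iff two_ne_zero |>.1 (le_antisymm hx (sq_nonneg _)))

/-- `n qᵐ` is exponentially small if `m` is at least a positive multiple of `n`. -/
lemma exists_mul_pow_le_exp {q η : ℝ} (hq0 : 0 < q) (hq1 : q < 1) (hη : 1 < η) :
    ∃ c : ℝ, 0 < c ∧ ∃ n₀ : ℕ, ∀ n ≥ n₀, ∀ p : ℕ, n ≤ p → η * n < p →
      n * q ^ (p - n) ≤ Real.exp (-(c * n)) := by
  have hl : 0 < -Real.log q := neg_pos.2 (Real.log_neg hq0 hq1)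
  set c : ℝ := -Real.log q * (η - 1) / 2 with hc
  have hc0 : 0 < c := by
    have : 0 < η - 1 := by linarith
    positivity
  have ht := (Real.tendsto_pow_mul_exp_neg_atTop_nhds_zero 1).comp
    (tendsto_natCast_atTop_atTop.const_mul_atTop hc0)
  obtain ⟨n₀, hn₀⟩ := eventually_atTop.1 (ht.eventually (gt_mem_nhds hc0))
  refine ⟨c, hc0, n₀, fun n hn p hnp hp => ?_⟩
  have h := hn₀ n hn
  simp only [Function.comp_apply, pow_one] at h
  have h1 : n * Real.exp (-(c * n)) ≤ 1 := by
    have : c * (n * Real.exp (-(c * n))) ≤ c * 1 := by linarith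
    exact le_of_mul_le_mul_left this hc0
  have h2 : q ^ (p - n) ≤ Real.exp (-(c * n)) * Real.exp (-(c * n)) := by
    rw [← Real.exp_add, ← Real.exp_log (pow_pos hq0 _), Real.log_pow, Nat.cast_sub hnp]
    refine Real.exp_le_exp.2 ?_
    have : -Real.log q * ((η - 1) * n) ≤ -Real.log q * (p - n) :=
      mul_le_mul_of_nonneg_left (by linarith) hl.le
    rw [hc]
    linarith
  calc n * q ^ (p - n) ≤ n * (Real.exp (-(c * n)) * Real.exp (-(c * n))) :=
        mul_le_mul_of_nonneg_left h2 (Nat.cast_nonneg n)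
    _ = n * Real.exp (-(c * n)) * Real.exp (-(c * n)) := by ring
    _ ≤ _ := mul_le_of_le_one_left (Real.exp_pos _).le h1

/-- The bias bound for independent features: the target is cut at `J = n` and at `K = min {p, A n}`. -/
theorem independent_bias_bound (ha : 0 < a) (hr : 0 < r) {b : EReal}
    (hb : ((1 + a : ℝ) : EReal) ≤ b) (hcE : 0 < cE) (hCE : 0 < CE) (hcR : 0 < cR) (hCR : 0 < CR)
    (hCT : 0 < CT) (hG : 0 < G) (hη : 1 < η) :
    ∃ c₁ : ℝ, 0 < c₁ ∧ ∃ q : ℕ, (2 * r ≠ a + 2 → q = 0) ∧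
      ∀ δ : ℝ, 0 < δ → δ < 1 → ∃ K : ℝ, 0 < K ∧ ∀ n p : ℕ, 2 ≤ n → η * n < p →
      ∀ (lam : ℝ) (eig θ : ℕ → ℝ) (μ : Measure (ℕ → ℝ)) (f : (ℕ → ℝ) → ℝ),
        IsProbabilityMeasure μ → IsFeatureLaw p eig μ → EigenDecay p a cE CE eig →
        TargetDecay p r CT θ → RidgeDecay b cR CR n lam → IndependentFeatures p eig μ G →
        IsTargetFunction μ θ f →
        1 - δ - 3 * Real.exp (-c₁ * n) ≤ (sampleLaw n μ).real
          {X | bias μ f lam X ≤ ENNReal.ofReal (K * Real.log n ^ q *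
            (n : ℝ) ^ (-min (2 * r + a) (2 * (1 + a))))} := by
  obtain ⟨D, c₁, hD, hc₁, n₁, H₁⟩ := exists_independent_transfer (cE := cE) ha hCE hG
  obtain ⟨A, c₀, c₂, hA, hc₀, hc₂, H₂⟩ := exists_independent_minEig (CE := CE) ha hcE hG
  obtain ⟨c₃, hc₃, n₃, H₃⟩ := exists_mul_pow_le_exp (atomConst_pos_lt G).1 (atomConst_pos_lt G).2 hη
  obtain ⟨CW, hCW, HW⟩ := exists_sum_range_rpow_le (2 + a - 2 * r)
  set c : ℝ := min c₁ (min c₂ c₃) with hc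
  have hc0 : 0 < c := lt_min hc₁ (lt_min hc₂ hc₃)
  obtain ⟨n₄, hn₄⟩ := exists_nat_ge (2 * Real.log 2 / c)
  -- for `n ≥ n₄`, replacing the factor `6` by `3` costs at most half of the exponent
  set N : ℕ := max (max n₁ n₃) (max n₄ 3) with hN
  have hN3 : 3 ≤ N := (le_max_right _ _).trans (le_max_right _ _)
  have hN0 : (0 : ℝ) < N := by exact_mod_cast (by omega : 0 < N)
  set E₀ : ℝ := CE * CT ^ 2 / (a + 2 * r) with hE₀
  have hE₀0 : 0 < E₀ := by positivity
  have hA0 : (0 : ℝ) < A := by exact_mod_cast hA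
  set c' : ℝ := min (c / 2) (1 / N) with hc'
  refine ⟨c', lt_min (by positivity) (by positivity),
    if 2 + a - 2 * r = 0 then 1 else 0, fun h => if_neg fun h0 => h (by linarith),
    fun δ hδ hδ1 => ?_⟩
  refine ⟨4 * ((128 * (D + CR)) ^ 2 * (CT ^ 2 / cE * CW) + 128 * (D + CR) * (CT ^ 2 * A)
    + 128 * (E₀ / δ) * (1 + D / c₀) + E₀), by positivity, ?_⟩
  intro n p hn hp lam eig θ μ f hμ hL hE hθ hR hI hf
  have hn0 : (0 : ℝ) < n := by positivity
  have hn1 : (1 : ℝ) ≤ n := by exact_mod_cast (by omega : 1 ≤ n)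
  rcases lt_or_ge n N with hnN | hnN
  · -- for small `n` the asserted lower bound is not positive
    have h1 : c' * n ≤ 1 := by
      calc c' * n ≤ 1 / N * N := mul_le_mul (min_le_right _ _) (by exact_mod_cast hnN.le) hn0.le
            (by positivity)
        _ = 1 := by field_simp
    have h2 : Real.exp (-1) ≤ Real.exp (-c' * n) := Real.exp_le_exp.2 (by linarith)
    have h3 : 1 ≤ 3 * Real.exp (-1) := by
      rw [Real.exp_neg, ← div_eq_mul_inv, one_le_div (Real.exp_pos _)]
      exact Real.exp_one_lt_three.le
    exact le_trans (by linarith) measureReal_nonneg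
  have hn₁ : n₁ ≤ n := ((le_max_left _ _).trans (le_max_left _ _)).trans hnN
  have hn₃ : n₃ ≤ n := ((le_max_right _ _).trans (le_max_left _ _)).trans hnN
  have hn₄' : n₄ ≤ n := ((le_max_left _ _).trans (le_max_right _ _)).trans hnN
  have hlog1 : 1 ≤ Real.log n := by
    rw [Real.le_log_iff_exp_le hn0]
    exact Real.exp_one_lt_three.le.trans (by exact_mod_cast hN3.trans hnN)
  have hnp : n ≤ p := by
    have : (n : ℝ) < p := (le_mul_of_one_le_left hn0.le hη.le).trans_lt hp
    exact_mod_cast this.le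
  have hT := H₁ n hn₁ p eig μ hμ hL hE hI hnp
  have hs := summable_eig ha hL hCE hE
  obtain ⟨hlam0, hlam⟩ := ridge_bounds hb hcR hCR (by omega) hR
  have hL1 : 1 ≤ Real.log n ^ (if 2 + a - 2 * r = 0 then 1 else 0) := by
    split_ifs <;> simp [hlog1]
  have hpos : ∀ l < n, 0 < eig l := fun l hl => eig_pos_of_lt hL (hl.trans_le hnp)
  have hW : ∑ k ∈ Finset.range n, θ k ^ 2 / eig k
      ≤ CT ^ 2 / cE * CW * Real.log n ^ (if 2 + a - 2 * r = 0 then 1 else 0)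
        * (n : ℝ) ^ max (2 + a - 2 * r) 0 := by
    refine (sum_sq_div_eig_le hcE hE hθ (by exact_mod_cast hnp)).trans ?_
    rw [mul_assoc, mul_assoc, ← mul_assoc CW]
    exact mul_le_mul_of_nonneg_left (HW n hn) (by positivity)
  have hexp : ∀ γ, c ≤ γ → Real.exp (-(γ * n)) ≤ Real.exp (-(c * n)) := fun γ hγ =>
    Real.exp_le_exp.2 (neg_le_neg (mul_le_mul_of_nonneg_right hγ hn0.le))
  have hx1 := hexp c₁ (min_le_left _ _)
  have hx2 := hexp c₂ ((min_le_right _ _).trans (min_le_left _ _))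
  have hx3 := hexp c₃ ((min_le_right _ _).trans (min_le_right _ _))
  have hfinal : 6 * Real.exp (-(c * n)) ≤ 3 * Real.exp (-c' * n) := by
    have h1 : c' * n ≤ c / 2 * n := mul_le_mul_of_nonneg_right (min_le_left _ _) hn0.le
    have h2 : 2 * Real.log 2 ≤ n * c := by
      rw [← div_le_iff₀ hc0]
      exact hn₄.trans (by exact_mod_cast hn₄')
    have h3 : 2 * Real.exp (-(c * n)) ≤ Real.exp (-c' * n) := by
      nth_rewrite 1 [← Real.exp_log (two_pos : (0 : ℝ) < 2)]
      rw [← Real.exp_add]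
      exact Real.exp_le_exp.2 (by linarith)
    linarith
  rcases le_or_gt (A * n) p with hAp | hAp
  · -- many features: the kernel matrix is well conditioned
    set E : ℝ := E₀ * (n : ℝ) ^ (-(a + 2 * r)) with hEd
    have hE0 : 0 < E := by positivity
    have hnK : n ≤ A * n := Nat.le_mul_of_pos_left n hA
    have hEf := hL.lintegral_target_tail_le hf (A * n) (E := E) fun m =>
      (sum_target_tail_le ha hr hL hCE hE hθ (by omega) m).trans
        (mul_le_mul_of_nonneg_left (Real.rpow_le_rpow_of_nonpos hn0 (by exact_mod_cast hnK)
          (by linarith)) hE₀0.le)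
    have hη' := measure_sum_sq_ge_le (n := n) (aemeasurable_target_tail hf (A * n)) hE0 hδ
      (by omega) hEf
    obtain ⟨F, hF⟩ := H₂ n (by omega) p eig μ hμ hL hE hI hAp
    have hfin := le_measureReal_of_compl_le (n := n) (μ := μ)
      (c := 4 * Real.exp (-(c₁ * n)) + 2 * Real.exp (-(c₂ * n)) + δ)
      (S := {X | bias μ f lam X ≤ ENNReal.ofReal (4 * ((128 * (D + CR)) ^ 2 * (CT ^ 2 / cE * CW)
        + 128 * (D + CR) * (CT ^ 2 * A) + 128 * (E₀ / δ) * (1 + D / c₀) + E₀)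
        * Real.log n ^ (if 2 + a - 2 * r = 0 then 1 else 0) *
            (n : ℝ) ^ (-min (2 * r + a) (2 * (1 + a))))})
      (by positivity) (((measure_union_le _ _).trans
        (add_le_add ((measure_union_le _ _).trans (add_le_add hT hF)) hη')).trans (le_of_eq (by
          rw [← ENNReal.ofReal_add (by positivity) (by positivity),
            ← ENNReal.ofReal_add (by positivity) hδ.le])))
      (ae_of_all _ fun X hX => ?_)
    · linarith
    simp only [Set.mem_union, Set.mem_ofPred_eq, not_or, not_not, not_le] at hX
    obtain ⟨⟨hX1, hX2⟩, hX3⟩ := hX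
    refine (bias_le_of_minEig hL hs hlam0 (by positivity) (by positivity) hX1 hnK hpos hE0.le hEf
      (by positivity) hX2 hX3.le).trans (ENNReal.ofReal_le_ofReal ?_)
    have e : n * E / δ = E₀ / δ * (n : ℝ) ^ (1 - (a + 2 * r)) := by
      rw [hEd, sub_eq_add_neg, Real.rpow_add hn0, Real.rpow_one]
      ring
    rw [e]
    exact independent_rate_le hCR hn1 (by positivity) hlam (by positivity) hL1 hW (by positivity)
      (sum_Ico_sq_le hr hθ (by omega) (by exact_mod_cast hAp) le_rfl) hc₀ hE₀0 hD (by positivity)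
  · -- few features: the target is a combination of `p` coordinates, without a tail
    obtain ⟨hEf, hfs⟩ := ae_target_eq_sum hL hf
    have hli := measure_not_linearIndependent_sample_le hL hI hG (by omega) hnp
    have hfin := le_measureReal_of_compl_le (n := n) (μ := μ)
      (c := 4 * Real.exp (-(c₁ * n)) + Real.exp (-(c₃ * n)))
      (S := {X | bias μ f lam X ≤ ENNReal.ofReal (4 * ((128 * (D + CR)) ^ 2 * (CT ^ 2 / cE * CW)
        + 128 * (D + CR) * (CT ^ 2 * A) + 128 * (E₀ / δ) * (1 + D / c₀) + E₀)
        * Real.log n ^ (if 2 + a - 2 * r = 0 then 1 else 0) *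
            (n : ℝ) ^ (-min (2 * r + a) (2 * (1 + a))))})
      (by positivity) ((measure_union_le _ _).trans (le_trans (add_le_add hT
        (hli.trans (ENNReal.ofReal_le_ofReal (H₃ n hn₃ p hnp hp)))) (le_of_eq (by
          rw [← ENNReal.ofReal_add (by positivity) (by positivity)]))))
      ?_
    · have := Real.exp_pos (-(c * n))
      linarith
    filter_upwards [ae_sample (n := n) hfs] with X hXf hX
    simp only [Set.mem_union, Set.mem_ofPred_eq, not_or, not_not] at hX
    obtain ⟨⟨x, rfl, hT'⟩, hX2⟩ := hX
    refine (bias_le_of_transfer (h := fun _ => 0) (Q := 0) (K := p) hL hs hlam0 x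
      (isUnit_gramRidge_det_of_linearIndependent x (by positivity) hX2) (by positivity)
      (by positivity) hT' hnp hpos le_rfl (fun i => (sub_eq_zero.2 (hXf i)).symm) (by simp) le_rfl
      hEf).trans (ENNReal.ofReal_le_ofReal ?_)
    refine le_trans ?_ (independent_rate_le (H := E₀ / δ) hCR hn1 (by positivity) hlam
      (by positivity) hL1 hW (by positivity) (sum_Ico_sq_le hr hθ (by omega) le_rfl hAp.le) hc₀
      hE₀0 hD (by positivity))
    have h1 : 0 ≤ 128 / (n : ℝ) * (E₀ / δ * (n : ℝ) ^ (1 - (a + 2 * r))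
        + D * (n : ℝ) ^ (-a) * (E₀ / δ * (n : ℝ) ^ (1 - (a + 2 * r)) / (c₀ * (n : ℝ) ^ (-a)))) := by
      positivity
    have h2 : 0 ≤ E₀ * (n : ℝ) ^ (-(a + 2 * r)) := by positivity
    have h3 : 128 / (n : ℝ) * (∑ _i : Fin n, (0 : ℝ) ^ 2 + D * (n : ℝ) ^ (-a) * 0) = 0 := by simp
    rw [h3]
    linarith

end IndependentBias

end RidgeRegression

end

theorem mainTheorem4 (a r : ℝ) (ha : 0 < a) (hr : 0 < r) (b : EReal)
    (hb : ((1 + a : ℝ) : EReal) ≤ b)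
    (cE CE cR CR CT : ℝ) (hcE : 0 < cE) (hCE : 0 < CE) (hcR : 0 < cR) (hCR : 0 < CR)
    (hCT : 0 < CT) :
    -- generic features
    (∀ α β κ : ℝ, 0 < α → 0 < β → 0 < κ →
      ∃ M : ℝ, 0 < M ∧ ∃ q : ℕ, ∀ δ : ℝ, 0 < δ → δ < 1 → ∃ K : ℝ, 0 < K ∧
        ∀ (n : ℕ) (p : ℕ∞), 2 ≤ n →
          ENNReal.ofReal (κ * (n : ℝ) ^ 2 * Real.log n) ≤ (p : ℝ≥0∞) →
        ∀ (lam : ℝ) (eig θ : ℕ → ℝ) (μ : Measure (ℕ → ℝ)) (f : (ℕ → ℝ) → ℝ),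
          IsProbabilityMeasure μ →
          RidgeRegression.IsFeatureLaw p eig μ →
          RidgeRegression.EigenDecay p a cE CE eig →
          RidgeRegression.TargetDecay p r CT θ →
          RidgeRegression.RidgeDecay b cR CR n lam →
          RidgeRegression.GenericFeatures p eig μ α β →
          RidgeRegression.IsTargetFunction μ θ f →
          1 - δ - M / Real.log n ≤
            (RidgeRegression.sampleLaw n μ).real
              {X | RidgeRegression.bias μ f lam X ≤
                ENNReal.ofReal (K * Real.log n ^ q *
                  (n : ℝ) ^ (-max (min (2 * (r - a)) (2 - a)) 0))}) ∧
    -- independent features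
    (∀ G η : ℝ, 0 < G → 1 < η →
      ∃ c₁ : ℝ, 0 < c₁ ∧ ∃ q : ℕ, (2 * r ≠ a + 2 → q = 0) ∧
        ∀ δ : ℝ, 0 < δ → δ < 1 → ∃ K : ℝ, 0 < K ∧
        ∀ n p : ℕ, 2 ≤ n → η * n < p →
        ∀ (lam : ℝ) (eig θ : ℕ → ℝ) (μ : Measure (ℕ → ℝ)) (f : (ℕ → ℝ) → ℝ),
          IsProbabilityMeasure μ →
          RidgeRegression.IsFeatureLaw p eig μ →
          RidgeRegression.EigenDecay p a cE CE eig →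
          RidgeRegression.TargetDecay p r CT θ →
          RidgeRegression.RidgeDecay b cR CR n lam →
          RidgeRegression.IndependentFeatures p eig μ G →
          RidgeRegression.IsTargetFunction μ θ f →
          1 - δ - 3 * Real.exp (-c₁ * n) ≤
            (RidgeRegression.sampleLaw n μ).real
              {X | RidgeRegression.bias μ f lam X ≤
                ENNReal.ofReal (K * Real.log n ^ q *
                  (n : ℝ) ^ (-min (2 * r + a) (2 * (1 + a))))}) :=
  ⟨fun _ _ _ hα hβ hκ =>
      RidgeRegression.generic_bias_bound ha hr hb hcE hCE hcR hCR hCT hα hβ hκ,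
    fun _ _ hG hη =>
      RidgeRegression.independent_bias_bound ha hr hb hcE hCE hcR hCR hCT hG hη⟩
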